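/- All knots are smooth oriented knots in $S^3=\partial D^4$, taken up to smooth ambient isotopy. For a knot $K$, let $\gamma_4(K)$ be the minimal first Betti number $b_1(\Sigma)=\dim H_1(\Sigma;\mathbb Z/2)$ of a compact connected non-orientable surface $\Sigma$ that is smoothly and properly embedded in $D^4$ (with $\Sigma\cap S^3=\partial\Sigma$, transversely) and has $\partial\Sigma=K$. In particular, slice knots are not assigned the value $0$ by convention. A knot is slice if it bounds a smoothly and properly embedded disk in $D^4$. A non-oriented band move on an oriented knot $K$ consists of attaching to $K$ an oriented band $h=[0,1]\times[0,1]$, smoothly embedded in $S^3$ and meeting $K$ exactly in $[0,1]\times\partial[0,1]$, such that the orientation of $K$ agrees with the boundary orientation of $h$ on exactly one of the two arcs $[0,1]\times\{0\}$ and $[0,1]\times\{1\}$, and then replacing the arcs $[0,1]\times\partial[0,1]$ of $K$ by the arcs $\partial[0,1]\times[0,1]$ (and rounding the corners). Two knots are related by a non-oriented band move if one of them is obtained from the other, up to isotopy, by such a move. **Proposition.** Let $K$ and $K'$ be knots related by a non-oriented band move. Then $$\gamma_4(K)\le\gamma_4(K')+1 .$$ If moreover $K'$ is slice, then $\gamma_4(K)=1$.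 -/

import Mathlib

namespace FourGenus

open scoped ContDiff Manifold

noncomputable section

/-- Euclidean four-space. -/
abbrev E4 : Type := EuclideanSpace ℝ (Fin 4)

/-- The unit three-sphere, with Mathlib's smooth structure. -/
abbrev S3 : Type := Metric.sphere (0 : EuclideanSpace ℝ (Fin (3 + 1))) 1

/-- The closed unit four-ball, whose boundary is `S3`. -/
abbrev D4 : Set E4 := Metric.closedBall 0 1

/-- An oriented smooth knot: a smooth embedding of the circle `ℝ / ℤ` in the three-sphere,
given as a `1`-periodic regular curve that is injective modulo the period. -/
structure Knot where
  toFun : ℝ → S3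
  contDiff : ContDiff ℝ ∞ (fun t => (toFun t : E4))
  periodic : Function.Periodic toFun 1
  injective_mod : ∀ s t : ℝ, toFun s = toFun t → ∃ n : ℤ, t = s + n
  deriv_ne_zero : ∀ t : ℝ, deriv (fun s => (toFun s : E4)) t ≠ 0

/-- The underlying unoriented knot. -/
def Knot.carrier (K : Knot) : Set S3 := Set.range K.toFun

/-- Smooth ambient isotopy of subsets of the three-sphere. -/
def AmbientIsotopic (A B : Set S3) : Prop :=
  ∃ H : ℝ → (S3 ≃ₘ^∞⟮𝓡 3, 𝓡 3⟯ S3),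
    ContMDiff (𝓘(ℝ, ℝ).prod (𝓡 3)) (𝓡 3) ∞ (fun p : ℝ × S3 => H p.1 p.2) ∧
    (∀ x, H 0 x = x) ∧ H 1 '' A = B

/-! ### Band moves -/

/-- The flat square `[0,1] × [0,1] × {0}` in three-space. -/
def flatSquare : Set (EuclideanSpace ℝ (Fin 3)) :=
  {u | u 0 ∈ Set.Icc (0 : ℝ) 1 ∧ u 1 ∈ Set.Icc (0 : ℝ) 1 ∧ u 2 = 0}

/-- A band `h = [0,1] × [0,1]` attached to `K` along `[0,1] × ∂[0,1]`. The band is given together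
with a thickening: a smooth chart `ψ` of the three-sphere in which the band is the flat square
and in which `K` consists of the lines containing the edges `[0,1] × {0}` and `[0,1] × {1}`. -/
structure IsAttachedBand (K : Knot) (ψ : OpenPartialHomeomorph S3 (EuclideanSpace ℝ (Fin 3))) :
    Prop where
  smooth : ψ ∈ IsManifold.maximalAtlas (𝓡 3) ∞ S3
  square_subset : flatSquare ⊆ ψ.target
  mem_knot_iff : ∀ x ∈ ψ.source, x ∈ K.carrier ↔ (ψ x 1 = 0 ∨ ψ x 1 = 1) ∧ ψ x 2 = 0

/-- The velocity of `K` in the direction of the first coordinate of the band. -/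
def bandVelocity (K : Knot) (ψ : OpenPartialHomeomorph S3 (EuclideanSpace ℝ (Fin 3))) (t : ℝ) :
    ℝ :=
  deriv (fun s => ψ (K.toFun s) 0) t

/-- `K` runs at time `t` through the edge `[0,1] × {c}` of the band. -/
def OnEdge (K : Knot) (ψ : OpenPartialHomeomorph S3 (EuclideanSpace ℝ (Fin 3))) (c t : ℝ) : Prop :=
  K.toFun t ∈ ψ.source ∧ ψ (K.toFun t) ∈ flatSquare ∧ ψ (K.toFun t) 1 = c

/-- The band is non-oriented: the orientation of `K` agrees with the boundary orientation of the
oriented square on exactly one of the two edges `[0,1] × {0}`, `[0,1] × {1}`.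
The boundary orientation is `+∂/∂x` on `[0,1] × {0}` and `-∂/∂x` on `[0,1] × {1}`, so agreement on
the first edge and disagreement on the second means positive velocity on both. -/
def IsNonOriented (K : Knot) (ψ : OpenPartialHomeomorph S3 (EuclideanSpace ℝ (Fin 3))) : Prop :=
  ((∀ t, OnEdge K ψ 0 t → 0 < bandVelocity K ψ t) ∧
    (∀ t, OnEdge K ψ 1 t → 0 < bandVelocity K ψ t)) ∨
  ((∀ t, OnEdge K ψ 0 t → bandVelocity K ψ t < 0) ∧
    (∀ t, OnEdge K ψ 1 t → bandVelocity K ψ t < 0))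

/-- A profile for rounding corners. The curve `(2y - 1)² = g x` in the unit square consists of two
smooth U-shaped arcs: one joins `(0,0)` to `(0,1)` and turns at `(a, 1/2)`, the other one joins
`(1,0)` to `(1,1)` and turns at `(b, 1/2)`; they fit smoothly to the lines `y = 0` and `y = 1`
outside the square. They are the edges `{0} × [0,1]` and `{1} × [0,1]`, with the corners rounded
inside the square. -/
structure IsRoundingProfile (g : ℝ → ℝ) (a b : ℝ) : Prop where
  zero_lt : 0 < a
  lt : a < b
  lt_one : b < 1
  contDiff : ContDiff ℝ ∞ g
  eq_one : ∀ x, x ≤ 0 ∨ 1 ≤ x → g x = 1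
  le_one : ∀ x, g x ≤ 1
  pos : ∀ x, x < a ∨ b < x → 0 < g x
  neg : ∀ x, a < x → x < b → g x < 0
  deriv_left : deriv g a < 0
  deriv_right : 0 < deriv g b

/-- The result of surgery on `K` along the band: the arcs `[0,1] × ∂[0,1]` of `K` are replaced by
the arcs `∂[0,1] × [0,1]`, with rounded corners. -/
def bandSurgery (K : Knot) (ψ : OpenPartialHomeomorph S3 (EuclideanSpace ℝ (Fin 3)))
    (g : ℝ → ℝ) : Set S3 :=
  {x | x ∈ K.carrier ∧ ¬ (x ∈ ψ.source ∧ ψ x ∈ flatSquare)} ∪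
  {x | x ∈ ψ.source ∧ ψ x ∈ flatSquare ∧ (2 * ψ x 1 - 1) ^ 2 = g (ψ x 0)}

/-- `K'` is obtained from `K` by a non-oriented band move (knots are taken up to isotopy). -/
def NonOrientedBandMove (K K' : Knot) : Prop :=
  ∃ (ψ : OpenPartialHomeomorph S3 (EuclideanSpace ℝ (Fin 3))) (g : ℝ → ℝ) (a b : ℝ),
    IsAttachedBand K ψ ∧ IsNonOriented K ψ ∧ IsRoundingProfile g a b ∧
    AmbientIsotopic (bandSurgery K ψ g) K'.carrier

/-- One of the two knots is obtained from the other one by a non-oriented band move. -/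
def RelatedByNonOrientedBandMove (K K' : Knot) : Prop :=
  NonOrientedBandMove K K' ∨ NonOrientedBandMove K' K

/-! ### Surfaces in the four-ball -/

/-- A compact connected surface, smoothly and properly embedded in the four-ball. Near each of its
points there are smooth coordinates of four-space in which the ball is the half-space
`0 ≤ u₀` and the surface is the half-plane `0 ≤ u₀, u₂ = u₃ = 0`. Away from the sphere, the
coordinates have `u₀ > 0`; on the sphere `u₀ = 0`. Hence the boundary of the surface is
its intersection with the sphere, and this intersection is transverse. -/
structure IsProperSurface (F : Set E4) : Prop where
  subset_ball : F ⊆ D4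
  isCompact : IsCompact F
  isConnected : IsConnected F
  chart : ∀ p ∈ F, ∃ φ : OpenPartialHomeomorph E4 E4, p ∈ φ.source ∧
    ContDiffOn ℝ ∞ φ φ.source ∧ ContDiffOn ℝ ∞ φ.symm φ.target ∧
    (∀ x ∈ φ.source, x ∈ D4 ↔ 0 ≤ φ x 0) ∧
    (∀ x ∈ φ.source, x ∈ F ↔ 0 ≤ φ x 0 ∧ φ x 2 = 0 ∧ φ x 3 = 0)

/-- The boundary of the surface `F` in the ball is the knot `K`. -/
def HasBoundary (F : Set E4) (K : Knot) : Prop :=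
  F ∩ Metric.sphere 0 1 = Subtype.val '' K.carrier

/-- The tangent plane of a surface at a point (at boundary points as well). -/
def tangentPlane (F : Set E4) (p : E4) : Submodule ℝ E4 :=
  Submodule.span ℝ (tangentConeAt ℝ F p)

/-- A surface is orientable if it carries a continuous nowhere vanishing two-form. -/
def IsOrientable (F : Set E4) : Prop :=
  ∃ η : E4 → E4 [⋀^Fin 2]→L[ℝ] ℝ, ContinuousOn η F ∧
    ∀ p ∈ F, ∃ v ∈ tangentPlane F p, ∃ w ∈ tangentPlane F p, η p ![v, w] ≠ 0

/-- The first Betti number, the dimension of the first singular homology group. For the surfaces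
below, which are compact with non-empty boundary, the integral homology is free, so that all
coefficient fields give the same number; we use the field with two elements. -/
def firstBetti (X : Type) [TopologicalSpace X] : ℕ∞ :=
  Cardinal.toENat (Module.rank (ZMod 2)
    (((AlgebraicTopology.singularHomologyFunctor (ModuleCat.{0} (ZMod 2)) 1).obj
      (ModuleCat.of (ZMod 2) (ZMod 2))).obj (TopCat.of X)))

/-- The non-orientable smooth four-genus: the minimal first Betti number of a non-orientable
surface, smoothly and properly embedded in the four-ball, with boundary `K`. -/
def gamma4 (K : Knot) : ℕ∞ :=
  sInf {n | ∃ F : Set E4, IsProperSurface F ∧ ¬ IsOrientable F ∧ HasBoundary F K ∧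
    firstBetti F = n}

/-- A knot is slice if it bounds a smoothly and properly embedded disk in the four-ball. -/
def IsSlice (K : Knot) : Prop :=
  ∃ F : Set E4, IsProperSurface F ∧ HasBoundary F K ∧
    Nonempty (F ≃ₜ Metric.closedBall (0 : EuclideanSpace ℝ (Fin 2)) 1)

end

end FourGenus

/-! Let `F` be any proper surface bounded by `K'`. Running the band move through a collar of the
sphere, that is, attaching a band to `F`, gives a surface `F'` bounded by `K`. Attaching a band
raises the first Betti number by at most one. A non-oriented band makes `F'` non-orientable whether
or not `F` was orientable. A minimal `F` gives the inequality, and a slice disk gives `gamma4 K ≤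
1`. Conversely, a surface with vanishing first Betti number is orientable, so `1 ≤ gamma4 K` for
every knot (`one_le_gamma4`).

Construction. `exists_conical` makes `F` a cone over its boundary near the sphere, and
`exists_ballDiffeo_of_ambientIsotopic` absorbs the isotopies in a norm preserving diffeomorphism. In
band coordinates `x, y` and depth `t = 1 - ‖p‖`, the saddle is the hypersurface `(2y - 1)² = 1 -
s(t)(1 - g(x))` inside the slice where the third band coordinate vanishes; `s = 0` gives the knot
and `s = 1` the surgered knot. The resulting `swapSurface` is smooth by `SwapSetting.regular`. An
increasing or a decreasing `s` treats the two directions of the band move alike.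

Betti number. Functionals on mod 2 homology are represented by additive, homotopy invariant
functions on paths (`PathCocycle`). The new surface is covered by the part outside the changed core,
which retracts into the image of `F`, and by a part near the band on which all cocycles are trivial.
The overlap has at most two path components, and a Mayer–Vietoris argument
(`PathCocycle.isCoboundary_or_of_two_components`, `firstBetti_le_add_one`) gives the bound.

Orientability. A nowhere vanishing two-form would have constant sign near the band
(`SwapSetting.bandForm_mul_pos`) and along the collar of the knot away from the band; these signs
are incompatible with a non-oriented band (`SwapSetting.not_isOrientable`). For the lower bound, the
unit Plücker vectors of the tangent planes form a double cover, which has a section when every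
cocycle is a coboundary (`exists_continuous_section`). -/

namespace FourGenus

open CategoryTheory Simplicial AlgebraicTopology

/-! ### First homology modulo two through cocycles on paths -/

section Homology

/-- A one-cocycle with values in `ℤ/2`, as a function on paths. -/
structure PathCocycle (X : Type) [TopologicalSpace X] where
  toFun : ∀ ⦃x y : X⦄, Path x y → ZMod 2
  map_trans : ∀ ⦃x y z : X⦄ (γ : Path x y) (γ' : Path y z), toFun (γ.trans γ') = toFun γ + toFun γ'
  map_homotopic : ∀ ⦃x y : X⦄ (γ₁ γ₂ : Path x y), γ₁.Homotopic γ₂ → toFun γ₁ = toFun γ₂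

/-- A cocycle is a coboundary if it is the difference of the values of a function at the ends. -/
def PathCocycle.IsCoboundary {X : Type} [TopologicalSpace X] (c : PathCocycle X) : Prop :=
  ∃ f : X → ZMod 2, ∀ ⦃x y : X⦄ (γ : Path x y), c.toFun γ = f x + f y

/-- The sum of two cocycles. -/
def PathCocycle.add {X : Type} [TopologicalSpace X] (c c' : PathCocycle X) : PathCocycle X where
  toFun _ _ γ := c.toFun γ + c'.toFun γ
  map_trans _ _ _ γ γ' := by rw [c.map_trans, c'.map_trans]; ring
  map_homotopic _ _ γ₁ γ₂ h := by rw [c.map_homotopic γ₁ γ₂ h, c'.map_homotopic γ₁ γ₂ h]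

/-- The pull-back of a cocycle. -/
def PathCocycle.comap {X Y : Type} [TopologicalSpace X] [TopologicalSpace Y] (c : PathCocycle X)
    (i : C(Y, X)) : PathCocycle Y where
  toFun _ _ γ := c.toFun (γ.map i.continuous)
  map_trans _ _ _ γ γ' := by rw [Path.map_trans, c.map_trans]
  map_homotopic _ _ γ γ' h := c.map_homotopic _ _ (h.map i)

variable {X : Type} [TopologicalSpace X]

/-- The set of singular simplices. -/
noncomputable abbrev singularSet (X : Type) [TopologicalSpace X] : SSet.{0} := TopCat.toSSet.obj (TopCat.of X)

/-- The field with two elements as a module over itself. -/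
abbrev coeffs : ModuleCat.{0} (ZMod 2) := ModuleCat.of (ZMod 2) (ZMod 2)

/-- The singular chains modulo two. -/
noncomputable abbrev chains (X : Type) [TopologicalSpace X] : ChainComplex (ModuleCat.{0} (ZMod 2)) ℕ :=
  (singularSet X).chainComplex coeffs

/-- First singular homology modulo two. -/
noncomputable abbrev H1 (X : Type) [TopologicalSpace X] : ModuleCat.{0} (ZMod 2) := (chains X).homology 1

/-- The map in first homology that is induced by a continuous map. -/
noncomputable abbrev H1map {X Y : Type} [TopologicalSpace X] [TopologicalSpace Y] (i : C(Y, X)) : H1 Y ⟶ H1 X :=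
  SSet.homologyMap (TopCat.toSSet.map (TopCat.ofHom i)) coeffs 1

lemma firstBetti_eq (X : Type) [TopologicalSpace X] :
    firstBetti X = Cardinal.toENat (Module.rank (ZMod 2) (H1 X)) := rfl

/-- The singular simplex of a continuous map. -/
noncomputable def simplexOf {n : ℕ} (T : C(stdSimplex ℝ (Fin (n + 1)), X)) : (singularSet X) _⦋n⦌ :=
  (TopCat.toSSetObjEquiv (TopCat.of X) (Opposite.op ⦋n⦌)).symm T

/-- The face map of standard simplices. -/
noncomputable def simplexFace {n : ℕ} (i : Fin (n + 2)) :
    C(stdSimplex ℝ (Fin (n + 1)), stdSimplex ℝ (Fin (n + 2))) :=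
  ⟨stdSimplex.map i.succAbove, stdSimplex.continuous_map _⟩

lemma δ_simplexOf {n : ℕ} (T : C(stdSimplex ℝ (Fin (n + 2)), X)) (i : Fin (n + 2)) :
    (singularSet X).δ i (simplexOf T) = simplexOf (T.comp (simplexFace i)) := rfl

lemma simplexOf_surjective {n : ℕ} (σ : (singularSet X) _⦋n⦌) :
    ∃ T : C(stdSimplex ℝ (Fin (n + 1)), X), σ = simplexOf T :=
  ⟨_, ((TopCat.toSSetObjEquiv (TopCat.of X) (Opposite.op ⦋n⦌)).symm_apply_apply σ).symm⟩

/-- The singular simplex of a path. -/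
noncomputable def simplexMapOfPath {x y : X} (γ : Path x y) : C(stdSimplex ℝ (Fin 2), X) :=
  γ.toContinuousMap.comp (stdSimplexHomeomorphUnitInterval : C(stdSimplex ℝ (Fin 2), unitInterval))

/-- The path of a singular one-simplex. -/
noncomputable def pathOfSimplexMap (T : C(stdSimplex ℝ (Fin 2), X)) :
    Path (T (stdSimplexHomeomorphUnitInterval.symm 0))
      (T (stdSimplexHomeomorphUnitInterval.symm 1)) where
  toFun t := T (stdSimplexHomeomorphUnitInterval.symm t)
  continuous_toFun := by fun_prop
  source' := rfl
  target' := rfl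

lemma simplexMapOfPath_pathOfSimplexMap (T : C(stdSimplex ℝ (Fin 2), X)) :
    simplexMapOfPath (pathOfSimplexMap T) = T := by
  ext s
  exact congrArg T (stdSimplexHomeomorphUnitInterval.symm_apply_apply s)

lemma simplexFace_apply (i : Fin 3) (s : stdSimplex ℝ (Fin 2)) (j : Fin 3) :
    simplexFace (n := 1) i s j =
      (if i.succAbove 0 = j then s 0 else 0) + (if i.succAbove 1 = j then s 1 else 0) := by
  change (stdSimplex.map i.succAbove s : Fin 3 → ℝ) j = _
  rw [stdSimplex.map_coe, FunOnFinite.linearMap_apply_apply, Finset.sum_filter, Fin.sum_univ_two]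

/-- A function on singular one-simplices that satisfies the cocycle identity. -/
def IsSimplicialCocycle (c : C(stdSimplex ℝ (Fin 2), X) → ZMod 2) : Prop :=
  ∀ T : C(stdSimplex ℝ (Fin 3), X), c (T.comp (simplexFace 0)) + c (T.comp (simplexFace 1)) +
    c (T.comp (simplexFace 2)) = 0

/-- A continuous map from the triangle, given by barycentric coordinates. -/
noncomputable def triangleMap {Y : Type} [TopologicalSpace Y] (f : C(Y, X))
    (g : (Fin 3 → ℝ) → Y) (hg : Continuous g) : C(stdSimplex ℝ (Fin 3), X) :=
  f.comp ⟨fun s => g (fun i => s i), hg.comp continuous_subtype_val⟩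

/-- The three faces of a constant triangle are the same edge, and `3a = 0` forces `a = 0` modulo
two. -/
lemma IsSimplicialCocycle.map_const {c : C(stdSimplex ℝ (Fin 2), X) → ZMod 2}
    (hc : IsSimplicialCocycle c) (x : X) : c (ContinuousMap.const _ x) = 0 := by
  have := hc (ContinuousMap.const _ x)
  simp only [ContinuousMap.const_comp] at this
  generalize c (ContinuousMap.const _ x) = a at this
  revert this; revert a; decide

lemma stdSimplex_fst (s : stdSimplex ℝ (Fin 2)) : s 0 = 1 - s 1 := by
  have := stdSimplex.add_eq_one s
  linarith

lemma simplexMapOfPath_apply {x y : X} (γ : Path x y) (s : stdSimplex ℝ (Fin 2)) :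
    simplexMapOfPath γ s = γ.extend (s 1) := by
  rw [γ.extend_apply ⟨stdSimplex.zero_le s 1, stdSimplex.le_one s 1⟩]
  rfl

/-- The identity is applied to the degenerate triangle obtained from the affine map that sends the
vertices to the times `0, 1/2, 1` of the composite path. -/
lemma IsSimplicialCocycle.map_trans {c : C(stdSimplex ℝ (Fin 2), X) → ZMod 2}
    (hc : IsSimplicialCocycle c) {x y z : X} (γ : Path x y) (γ' : Path y z) :
    c (simplexMapOfPath (γ.trans γ')) = c (simplexMapOfPath γ) + c (simplexMapOfPath γ') := by
  have h := hc (triangleMap (⟨(γ.trans γ').extend, (γ.trans γ').continuous_extend⟩ : C(ℝ, X))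
    (fun v => v 1 / 2 + v 2) (by fun_prop))
  have h0 : (triangleMap (⟨(γ.trans γ').extend, (γ.trans γ').continuous_extend⟩ : C(ℝ, X))
    (fun v => v 1 / 2 + v 2) (by fun_prop)).comp (simplexFace 0) = simplexMapOfPath γ' := by
    ext s
    have h1 := stdSimplex.zero_le s 1
    have h2 := stdSimplex.le_one s 1
    rw [simplexMapOfPath_apply]
    change (γ.trans γ').extend (simplexFace 0 s 1 / 2 + simplexFace 0 s 2) = _
    rw [simplexFace_apply, simplexFace_apply]
    have e : ((if (0 : Fin 3).succAbove 0 = 1 then s 0 else 0) +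
      (if (0 : Fin 3).succAbove 1 = 1 then s 1 else 0)) / 2 +
      ((if (0 : Fin 3).succAbove 0 = 2 then s 0 else 0) +
      (if (0 : Fin 3).succAbove 1 = 2 then s 1 else 0)) = 1 / 2 + s 1 / 2 := by
      rw [if_pos (by decide), if_neg (by decide), if_neg (by decide), if_pos (by decide),
        stdSimplex_fst]; ring
    rw [e, Path.extend_trans_of_half_le _ _ (by linarith)]
    congr 1; ring
  have h1 : (triangleMap (⟨(γ.trans γ').extend, (γ.trans γ').continuous_extend⟩ : C(ℝ, X))
    (fun v => v 1 / 2 + v 2) (by fun_prop)).comp (simplexFace 1) =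
      simplexMapOfPath (γ.trans γ') := by
    ext s
    rw [simplexMapOfPath_apply]
    change (γ.trans γ').extend (simplexFace 1 s 1 / 2 + simplexFace 1 s 2) = _
    rw [simplexFace_apply, simplexFace_apply]
    rw [if_neg (by decide), if_neg (by decide), if_neg (by decide), if_pos (by decide)]
    congr 1; ring
  have h2 : (triangleMap (⟨(γ.trans γ').extend, (γ.trans γ').continuous_extend⟩ : C(ℝ, X))
    (fun v => v 1 / 2 + v 2) (by fun_prop)).comp (simplexFace 2) = simplexMapOfPath γ := by
    ext s
    have h1 := stdSimplex.zero_le s 1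
    have h2 := stdSimplex.le_one s 1
    rw [simplexMapOfPath_apply]
    change (γ.trans γ').extend (simplexFace 2 s 1 / 2 + simplexFace 2 s 2) = _
    rw [simplexFace_apply, simplexFace_apply]
    rw [if_neg (by decide), if_pos (by decide), if_neg (by decide), if_neg (by decide)]
    rw [Path.extend_trans_of_le_half _ _ (by linarith)]
    congr 1; ring
  rw [h0, h1, h2] at h
  generalize c (simplexMapOfPath γ') = a at *
  generalize c (simplexMapOfPath γ) = b at *
  generalize c (simplexMapOfPath (γ.trans γ')) = d at *
  revert a b d; decide

/-- The square of the homotopy is cut along its diagonal into two triangles. The diagonal occurs in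
both and cancels, the two constant sides contribute zero, and the two paths remain. -/
lemma IsSimplicialCocycle.map_homotopic {c : C(stdSimplex ℝ (Fin 2), X) → ZMod 2}
    (hc : IsSimplicialCocycle c) {x y : X} (γ γ' : Path x y) (h : γ.Homotopic γ') :
    c (simplexMapOfPath γ) = c (simplexMapOfPath γ') := by
  obtain ⟨H⟩ := h
  let G : C(ℝ × ℝ, X) := ⟨fun p => H (Set.projIcc 0 1 zero_le_one p.1,
    Set.projIcc 0 1 zero_le_one p.2), by fun_prop⟩
  have G0 (t : ℝ) : G (0, t) = γ.extend t := by
    simp [G, Path.extend, Set.IccExtend]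
  have G1 (t : ℝ) : G (1, t) = γ'.extend t := by
    simp [G, Path.extend, Set.IccExtend]
  have Gx (t : ℝ) : G (t, 0) = x := by simp [G]
  have Gy (t : ℝ) : G (t, 1) = y := by simp [G]
  have k1 := hc (triangleMap G (fun v => (v 2, v 1 + v 2)) (by fun_prop))
  have k2 := hc (triangleMap G (fun v => (v 1 + v 2, v 2)) (by fun_prop))
  have e10 : (triangleMap G (fun v => (v 2, v 1 + v 2)) (by fun_prop)).comp (simplexFace 0) =
      ContinuousMap.const _ y := by
    ext s
    change G (simplexFace 0 s 2, simplexFace 0 s 1 + simplexFace 0 s 2) = y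
    rw [← Gy (simplexFace 0 s 2)]
    congr 2
    rw [simplexFace_apply, simplexFace_apply, if_pos (by decide), if_neg (by decide),
      if_neg (by decide), if_pos (by decide), stdSimplex_fst]; ring
  have e12 : (triangleMap G (fun v => (v 2, v 1 + v 2)) (by fun_prop)).comp (simplexFace 2) =
      simplexMapOfPath γ := by
    ext s
    change G (simplexFace 2 s 2, simplexFace 2 s 1 + simplexFace 2 s 2) = _
    rw [simplexMapOfPath_apply, ← G0, simplexFace_apply, simplexFace_apply, if_neg (by decide),
      if_neg (by decide), if_neg (by decide), if_pos (by decide)]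
    congr 2 <;> ring
  have e20 : (triangleMap G (fun v => (v 1 + v 2, v 2)) (by fun_prop)).comp (simplexFace 0) =
      simplexMapOfPath γ' := by
    ext s
    change G (simplexFace 0 s 1 + simplexFace 0 s 2, simplexFace 0 s 2) = _
    rw [simplexMapOfPath_apply, ← G1, simplexFace_apply, simplexFace_apply, if_pos (by decide),
      if_neg (by decide), if_neg (by decide), if_pos (by decide), stdSimplex_fst]
    congr 2 <;> ring
  have e22 : (triangleMap G (fun v => (v 1 + v 2, v 2)) (by fun_prop)).comp (simplexFace 2) =
      ContinuousMap.const _ x := by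
    ext s
    change G (simplexFace 2 s 1 + simplexFace 2 s 2, simplexFace 2 s 2) = x
    rw [← Gx (simplexFace 2 s 1 + simplexFace 2 s 2)]
    congr 2
    rw [simplexFace_apply, if_neg (by decide), if_neg (by decide), add_zero]
  have e11 : (triangleMap G (fun v => (v 2, v 1 + v 2)) (by fun_prop)).comp (simplexFace 1) =
      (triangleMap G (fun v => (v 1 + v 2, v 2)) (by fun_prop)).comp (simplexFace 1) := by
    ext s
    change G (simplexFace 1 s 2, simplexFace 1 s 1 + simplexFace 1 s 2) =
      G (simplexFace 1 s 1 + simplexFace 1 s 2, simplexFace 1 s 2)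
    have : simplexFace (n := 1) 1 s 1 = 0 := by
      rw [simplexFace_apply, if_neg (by decide), if_neg (by decide), add_zero]
    rw [this, zero_add]
  rw [e10, e12, e11, hc.map_const] at k1
  rw [e20, e22, hc.map_const] at k2
  have key : ∀ a b d : ZMod 2, 0 + d + b = 0 → a + d + 0 = 0 → b = a := by decide
  exact key _ _ _ k1 k2

/-- The path cocycle of a simplicial cocycle. -/
noncomputable def IsSimplicialCocycle.pathCocycle {c : C(stdSimplex ℝ (Fin 2), X) → ZMod 2}
    (hc : IsSimplicialCocycle c) : PathCocycle X where
  toFun _ _ γ := c (simplexMapOfPath γ)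
  map_trans _ _ _ := hc.map_trans
  map_homotopic _ _ := hc.map_homotopic

lemma PathCocycle.toFun_cast (c : PathCocycle X) {x y x' y' : X} (γ : Path x y) (hx : x' = x)
    (hy : y' = y) : c.toFun (γ.cast hx hy) = c.toFun γ := by
  subst hx hy; rfl

/-- The triangle is contractible, so the two routes along its boundary from the first to the last
vertex are homotopic. -/
lemma PathCocycle.isSimplicialCocycle (c : PathCocycle X) :
    IsSimplicialCocycle (fun T => c.toFun (pathOfSimplexMap T)) := by
  intro T
  have : ContractibleSpace (stdSimplex ℝ (Fin 3)) :=
    (convex_stdSimplex ℝ (Fin 3)).contractibleSpace ⟨_, single_mem_stdSimplex ℝ (0 : Fin 3)⟩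
  let p (i : Fin 3) := pathOfSimplexMap (simplexFace (n := 1) i)
  have ev (i j : Fin 3) (a b : unitInterval) (h : ∀ k : Fin 3,
      (if i.succAbove 0 = k then 1 - (a : ℝ) else 0) + (if i.succAbove 1 = k then (a : ℝ) else 0) =
      (if j.succAbove 0 = k then 1 - (b : ℝ) else 0) + (if j.succAbove 1 = k then (b : ℝ) else 0)) :
      simplexFace (n := 1) i (stdSimplexHomeomorphUnitInterval.symm a) =
      simplexFace (n := 1) j (stdSimplexHomeomorphUnitInterval.symm b) := by
    apply stdSimplex.ext; funext k
    rw [simplexFace_apply, simplexFace_apply]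
    exact h k
  have e1 := ev 2 1 0 0 (by intro k; fin_cases k <;> simp [Fin.succAbove])
  have e2 := ev 2 0 1 0 (by intro k; fin_cases k <;> simp [Fin.succAbove])
  have e3 := ev 0 1 1 1 (by intro k; fin_cases k <;> simp [Fin.succAbove])
  have hom : ((p 2).trans ((p 0).cast e2 e3.symm)).Homotopic ((p 1).cast e1 rfl) :=
    SimplyConnectedSpace.paths_homotopic _ _
  have h := c.map_homotopic _ _ (hom.map T)
  rw [Path.map_trans, c.map_trans] at h
  have h0 : c.toFun (((p 0).cast e2 e3.symm).map T.continuous) =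
      c.toFun (pathOfSimplexMap (T.comp (simplexFace 0))) :=
    c.toFun_cast (pathOfSimplexMap (T.comp (simplexFace 0))) (congrArg T e2) (congrArg T e3.symm)
  have h1 : c.toFun (((p 1).cast e1 rfl).map T.continuous) =
      c.toFun (pathOfSimplexMap (T.comp (simplexFace 1))) :=
    c.toFun_cast (pathOfSimplexMap (T.comp (simplexFace 1))) (congrArg T e1) rfl
  have h2 : c.toFun ((p 2).map T.continuous) =
      c.toFun (pathOfSimplexMap (T.comp (simplexFace 2))) := rfl
  rw [h0, h1, h2] at h
  have key : ∀ a b d : ZMod 2, d + a = b → a + b + d = 0 := by decide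
  exact key _ _ _ h

/-- The value of a cochain on a singular simplex. -/
noncomputable def cochainCoeff {n : ℕ} (φ : (chains X).X n ⟶ coeffs)
    (T : C(stdSimplex ℝ (Fin (n + 1)), X)) : ZMod 2 :=
  ((singularSet X).ιChainComplex (simplexOf T) ≫ φ).hom (1 : ZMod 2)

lemma cochain_ext {n : ℕ} {φ φ' : (chains X).X n ⟶ coeffs}
    (h : ∀ T, cochainCoeff φ T = cochainCoeff φ' T) : φ = φ' := by
  refine SSet.chainComplex_hom_ext fun σ => ?_
  obtain ⟨T, rfl⟩ := simplexOf_surjective σ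
  refine ModuleCat.hom_ext (LinearMap.ext_ring ?_)
  exact h T

/-- The cochain with given values on simplices. -/
noncomputable def cochainOf {n : ℕ} (c : C(stdSimplex ℝ (Fin (n + 1)), X) → ZMod 2) :
    (chains X).X n ⟶ coeffs :=
  Limits.Cofan.IsColimit.desc ((singularSet X).isColimitChainComplexXCofan coeffs n)
    (fun σ => ModuleCat.ofHom (c (TopCat.toSSetObjEquiv (TopCat.of X) (Opposite.op ⦋n⦌) σ) •
      (LinearMap.id : ZMod 2 →ₗ[ZMod 2] ZMod 2)))

lemma cochainCoeff_cochainOf {n : ℕ} (c : C(stdSimplex ℝ (Fin (n + 1)), X) → ZMod 2)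
    (T : C(stdSimplex ℝ (Fin (n + 1)), X)) : cochainCoeff (cochainOf c) T = c T := by
  unfold cochainCoeff cochainOf
  have : (singularSet X).ιChainComplex (simplexOf T) ≫
      Limits.Cofan.IsColimit.desc ((singularSet X).isColimitChainComplexXCofan coeffs n)
    (fun σ => ModuleCat.ofHom (c (TopCat.toSSetObjEquiv (TopCat.of X) (Opposite.op ⦋n⦌) σ) •
      (LinearMap.id : ZMod 2 →ₗ[ZMod 2] ZMod 2))) = ModuleCat.ofHom (c T •
      (LinearMap.id : ZMod 2 →ₗ[ZMod 2] ZMod 2)) := by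
    have := Limits.Cofan.IsColimit.fac ((singularSet X).isColimitChainComplexXCofan coeffs n)
      (fun σ => ModuleCat.ofHom (c (TopCat.toSSetObjEquiv (TopCat.of X) (Opposite.op ⦋n⦌) σ) •
      (LinearMap.id : ZMod 2 →ₗ[ZMod 2] ZMod 2))) (simplexOf T)
    rw [simplexOf, Equiv.apply_symm_apply] at this
    exact this
  rw [this]
  simp

/-- Removes the signs from the boundary formula, since they play no role modulo two. -/
lemma neg_one_pow_zsmul (n : ℕ) {M N : ModuleCat.{0} (ZMod 2)} (f : M ⟶ N) :
    ((-1 : ℤ) ^ n) • f = f := by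
  have h2 : ∀ g : M ⟶ N, -g = g := fun g => by
    refine ModuleCat.hom_ext (LinearMap.ext fun x => ?_)
    change -(g.hom x) = g.hom x
    rw [← neg_one_smul (ZMod 2), show (-1 : ZMod 2) = 1 by decide, one_smul]
  rcases neg_one_pow_eq_or ℤ n with h | h <;> simp [h, h2]

lemma cochainCoeff_d_comp {n : ℕ} (φ : (chains X).X n ⟶ coeffs)
    (T : C(stdSimplex ℝ (Fin (n + 2)), X)) :
    cochainCoeff ((chains X).d (n + 1) n ≫ φ) T =
      ∑ i, cochainCoeff φ (T.comp (simplexFace i)) := by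
  unfold cochainCoeff
  rw [SSet.ιChainComplex_d_assoc]
  simp only [neg_one_pow_zsmul, Preadditive.sum_comp, δ_simplexOf]
  simp [ModuleCat.hom_sum]

lemma isSimplicialCocycle_cochainCoeff {φ : (chains X).X 1 ⟶ coeffs}
    (h : (chains X).d 2 1 ≫ φ = 0) : IsSimplicialCocycle (cochainCoeff φ) := by
  intro T
  have := cochainCoeff_d_comp φ T
  rw [h, Fin.sum_univ_three] at this
  rw [← this]
  simp [cochainCoeff]

/-- A functional on first homology is represented by a path cocycle. -/
def Represents (ℓ : H1 X ⟶ coeffs) (c : PathCocycle X) : Prop :=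
  ∃ φ : (chains X).X 1 ⟶ coeffs, (∀ ⦃x y : X⦄ (γ : Path x y), cochainCoeff φ (simplexMapOfPath γ) =
    c.toFun γ) ∧ (chains X).iCycles 1 ≫ φ = (chains X).homologyπ 1 ≫ ℓ

/-- The map induced by `f` on `V / ker f` is injective, and over a field it has a left inverse. -/
lemma exists_functional_comp {V W : Type} [AddCommGroup V] [AddCommGroup W] [Module (ZMod 2) V]
    [Module (ZMod 2) W] (f : V →ₗ[ZMod 2] W) (g : V →ₗ[ZMod 2] ZMod 2)
    (h : LinearMap.ker f ≤ LinearMap.ker g) : ∃ k : W →ₗ[ZMod 2] ZMod 2, k ∘ₗ f = g := by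
  obtain ⟨s, hs⟩ := LinearMap.exists_leftInverse_of_injective
    ((LinearMap.ker f).liftQ f le_rfl) (Submodule.ker_liftQ_eq_bot _ _ _ le_rfl)
  refine ⟨(LinearMap.ker f).liftQ g h ∘ₗ s, LinearMap.ext fun v => ?_⟩
  have := LinearMap.congr_fun hs (Submodule.Quotient.mk v)
  simp at this
  simp [this]

/-- The functional is pulled back to cycles and extended to all chains, which is possible over a
field. The extension kills boundaries, hence is a cocycle. -/
lemma exists_represents (ℓ : H1 X ⟶ coeffs) : ∃ c, Represents ℓ c := by
  have hmono : LinearMap.ker ((chains X).iCycles 1).hom = ⊥ :=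
    (ModuleCat.mono_iff_ker_eq_bot _).1 inferInstance
  obtain ⟨φ, hφ⟩ : ∃ φ : (chains X).X 1 ⟶ coeffs,
      (chains X).iCycles 1 ≫ φ = (chains X).homologyπ 1 ≫ ℓ := by
    obtain ⟨k, hk⟩ := exists_functional_comp ((chains X).iCycles 1).hom
      ((chains X).homologyπ 1 ≫ ℓ).hom (by rw [hmono]; exact bot_le)
    exact ⟨ModuleCat.ofHom k, ModuleCat.hom_ext hk⟩
  have hd : (chains X).d 2 1 ≫ φ = 0 := by
    rw [← (chains X).toCycles_i 2 1, Category.assoc, hφ, ← Category.assoc,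
      HomologicalComplex.toCycles_comp_homologyπ, Limits.zero_comp]
  exact ⟨(isSimplicialCocycle_cochainCoeff hd).pathCocycle, φ, fun _ _ _ => rfl, hφ⟩

lemma simplexFace_default (i : Fin 2) :
    simplexFace (n := 0) i default = stdSimplexHomeomorphUnitInterval.symm (if i = 0 then 1 else 0) := by
  apply stdSimplex.ext; funext k
  change (stdSimplex.map i.succAbove default : Fin 2 → ℝ) k = _
  rw [stdSimplex.map_coe, FunOnFinite.linearMap_apply_apply, Finset.sum_filter, Fin.sum_univ_one]
  have : (default : stdSimplex ℝ (Fin 1)) 0 = 1 := rfl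
  rw [this]
  change _ = (![1 - (((if i = 0 then 1 else 0 : unitInterval)) : ℝ),
    ((if i = 0 then 1 else 0 : unitInterval) : ℝ)] : Fin 2 → ℝ) k
  fin_cases i <;> fin_cases k <;> simp [Fin.succAbove]

/-- If the cocycle is a coboundary, the representing cochain factors through the boundary map and
vanishes on cycles. -/
lemma Represents.eq_zero {ℓ : H1 X ⟶ coeffs} {c : PathCocycle X} (h : Represents ℓ c)
    (hc : c.IsCoboundary) : ℓ = 0 := by
  obtain ⟨φ, hφ, hℓ⟩ := h
  obtain ⟨f, hf⟩ := hc
  have : φ = (chains X).d 1 0 ≫ cochainOf (fun T => f (T default)) := by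
    refine cochain_ext fun T => ?_
    rw [cochainCoeff_d_comp, Fin.sum_univ_two, cochainCoeff_cochainOf, cochainCoeff_cochainOf]
    rw [← simplexMapOfPath_pathOfSimplexMap T, hφ, hf, simplexMapOfPath_pathOfSimplexMap, add_comm]
    congr 2
    · change T _ = T _
      rw [simplexFace_default]; rfl
    · change T _ = T _
      rw [simplexFace_default]; rfl
  rw [this, ← Category.assoc, HomologicalComplex.iCycles_d, Limits.zero_comp] at hℓ
  rw [← cancel_epi ((chains X).homologyπ 1), ← hℓ, Limits.comp_zero]

/-- A cochain that vanishes on cycles factors through the boundary map. The values of the factor on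
the points are the required function. -/
lemma isCoboundary_of_cochain {c : PathCocycle X} {φ : (chains X).X 1 ⟶ coeffs}
    (hφ : ∀ ⦃x y : X⦄ (γ : Path x y), cochainCoeff φ (simplexMapOfPath γ) = c.toFun γ)
    (hk : ∀ v : (chains X).X 1, ((chains X).d 1 0).hom v = 0 → φ.hom v = 0) :
    c.IsCoboundary := by
  obtain ⟨ψ, hψ⟩ : ∃ ψ : (chains X).X 0 ⟶ coeffs, (chains X).d 1 0 ≫ ψ = φ := by
    obtain ⟨k, hk⟩ := exists_functional_comp ((chains X).d 1 0).hom φ.hom hk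
    exact ⟨ModuleCat.ofHom k, ModuleCat.hom_ext hk⟩
  refine ⟨fun x => cochainCoeff ψ (ContinuousMap.const _ x), fun x y γ => ?_⟩
  rw [← hφ, ← hψ, cochainCoeff_d_comp, Fin.sum_univ_two, add_comm]
  congr 2
  · ext s
    obtain rfl : s = default := Subsingleton.elim _ _
    change simplexMapOfPath γ (simplexFace 1 default) = x
    rw [simplexFace_default]
    exact γ.source
  · ext s
    obtain rfl : s = default := Subsingleton.elim _ _
    change simplexMapOfPath γ (simplexFace 0 default) = y
    rw [simplexFace_default]
    exact γ.target

lemma Represents.isCoboundary {c : PathCocycle X} (h : Represents 0 c) : c.IsCoboundary := by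
  obtain ⟨φ, hφ, hℓ⟩ := h
  refine isCoboundary_of_cochain hφ fun v hv => ?_
  have ex := (chains X).cyclesIsKernel 1 0 (by simp)
  let k : coeffs ⟶ (chains X).X 1 := ModuleCat.ofHom (LinearMap.toSpanSingleton (ZMod 2) _ v)
  have hk : k ≫ (chains X).d 1 0 = 0 := by
    refine ModuleCat.hom_ext (LinearMap.ext_ring ?_)
    change ((chains X).d 1 0).hom ((1 : ZMod 2) • v) = 0
    rw [one_smul, hv]
  have : k ≫ φ = 0 := by
    rw [← (chains X).liftCycles_i k 0 (by simp) hk, Category.assoc, hℓ, Limits.comp_zero,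
      Limits.comp_zero]
  have := LinearMap.congr_fun (congrArg ModuleCat.Hom.hom this) (1 : ZMod 2)
  change φ.hom ((1 : ZMod 2) • v) = 0 at this
  rwa [one_smul] at this

/-- Without first homology every cycle is a boundary, and the cochain of a path cocycle vanishes on
boundaries. -/
lemma isCoboundary_of_isZero (h : Limits.IsZero (H1 X)) (c : PathCocycle X) : c.IsCoboundary := by
  have hco := c.isSimplicialCocycle
  have hc0 : ∀ ⦃x y : X⦄ (γ : Path x y),
      cochainCoeff (cochainOf fun T => c.toFun (pathOfSimplexMap T)) (simplexMapOfPath γ) =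
      c.toFun γ := by
    intro x y γ
    rw [cochainCoeff_cochainOf]
    refine Eq.trans ?_ (c.toFun_cast γ γ.source γ.target)
    congr 1
  refine isCoboundary_of_cochain hc0 fun v hv => ?_
  have ex := ((chains X).exactAt_iff_isZero_homology 1).2 h
  rw [(chains X).exactAt_iff' 2 1 0 (by simp) (by simp), ShortComplex.moduleCat_exact_iff] at ex
  obtain ⟨w, rfl⟩ := ex v hv
  have hd : (chains X).d 2 1 ≫ (cochainOf fun T => c.toFun (pathOfSimplexMap T)) = 0 := by
    refine cochain_ext fun T => ?_
    rw [cochainCoeff_d_comp, Fin.sum_univ_three, cochainCoeff_cochainOf, cochainCoeff_cochainOf,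
      cochainCoeff_cochainOf, hco T]
    rfl
  exact LinearMap.congr_fun (congrArg ModuleCat.Hom.hom hd) w

lemma Represents.comap {Y : Type} [TopologicalSpace Y] {ℓ : H1 X ⟶ coeffs} {c : PathCocycle X}
    (h : Represents ℓ c) (i : C(Y, X)) : Represents (H1map i ≫ ℓ) (c.comap i) := by
  obtain ⟨φ, hφ, hℓ⟩ := h
  refine ⟨(SSet.chainComplexMap (TopCat.toSSet.map (TopCat.ofHom i)) coeffs).f 1 ≫ φ,
    fun x y γ => ?_, ?_⟩
  · rw [cochainCoeff, SSet.ι_chainComplexMap_f_assoc]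
    exact hφ (γ.map i.continuous)
  · rw [← Category.assoc, ← HomologicalComplex.cyclesMap_i, Category.assoc, hℓ, ← Category.assoc,
      ← HomologicalComplex.homologyπ_naturality, Category.assoc]

lemma Represents.add {ℓ ℓ' : H1 X ⟶ coeffs} {c c' : PathCocycle X}
    (h : Represents ℓ c) (h' : Represents ℓ' c') : Represents (ℓ + ℓ') (c.add c') := by
  obtain ⟨φ, hφ, hℓ⟩ := h
  obtain ⟨φ', hφ', hℓ'⟩ := h'
  refine ⟨φ + φ', fun x y γ => ?_, by rw [Preadditive.comp_add, hℓ, hℓ', Preadditive.comp_add]⟩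
  change _ = c.toFun γ + c'.toFun γ
  rw [← hφ, ← hφ', cochainCoeff, Preadditive.comp_add]
  rfl

lemma firstBetti_eq_zero (h : ∀ c : PathCocycle X, c.IsCoboundary) : firstBetti X = 0 := by
  have hz : ∀ ℓ : H1 X ⟶ coeffs, ℓ = 0 := fun ℓ => by
    obtain ⟨c, hc⟩ := exists_represents ℓ
    exact hc.eq_zero (h c)
  have : Subsingleton (H1 X) := by
    refine ⟨fun a b => ?_⟩
    by_contra hab
    obtain ⟨f, hf⟩ := Module.Projective.exists_dual_ne_zero (ZMod 2) (sub_ne_zero.2 hab)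
    exact hf (LinearMap.congr_fun (congrArg ModuleCat.Hom.hom (hz (ModuleCat.ofHom f))) _)
  rw [firstBetti_eq, rank_subsingleton']
  simp

lemma isCoboundary_of_firstBetti_eq_zero (h : firstBetti X = 0) (c : PathCocycle X) :
    c.IsCoboundary := by
  rw [firstBetti_eq, Cardinal.toENat_eq_zero, rank_zero_iff] at h
  exact isCoboundary_of_isZero (ModuleCat.isZero_of_subsingleton _) c

/-- If the cocycles that become trivial along `i : Y → X` form a space of dimension at most one,
then the first Betti number grows by at most one. -/
theorem firstBetti_le_add_one {Y : Type} [TopologicalSpace Y] (i : C(Y, X))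
    (h : ∀ c c' : PathCocycle X, (c.comap i).IsCoboundary → (c'.comap i).IsCoboundary →
      c.IsCoboundary ∨ c'.IsCoboundary ∨ (c.add c').IsCoboundary) :
    firstBetti X ≤ firstBetti Y + 1 := by
  -- Functionals on the quotient by the image `A` are the functionals on `H1 X` that vanish along
  -- `i`. By hypothesis any two non-zero ones add up to zero, so there is at most one non-zero
  -- functional and the quotient has rank at most one.
  let A : Submodule (ZMod 2) (H1 X) := LinearMap.range (H1map i).hom
  have hA : Module.rank (ZMod 2) A ≤ Module.rank (ZMod 2) (H1 Y) := rank_range_le _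
  have hQ : Module.rank (ZMod 2) (H1 X ⧸ A) ≤ 1 := by
    have key : ∀ f f' : (H1 X ⧸ A) →ₗ[ZMod 2] ZMod 2, f ≠ 0 → f' ≠ 0 → f + f' = 0 := by
      intro f f' hf hf'
      let lift (f : (H1 X ⧸ A) →ₗ[ZMod 2] ZMod 2) : H1 X ⟶ coeffs := ModuleCat.ofHom (f ∘ₗ A.mkQ)
      have lift_ne : ∀ f, lift f = 0 → f = 0 := fun f hf => by
        refine Submodule.linearMap_qext _ ?_
        exact congrArg ModuleCat.Hom.hom hf
      have lift_i : ∀ f, H1map i ≫ lift f = 0 := fun f => by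
        refine ModuleCat.hom_ext (LinearMap.ext fun v => ?_)
        change f (A.mkQ ((H1map i).hom v)) = 0
        rw [Submodule.mkQ_apply, (Submodule.Quotient.mk_eq_zero A).2 ⟨v, rfl⟩, map_zero]
      obtain ⟨c, hc⟩ := exists_represents (lift f)
      obtain ⟨c', hc'⟩ := exists_represents (lift f')
      have k := hc.comap i
      have k' := hc'.comap i
      rw [lift_i] at k k'
      rcases h c c' k.isCoboundary k'.isCoboundary with h | h | h
      · exact absurd (lift_ne _ (hc.eq_zero h)) hf
      · exact absurd (lift_ne _ (hc'.eq_zero h)) hf'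
      · exact lift_ne _ ((hc.add hc').eq_zero h)
    rw [rank_le_one_iff]
    by_cases hs : ∀ v : H1 X ⧸ A, v = 0
    · exact ⟨0, fun v => ⟨0, by rw [hs v, smul_zero]⟩⟩
    push Not at hs
    obtain ⟨v₀, hv₀⟩ := hs
    obtain ⟨f, hf⟩ := Module.Projective.exists_dual_ne_zero (ZMod 2) hv₀
    have two : ∀ a b : ZMod 2, a ≠ 0 → a + b = 0 → b ≠ 0 := by decide
    have hf0 : f ≠ 0 := by rintro rfl; exact hf rfl
    have hne : ∀ w : H1 X ⧸ A, w ≠ 0 → f w ≠ 0 := fun w hw => by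
      obtain ⟨f', hf'⟩ := Module.Projective.exists_dual_ne_zero (ZMod 2) hw
      have hf0' : f' ≠ 0 := by rintro rfl; exact hf' rfl
      exact two _ _ hf' (LinearMap.congr_fun (key f' f hf0' hf0) w)
    refine ⟨v₀, fun v => ?_⟩
    by_cases hv : v = 0
    · exact ⟨0, by rw [hv, zero_smul]⟩
    · refine ⟨1, ?_⟩
      rw [one_smul]
      by_contra hvv
      have two' : ∀ a b : ZMod 2, a ≠ 0 → b ≠ 0 → a - b = 0 := by decide
      refine hne (v₀ - v) (sub_ne_zero.2 hvv) ?_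
      rw [map_sub]
      exact two' _ _ hf (hne v hv)
  rw [firstBetti_eq, firstBetti_eq, ← Submodule.rank_quotient_add_rank A, map_add, add_comm]
  refine add_le_add ?_ ?_
  · exact Cardinal.toENat.monotone' hA
  · exact (Cardinal.toENat.monotone' hQ).trans (by simp)

end Homology

end FourGenus

namespace FourGenus

/-! ### Gluing trivializations of cocycles -/

section PathCalculus

open Topology unitInterval

variable {X : Type} [TopologicalSpace X]

lemma PathCocycle.map_refl (c : PathCocycle X) (x : X) : c.toFun (Path.refl x) = 0 := by
  have h := c.map_trans (Path.refl x) (Path.refl x)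
  rw [Path.refl_trans_refl] at h
  exact left_eq_add.1 h

/-- A cocycle is trivialized by the function `f` over the set `A`. -/
def PathCocycle.TrivializedOn (c : PathCocycle X) (A : Set X) (f : X → ZMod 2) : Prop :=
  ∀ ⦃x y : X⦄ (γ : Path x y), (∀ t, γ t ∈ A) → c.toFun γ = f x + f y

lemma zmod_two_add_self (a : ZMod 2) : a + a = 0 := by revert a; decide

lemma PathCocycle.TrivializedOn.add_const {c : PathCocycle X} {A : Set X} {f : X → ZMod 2}
    (h : c.TrivializedOn A f) (a : ZMod 2) : c.TrivializedOn A (fun x => f x + a) := by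
  intro x y γ hγ
  rw [h γ hγ]
  linear_combination -zmod_two_add_self a

lemma PathCocycle.TrivializedOn.congr {c : PathCocycle X} {A : Set X} {f g : X → ZMod 2}
    (h : c.TrivializedOn A f) (hfg : ∀ x ∈ A, f x = g x) : c.TrivializedOn A g := by
  intro x y γ hγ
  rw [h γ hγ, hfg x (by simpa using hγ 0), hfg y (by simpa using hγ 1)]

lemma PathCocycle.TrivializedOn.add {c c' : PathCocycle X} {A : Set X} {f f' : X → ZMod 2}
    (h : c.TrivializedOn A f) (h' : c'.TrivializedOn A f') :
    (c.add c').TrivializedOn A (fun x => f x + f' x) := by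
  intro x y γ hγ
  change c.toFun γ + c'.toFun γ = _
  rw [h γ hγ, h' γ hγ]
  ring

/-- Two trivializations differ by a constant on each path component; this is the source of all
gluing obstructions below. -/
lemma PathCocycle.TrivializedOn.eq_of_joinedIn {c : PathCocycle X} {A : Set X} {f g : X → ZMod 2}
    (hf : c.TrivializedOn A f) (hg : c.TrivializedOn A g) {x y : X} (h : JoinedIn A x y) :
    f x + g x = f y + g y := by
  obtain ⟨γ, hγ⟩ := h
  have := (hf γ hγ).symm.trans (hg γ hγ)
  have key : ∀ a b d e : ZMod 2, a + b = d + e → a + d = b + e := by decide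
  exact key _ _ _ _ this

/-- A cocycle that is trivialized locally by a single function is trivialized globally. -/
lemma PathCocycle.trivializedOn_of_local {c : PathCocycle X} {A : Set X} {f : X → ZMod 2}
    (h : ∀ x ∈ A, ∃ U ∈ 𝓝 x, c.TrivializedOn (U ∩ A) f) : c.TrivializedOn A f := by
  intro x y γ hγ
  -- The value on the initial segment up to time `t`, corrected by `f (γ t)`, does not change
  -- locally in `t`; connectedness of the interval then compares the two ends.
  have hloc : IsLocallyConstant (fun t : I => c.toFun (γ.subpath 0 t) + f (γ t)) := by
    rw [IsLocallyConstant.iff_eventually_eq]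
    intro t
    obtain ⟨U, hU, hc⟩ := h (γ t) (hγ t)
    have hU' : γ ⁻¹' U ∈ 𝓝 t := γ.continuous.continuousAt hU
    obtain ⟨W, hW, hWc, hWU⟩ : ∃ W ∈ 𝓝 t, W.OrdConnected ∧ W ⊆ γ ⁻¹' U := by
      obtain ⟨ε, hε, hb⟩ := Metric.mem_nhds_iff.1 hU'
      refine ⟨Metric.ball t ε, Metric.ball_mem_nhds _ hε, ⟨?_⟩, hb⟩
      intro a ha b hb' z hz
      rw [Metric.mem_ball, Subtype.dist_eq, Real.dist_eq, abs_lt] at *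
      have h1 : (a : ℝ) ≤ z := hz.1
      have h2 : (z : ℝ) ≤ b := hz.2
      constructor <;> linarith
    filter_upwards [hW] with s hs
    have hsub : c.toFun (γ.subpath t s) = f (γ t) + f (γ s) := by
      refine hc _ fun r => ⟨?_, ?_⟩
      · have : γ.subpath t s r ∈ Set.range (γ.subpath t s) := ⟨r, rfl⟩
        rw [Path.range_subpath] at this
        obtain ⟨q, hq, hq'⟩ := this
        rw [← hq']
        exact hWU (hWc.uIcc_subset (mem_of_mem_nhds hW) hs hq)
      · exact hγ _
    have htr := c.map_trans (γ.subpath 0 t) (γ.subpath t s)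
    rw [c.map_homotopic _ _ ⟨Path.Homotopy.subpathTransSubpath γ 0 t s⟩, hsub] at htr
    rw [htr]
    linear_combination zmod_two_add_self (f (γ s))
  have := hloc.apply_eq_of_preconnectedSpace 0 1
  simp only [Path.subpath_self, c.map_refl, Path.subpath_zero_one, c.toFun_cast, Path.source,
    Path.target, zero_add] at this
  have key : ∀ a b d : ZMod 2, a = b + d → b = a + d := by decide
  exact key _ _ _ this

lemma PathCocycle.trivializedOn_union {c : PathCocycle X} {A B : Set X} {f : X → ZMod 2}
    (hA : IsOpen A) (hB : IsOpen B) (h : c.TrivializedOn A f) (h' : c.TrivializedOn B f) :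
    c.TrivializedOn (A ∪ B) f := by
  refine PathCocycle.trivializedOn_of_local fun x hx => ?_
  rcases hx with hx | hx
  · exact ⟨A, hA.mem_nhds hx, fun x y γ hγ => h γ fun t => (hγ t).1⟩
  · exact ⟨B, hB.mem_nhds hx, fun x y γ hγ => h' γ fun t => (hγ t).1⟩

lemma PathCocycle.TrivializedOn.mono {c : PathCocycle X} {A B : Set X} {f : X → ZMod 2}
    (h : c.TrivializedOn B f) (hAB : A ⊆ B) : c.TrivializedOn A f :=
  fun _ _ γ hγ => h γ fun t => hAB (hγ t)

/-- A cocycle that is trivial over `A` and over `B` is trivial over the union if the intersection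
is path connected. -/
lemma PathCocycle.exists_trivializedOn_union {c : PathCocycle X} {A B : Set X}
    (hA : IsOpen A) (hB : IsOpen B) (h : ∃ f, c.TrivializedOn A f) (h' : ∃ f, c.TrivializedOn B f)
    (hAB : ∀ x ∈ A ∩ B, ∀ y ∈ A ∩ B, JoinedIn (A ∩ B) x y) :
    ∃ f, c.TrivializedOn (A ∪ B) f := by
  classical
  obtain ⟨f, hf⟩ := h
  obtain ⟨f', hf'⟩ := h'
  obtain ⟨a, ha⟩ : ∃ a : ZMod 2, ∀ x ∈ A ∩ B, f x + f' x = a := by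
    by_cases hne : (A ∩ B).Nonempty
    · obtain ⟨x₀, hx₀⟩ := hne
      exact ⟨_, fun x hx => (hf.mono Set.inter_subset_left).eq_of_joinedIn
        (hf'.mono Set.inter_subset_right) (hAB x hx x₀ hx₀)⟩
    · exact ⟨0, fun x hx => (hne ⟨x, hx⟩).elim⟩
  -- On the path connected overlap the two trivializations differ by the constant `a`, so shifting
  -- the second one by `a` makes them agree.
  refine ⟨fun x => if x ∈ A then f x else f' x + a, PathCocycle.trivializedOn_union hA hB
    (hf.congr fun x hx => by simp [hx]) ((hf'.add_const a).congr fun x hx => ?_)⟩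
  split_ifs with hxA
  · rw [← ha x ⟨hxA, hx⟩]
    linear_combination zmod_two_add_self (f' x)
  · rfl

/-- If the intersection of `A` and `B` has two path components, then the cocycles
that are trivial over `A` and over `B` form a space of dimension at most one. -/
lemma PathCocycle.isCoboundary_or_of_two_components {c c' : PathCocycle X} {A B P Q : Set X}
    (hA : IsOpen A) (hB : IsOpen B) (hU : A ∪ B = Set.univ)
    (h : ∃ f, c.TrivializedOn A f) (h' : ∃ f, c.TrivializedOn B f)
    (k : ∃ f, c'.TrivializedOn A f) (k' : ∃ f, c'.TrivializedOn B f)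
    (hPQ : A ∩ B ⊆ P ∪ Q)
    (hP : ∀ x ∈ P, ∀ y ∈ P, JoinedIn (A ∩ B) x y)
    (hQ : ∀ x ∈ Q, ∀ y ∈ Q, JoinedIn (A ∩ B) x y) :
    c.IsCoboundary ∨ c'.IsCoboundary ∨ (c.add c').IsCoboundary := by
  classical
  have main : ∀ (d : PathCocycle X) (f f' : X → ZMod 2), d.TrivializedOn A f →
      d.TrivializedOn B f' → ∃ a b : ZMod 2, (∀ x ∈ P, f x + f' x = a) ∧
      (∀ x ∈ Q, f x + f' x = b) := by
    intro d f f' hf hf'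
    have aux : ∀ S : Set X, (∀ x ∈ S, ∀ y ∈ S, JoinedIn (A ∩ B) x y) →
        ∃ a : ZMod 2, ∀ x ∈ S, f x + f' x = a := by
      intro S hS
      by_cases hne : S.Nonempty
      · obtain ⟨x₀, hx₀⟩ := hne
        exact ⟨_, fun x hx => (hf.mono Set.inter_subset_left).eq_of_joinedIn
          (hf'.mono Set.inter_subset_right) (hS x hx x₀ hx₀)⟩
      · exact ⟨0, fun x hx => (hne ⟨x, hx⟩).elim⟩
    obtain ⟨a, ha⟩ := aux P hP
    obtain ⟨b, hb⟩ := aux Q hQ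
    exact ⟨a, b, ha, hb⟩
  have concl : ∀ (d : PathCocycle X) (f f' : X → ZMod 2) (a : ZMod 2), d.TrivializedOn A f →
      d.TrivializedOn B f' → (∀ x ∈ P, f x + f' x = a) → (∀ x ∈ Q, f x + f' x = a) →
      d.IsCoboundary := by
    intro d f f' a hf hf' ha hb
    have := PathCocycle.trivializedOn_union (f := fun x => if x ∈ A then f x else f' x + a) hA hB
      (hf.congr fun x hx => by simp [hx]) ((hf'.add_const a).congr fun x hx => by
        split_ifs with hxA
        · have hxa : f x + f' x = a := by
            rcases hPQ ⟨hxA, hx⟩ with hx | hx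
            exacts [ha x hx, hb x hx]
          rw [← hxa]
          linear_combination zmod_two_add_self (f' x)
        · rfl)
    exact ⟨_, fun x y γ => this γ fun t => hU ▸ Set.mem_univ _⟩
  obtain ⟨f, hf⟩ := h
  obtain ⟨f', hf'⟩ := h'
  obtain ⟨g, hg⟩ := k
  obtain ⟨g', hg'⟩ := k'
  obtain ⟨a, b, ha, hb⟩ := main c f f' hf hf'
  obtain ⟨a', b', ha', hb'⟩ := main c' g g' hg hg'
  -- A cocycle is described by its offsets on `P` and `Q` and is a coboundary once the two are
  -- equal. Modulo equal pairs the offsets form a group of order two, so one of `c`, `c'` and their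
  -- sum is trivial.
  have key : ∀ a b a' b' : ZMod 2, a = b ∨ a' = b' ∨ a + a' = b + b' := by decide
  rcases key a b a' b' with e | e | e
  · exact Or.inl (concl c f f' a hf hf' ha (e ▸ hb))
  · exact Or.inr (Or.inl (concl c' g g' a' hg hg' ha' (e ▸ hb')))
  · refine Or.inr (Or.inr (concl _ _ _ (a + a') (hf.add hg) (hf'.add hg') ?_ ?_))
    · intro x hx
      rw [← ha x hx, ← ha' x hx]; ring
    · intro x hx
      rw [e, ← hb x hx, ← hb' x hx]; ring

/-- Homotopic maps pull a cocycle back to cohomologous cocycles. -/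
lemma PathCocycle.comap_homotopy (c : PathCocycle X) {Y : Type} [TopologicalSpace Y]
    (H : C(I × Y, X)) : ∃ f : Y → ZMod 2, ∀ ⦃x y : Y⦄ (γ : Path x y),
      c.toFun (γ.map (f := fun y => H (0, y)) (by fun_prop)) +
        c.toFun (γ.map (f := fun y => H (1, y)) (by fun_prop)) = f x + f y := by
  let track (y : Y) : Path (H (0, y)) (H (1, y)) :=
    { toFun := fun t => H (t, y), continuous_toFun := by fun_prop, source' := rfl, target' := rfl }
  refine ⟨fun y => c.toFun (track y), fun x y γ => ?_⟩
  have : ContractibleSpace I := (convex_Icc (0 : ℝ) 1).contractibleSpace ⟨0, by simp⟩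
  let K : C(I × I, X) := H.comp ⟨fun p => (p.1, γ p.2), by fun_prop⟩
  -- The two routes along the boundary of the unit square are homotopic. Their images are built from
  -- the two copies of `γ` and the tracks of its ends.
  have hsq : (((Path.refl (0 : I)).prod Path.id).trans (Path.id.prod (Path.refl (1 : I)))).Homotopic
      ((Path.id.prod (Path.refl (0 : I))).trans ((Path.refl (1 : I)).prod Path.id)) :=
    SimplyConnectedSpace.paths_homotopic _ _
  have this := c.map_homotopic _ _ (hsq.map K)
  rw [Path.map_trans, Path.map_trans, c.map_trans, c.map_trans] at this
  have e1 : c.toFun (((Path.refl (0 : I)).prod Path.id).map K.continuous) =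
      c.toFun (γ.map (f := fun y => H (0, y)) (by fun_prop)) :=
    c.toFun_cast (γ.map (f := fun y => H (0, y)) (by fun_prop)) (by simp [K]) (by simp [K])
  have e2 : c.toFun (((Path.refl (1 : I)).prod Path.id).map K.continuous) =
      c.toFun (γ.map (f := fun y => H (1, y)) (by fun_prop)) :=
    c.toFun_cast (γ.map (f := fun y => H (1, y)) (by fun_prop)) (by simp [K]) (by simp [K])
  have e3 : c.toFun ((Path.id.prod (Path.refl (1 : I))).map K.continuous) = c.toFun (track y) := by
    refine Eq.trans ?_ (c.toFun_cast (track y) (show K (0, 1) = _ by simp [K])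
      (show K (1, 1) = _ by simp [K]))
    congr 1; ext t; simp [K, track]
  have e4 : c.toFun ((Path.id.prod (Path.refl (0 : I))).map K.continuous) = c.toFun (track x) := by
    refine Eq.trans ?_ (c.toFun_cast (track x) (show K (0, 0) = _ by simp [K])
      (show K (1, 0) = _ by simp [K]))
    congr 1; ext t; simp [K, track]
  rw [e1, e2, e3, e4] at this
  have key : ∀ a b d e : ZMod 2, a + b = d + e → a + e = d + b := by decide
  exact key _ _ _ _ this

/-- If the inclusion of `A` is homotopic to a constant map, then every cocycle is trivial over
`A`. -/
lemma PathCocycle.exists_trivializedOn_of_contraction (c : PathCocycle X) {A : Set X}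
    (H : C(I × A, X)) (h0 : ∀ a : A, H (0, a) = a) (x₀ : X) (h1 : ∀ a : A, H (1, a) = x₀) :
    ∃ f, c.TrivializedOn A f := by
  classical
  obtain ⟨f, hf⟩ := c.comap_homotopy H
  refine ⟨fun x => if hx : x ∈ A then f ⟨x, hx⟩ else 0, fun x y γ hγ => ?_⟩
  have hx : x ∈ A := by simpa using hγ 0
  have hy : y ∈ A := by simpa using hγ 1
  let γ' : Path (⟨x, hx⟩ : A) ⟨y, hy⟩ :=
    { toFun := fun t => ⟨γ t, hγ t⟩
      continuous_toFun := by fun_prop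
      source' := by simp
      target' := by simp }
  have := hf γ'
  have e1 : c.toFun (γ'.map (f := fun y => H (0, y)) (by fun_prop)) = c.toFun γ := by
    refine Eq.trans ?_ (c.toFun_cast γ (h0 ⟨x, hx⟩) (h0 ⟨y, hy⟩))
    congr 1; ext t; exact h0 _
  have e2 : c.toFun (γ'.map (f := fun y => H (1, y)) (by fun_prop)) = 0 := by
    refine Eq.trans ?_ ((c.toFun_cast (Path.refl x₀) (h1 ⟨x, hx⟩) (h1 ⟨y, hy⟩)).trans (c.map_refl x₀))
    congr 1; ext t; exact h1 _
  rw [e1, e2, add_zero] at this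
  simp only [hx, hy, dif_pos, this]

/-- If the inclusion of `A` is homotopic to a map that factors through a map `i` along which the
cocycle is trivial, then the cocycle is trivial over `A`. -/
lemma PathCocycle.exists_trivializedOn_of_homotopy (c : PathCocycle X) {A : Set X} {Y : Type}
    [TopologicalSpace Y] (i : C(Y, X)) (r : C(A, Y)) (hi : (c.comap i).IsCoboundary)
    (H : C(I × A, X)) (h0 : ∀ a : A, H (0, a) = a) (h1 : ∀ a : A, H (1, a) = i (r a)) :
    ∃ f, c.TrivializedOn A f := by
  classical
  obtain ⟨f, hf⟩ := c.comap_homotopy H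
  obtain ⟨g, hg⟩ := hi
  refine ⟨fun x => if hx : x ∈ A then f ⟨x, hx⟩ + g (r ⟨x, hx⟩) else 0, fun x y γ hγ => ?_⟩
  have hx : x ∈ A := by simpa using hγ 0
  have hy : y ∈ A := by simpa using hγ 1
  let γ' : Path (⟨x, hx⟩ : A) ⟨y, hy⟩ :=
    { toFun := fun t => ⟨γ t, hγ t⟩
      continuous_toFun := by fun_prop
      source' := by simp
      target' := by simp }
  have := hf γ'
  have e1 : c.toFun (γ'.map (f := fun y => H (0, y)) (by fun_prop)) = c.toFun γ := by
    refine Eq.trans ?_ (c.toFun_cast γ (h0 ⟨x, hx⟩) (h0 ⟨y, hy⟩))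
    congr 1; ext t; exact h0 _
  have e2 : c.toFun (γ'.map (f := fun y => H (1, y)) (by fun_prop)) =
      g (r ⟨x, hx⟩) + g (r ⟨y, hy⟩) := by
    refine Eq.trans ?_ (hg (γ'.map r.continuous))
    refine Eq.trans ?_ (c.toFun_cast ((γ'.map r.continuous).map i.continuous) (h1 _) (h1 _))
    congr 1; ext t; exact h1 _
  rw [e1, e2] at this
  simp only [hx, hy, dif_pos]
  generalize c.toFun γ = a, g (r ⟨x, hx⟩) = b, g (r ⟨y, hy⟩) = d, f ⟨x, hx⟩ = e,
    f ⟨y, hy⟩ = k at this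
  revert a b d e k; decide

/-- A contractible space has vanishing first Betti number. -/
lemma firstBetti_eq_zero_of_contractibleSpace [ContractibleSpace X] : firstBetti X = 0 := by
  refine firstBetti_eq_zero fun c => ?_
  obtain ⟨x₀⟩ : Nonempty X := inferInstance
  obtain ⟨f, hf⟩ : ∃ f : X → ZMod 2, ∀ x, ∃ γ : Path x₀ x, c.toFun γ = f x := by
    exact ⟨fun x => c.toFun (PathConnectedSpace.somePath x₀ x), fun x => ⟨_, rfl⟩⟩
  refine ⟨f, fun x y γ => ?_⟩
  obtain ⟨γx, hx⟩ := hf x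
  obtain ⟨γy, hy⟩ := hf y
  have := c.map_homotopic _ _ (SimplyConnectedSpace.paths_homotopic (γx.trans γ) γy)
  rw [c.map_trans, hx, hy] at this
  have key : ∀ a b d : ZMod 2, a + b = d → b = a + d := by decide
  exact key _ _ _ this

end PathCalculus
end FourGenus

namespace FourGenus

open scoped ContDiff Manifold
open Topology

/-! ### Norm preserving diffeomorphisms of four-space -/

section BallDiffeo

/-- A diffeomorphism of four-space that preserves the norm. -/
structure BallDiffeo where
  toHomeomorph : E4 ≃ₜ E4
  contDiff : ContDiff ℝ ∞ toHomeomorph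
  contDiff_symm : ContDiff ℝ ∞ toHomeomorph.symm
  norm_map : ∀ p, ‖toHomeomorph p‖ = ‖p‖

/-- The inverse diffeomorphism. -/
def BallDiffeo.symm (Φ : BallDiffeo) : BallDiffeo where
  toHomeomorph := Φ.toHomeomorph.symm
  contDiff := Φ.contDiff_symm
  contDiff_symm := Φ.contDiff
  norm_map p := by rw [← Φ.norm_map, Homeomorph.apply_symm_apply]

/-- A norm preserving injective immersion of four-space in itself is a diffeomorphism. -/
lemma exists_ballDiffeo {f : E4 → E4} (hf : ContDiff ℝ ∞ f) (hn : ∀ p, ‖f p‖ = ‖p‖)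
    (hinj : Function.Injective f) (hd : ∀ p v, fderiv ℝ f p v = 0 → v = 0) :
    ∃ Φ : BallDiffeo, ∀ p, Φ.toHomeomorph p = f p := by
  have hfi : ∀ p, Function.Injective (fderiv ℝ f p : E4 →ₗ[ℝ] E4) := fun p =>
    (injective_iff_map_eq_zero _).2 (hd p)
  let e (p : E4) : E4 ≃L[ℝ] E4 :=
    (LinearEquiv.ofInjectiveEndo (fderiv ℝ f p : E4 →ₗ[ℝ] E4) (hfi p)).toContinuousLinearEquiv
  have he : ∀ p, HasStrictFDerivAt f (e p : E4 →L[ℝ] E4) p := by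
    intro p
    have := (hf.contDiffAt (x := p)).hasStrictFDerivAt (by simp)
    exact this
  -- The map is open by the inverse function theorem and closed because preservation of the norm
  -- makes it proper. Its image is therefore open, closed and non-empty.
  have hopen : IsOpenMap f := isOpenMap_iff_nhds_le.2 fun p => (he p).map_nhds_eq_of_equiv.ge
  have hclosed : IsClosedMap f := by
    have : IsProperMap f := by
      rw [isProperMap_iff_tendsto_cocompact]
      refine ⟨hf.continuous, ?_⟩
      rw [Metric.cobounded_eq_cocompact.symm, ← comap_norm_atTop, Filter.tendsto_comap_iff]
      simp only [Function.comp_def, hn]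
      exact Filter.tendsto_comap
    exact this.isClosedMap
  have hsurj : Function.Surjective f := by
    rw [← Set.range_eq_univ]
    exact IsClopen.eq_univ ⟨hclosed.isClosed_range, hopen.isOpen_range⟩ ⟨f 0, 0, rfl⟩
  let Φ : E4 ≃ₜ E4 := (Equiv.ofBijective f ⟨hinj, hsurj⟩).toHomeomorphOfContinuousOpen
    hf.continuous hopen
  refine ⟨⟨Φ, hf, ?_, hn⟩, fun _ => rfl⟩
  rw [contDiff_iff_contDiffAt]
  intro q
  exact Φ.toOpenPartialHomeomorph.contDiffAt_symm (a := q) (f₀' := e (Φ.symm q)) trivial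
    (he (Φ.symm q)).hasFDerivAt hf.contDiffAt

variable (Φ : BallDiffeo)

lemma BallDiffeo.mem_D4 (p : E4) : Φ.toHomeomorph p ∈ D4 ↔ p ∈ D4 := by
  simp [Φ.norm_map]

lemma BallDiffeo.isProperSurface {F : Set E4} (hF : IsProperSurface F) :
    IsProperSurface (Φ.toHomeomorph '' F) where
  subset_ball := by
    rintro _ ⟨p, hp, rfl⟩
    exact (Φ.mem_D4 p).2 (hF.subset_ball hp)
  isCompact := hF.isCompact.image Φ.toHomeomorph.continuous
  isConnected := hF.isConnected.image _ Φ.toHomeomorph.continuous.continuousOn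
  chart := by
    rintro _ ⟨p, hp, rfl⟩
    obtain ⟨φ, hpφ, h1, h2, h3, h4⟩ := hF.chart p hp
    refine ⟨Φ.toHomeomorph.symm.toOpenPartialHomeomorph.trans φ, ?_, ?_, ?_, ?_, ?_⟩
    · simpa using hpφ
    · refine h1.comp (Φ.contDiff_symm.contDiffOn (s := _)) ?_
      intro x hx
      simpa using hx
    · refine Φ.contDiff.comp_contDiffOn (h2.mono ?_)
      intro x hx
      simpa using hx
    · intro x hx
      have hx' : Φ.toHomeomorph.symm x ∈ φ.source := by simpa using hx
      have := h3 _ hx'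
      rw [← Φ.mem_D4, Homeomorph.apply_symm_apply] at this
      exact this
    · intro x hx
      have hx' : Φ.toHomeomorph.symm x ∈ φ.source := by simpa using hx
      have hm : x ∈ Φ.toHomeomorph '' F ↔ Φ.toHomeomorph.symm x ∈ F := by
        constructor
        · rintro ⟨y, hy, rfl⟩
          simpa using hy
        · exact fun h => ⟨_, h, Φ.toHomeomorph.apply_symm_apply x⟩
      rw [hm]
      exact h4 _ hx'

lemma firstBetti_congr {X Y : Type} [TopologicalSpace X] [TopologicalSpace Y] (e : X ≃ₜ Y) :
    firstBetti X = firstBetti Y := by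
  unfold firstBetti
  congr 1
  exact (((AlgebraicTopology.singularHomologyFunctor (ModuleCat.{0} (ZMod 2)) 1).obj
      (ModuleCat.of (ZMod 2) (ZMod 2))).mapIso (TopCat.isoOfHomeo (X := TopCat.of X) (Y := TopCat.of Y) e)).toLinearEquiv.rank_eq

lemma BallDiffeo.firstBetti_image (F : Set E4) :
    firstBetti (Φ.toHomeomorph '' F) = firstBetti F :=
  (firstBetti_congr (Φ.toHomeomorph.image F)).symm

/-- The two-form is pulled back. Tangent vectors that witness its non-vanishing come from the
derivative of the inverse, which maps tangent cones to tangent cones. -/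
lemma BallDiffeo.isOrientable {F : Set E4} (h : IsOrientable (Φ.toHomeomorph '' F)) :
    IsOrientable F := by
  obtain ⟨η, hη, hne⟩ := h
  refine ⟨fun p => (η (Φ.toHomeomorph p)).compContinuousLinearMap (fderiv ℝ Φ.toHomeomorph p),
    ?_, fun p hp => ?_⟩
  · have hcomp : Continuous (fun fg : (E4 [⋀^Fin 2]→L[ℝ] ℝ) × (E4 →L[ℝ] E4) =>
        fg.1.compContinuousLinearMap fg.2) := continuous_iff_continuousAt.2 fun fg =>
      (ContinuousAlternatingMap.hasStrictFDerivAt_compContinuousLinearMap fg).continuousAt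
    exact hcomp.comp_continuousOn ((hη.comp Φ.toHomeomorph.continuous.continuousOn
      (Set.mapsTo_image _ _)).prodMk (Φ.contDiff.continuous_fderiv (by simp)).continuousOn)
  · obtain ⟨v, hv, w, hw, hvw⟩ := hne _ (Set.mem_image_of_mem _ hp)
    have hdiff : DifferentiableAt ℝ Φ.toHomeomorph.symm (Φ.toHomeomorph p) :=
      Φ.contDiff_symm.differentiable (by simp) _
    have hmap : ∀ v ∈ tangentPlane (Φ.toHomeomorph '' F) (Φ.toHomeomorph p),
        fderiv ℝ Φ.toHomeomorph.symm (Φ.toHomeomorph p) v ∈ tangentPlane F p := by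
      intro v hv
      have : tangentPlane (Φ.toHomeomorph '' F) (Φ.toHomeomorph p) ≤
          (tangentPlane F p).comap (fderiv ℝ Φ.toHomeomorph.symm (Φ.toHomeomorph p) : E4 →ₗ[ℝ] E4) := by
        refine Submodule.span_le.2 fun v hv => Submodule.subset_span ?_
        have := HasFDerivWithinAt.mapsTo_tangent_cone (s := Φ.toHomeomorph '' F)
          hdiff.hasFDerivAt.hasFDerivWithinAt hv
        rw [← Set.image_comp] at this
        simpa using this
      exact this hv
    have hinv : ∀ v, fderiv ℝ Φ.toHomeomorph p (fderiv ℝ Φ.toHomeomorph.symm (Φ.toHomeomorph p) v) = v := by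
      intro v
      have h1 : HasFDerivAt Φ.toHomeomorph (fderiv ℝ Φ.toHomeomorph p)
          (Φ.toHomeomorph.symm (Φ.toHomeomorph p)) := by
        rw [Homeomorph.symm_apply_apply]
        exact (Φ.contDiff.differentiable (by simp) p).hasFDerivAt
      have h2 := h1.comp _ hdiff.hasFDerivAt
      have h3 : (Φ.toHomeomorph ∘ Φ.toHomeomorph.symm : E4 → E4) = id := by
        funext x; simp
      rw [h3] at h2
      exact (DFunLike.congr_fun (h2.unique (hasFDerivAt_id _)) v)
    refine ⟨_, hmap v hv, _, hmap w hw, ?_⟩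
    rw [ContinuousAlternatingMap.compContinuousLinearMap_apply]
    convert hvw using 2
    funext i
    fin_cases i <;> simp [hinv]

end BallDiffeo
end FourGenus

namespace FourGenus

open scoped ContDiff Manifold
open Topology

/-! ### Extending an ambient isotopy of the sphere to the ball -/

section Isotopy

/-- The radial projection to the sphere (with an arbitrary value at the origin). -/
noncomputable def dir (p : E4) : S3 :=
  if h : p = 0 then ⟨EuclideanSpace.single 0 1, by simp⟩ else
    ⟨‖p‖⁻¹ • p, by simp [norm_smul, h]⟩

lemma coe_dir {p : E4} (h : p ≠ 0) : (dir p : E4) = ‖p‖⁻¹ • p := by simp [dir, h]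

lemma norm_smul_dir (p : E4) : ‖p‖ • (dir p : E4) = p := by
  by_cases h : p = 0
  · simp [h]
  · rw [coe_dir h, smul_smul, mul_inv_cancel₀ (norm_ne_zero_iff.2 h), one_smul]

@[simp] lemma norm_coe_S3 (θ : S3) : ‖(θ : E4)‖ = 1 := by simp

lemma dir_smul {r : ℝ} (hr : 0 < r) (θ : S3) : dir (r • (θ : E4)) = θ := by
  have h0 : r • (θ : E4) ≠ 0 := by
    rw [← norm_ne_zero_iff, norm_smul, norm_coe_S3]; simp [hr.ne']
  apply Subtype.ext
  rw [coe_dir h0, norm_smul, norm_coe_S3, smul_smul]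
  simp [abs_of_pos hr, hr.ne']

lemma dir_coe (θ : S3) : dir (θ : E4) = θ := by
  simpa using dir_smul one_pos θ

/-- Near `p₀` the projection agrees with the normalization of a globally smooth, nowhere vanishing
map `w`, to which the criterion for smooth maps into the sphere applies. -/
lemma contMDiffAt_dir {p₀ : E4} (h : p₀ ≠ 0) : ContMDiffAt 𝓘(ℝ, E4) (𝓡 3) ∞ dir p₀ := by
  have hp : 0 < ‖p₀‖ := norm_pos_iff.2 h
  let χ : ContDiffBump p₀ := ⟨‖p₀‖ / 4, ‖p₀‖ / 2, by positivity, by linarith⟩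
  let w : E4 → E4 := fun p => χ p • p + (1 - χ p) • p₀
  have hw : ∀ p, w p ≠ 0 := by
    intro p
    have e : w p = p₀ + χ p • (p - p₀) := by simp only [w]; module
    have hb : ‖χ p • (p - p₀)‖ ≤ ‖p₀‖ / 2 := by
      by_cases hp' : dist p p₀ < ‖p₀‖ / 2
      · rw [norm_smul, Real.norm_of_nonneg χ.nonneg, ← dist_eq_norm]
        nlinarith [χ.nonneg (x := p), χ.le_one (x := p), dist_nonneg (x := p) (y := p₀)]
      · rw [χ.zero_of_le_dist (not_lt.1 hp'), zero_smul, norm_zero]; positivity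
    intro h0
    rw [e, add_eq_zero_iff_eq_neg] at h0
    rw [← norm_neg, ← h0] at hb
    linarith
  have hwd : ContDiff ℝ ∞ w := by
    have h1 : ContDiff ℝ ∞ (fun p => χ p) := χ.contDiff
    exact (h1.smul contDiff_id).add ((contDiff_const.sub h1).smul contDiff_const)
  have hs : ∀ p, ‖w p‖⁻¹ • w p ∈ Metric.sphere (0 : EuclideanSpace ℝ (Fin (3 + 1))) 1 := by
    intro p
    have := norm_ne_zero_iff.2 (hw p)
    simp [norm_smul, this]
  have hsm : ContDiff ℝ ∞ (fun p => ‖w p‖⁻¹ • w p) :=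
    ((hwd.norm ℝ hw).inv fun p => norm_ne_zero_iff.2 (hw p)).smul hwd
  have : Fact (Module.finrank ℝ (EuclideanSpace ℝ (Fin (3 + 1))) = 3 + 1) :=
    ⟨finrank_euclideanSpace_fin⟩
  have := ContMDiff.codRestrict_sphere (E := EuclideanSpace ℝ (Fin (3 + 1))) (n := 3)
    hsm.contMDiff hs
  refine (this p₀).congr_of_eventuallyEq ?_
  filter_upwards [χ.eventuallyEq_one, isOpen_ne.mem_nhds h] with p hp1 hp0
  apply Subtype.ext
  rw [coe_dir hp0]
  change ‖p‖⁻¹ • p = ‖w p‖⁻¹ • w p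
  have : w p = p := by simp only [w, hp1, Pi.one_apply]; simp
  rw [this]

lemma contMDiff_coe_S3 : ContMDiff (𝓡 3) 𝓘(ℝ, E4) ∞ (fun θ : S3 => (θ : E4)) :=
  have : Fact (Module.finrank ℝ (EuclideanSpace ℝ (Fin (3 + 1))) = 3 + 1) :=
    ⟨finrank_euclideanSpace_fin⟩
  contMDiff_coe_sphere (E := EuclideanSpace ℝ (Fin (3 + 1)))

/-- The cone over a subset of the sphere, without the apex. -/
def coneOver (A : Set S3) : Set E4 := {p | p ≠ 0 ∧ dir p ∈ A}

/-- Differentiating `‖f q‖² = ‖q‖²` shows that a vector killed by the derivative is tangent to the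
sphere through `p`, which reduces immersivity to tangential directions. -/
lemma fderiv_orthogonal_of_norm_preserving {f : E4 → E4} {p v : E4} (hf : DifferentiableAt ℝ f p)
    (hn : ∀ q, ‖f q‖ = ‖q‖) (hv : fderiv ℝ f p v = 0) : inner ℝ p v = 0 := by
  have h1 := hf.hasFDerivAt.norm_sq
  have h2 := (hasFDerivAt_id (𝕜 := ℝ) p).norm_sq
  simp only [hn] at h1
  have := DFunLike.congr_fun (h1.unique h2) v
  simp [hv] at this
  exact this

/-- An ambient isotopy extends to a diffeomorphism of the ball that is conical near the sphere. -/
lemma exists_ballDiffeo_of_ambientIsotopic {A B : Set S3} (h : AmbientIsotopic A B) :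
    ∃ Φ : BallDiffeo, ∀ p, 3 / 4 ≤ ‖p‖ → (Φ.toHomeomorph p ∈ coneOver B ↔ p ∈ coneOver A) := by
  obtain ⟨H, hH, hH0, hH1⟩ := h
  -- The isotopy is run along the radius: it is constant at time `0` inside radius `1/2`, which
  -- avoids the singular origin, and has reached time `1` from radius `3/4` on.
  let χ : ℝ → ℝ := fun r => Real.smoothTransition (4 * r - 2)
  have hχ : ContDiff ℝ ∞ χ := Real.smoothTransition.contDiff.comp (by fun_prop)
  have hχ0 : ∀ r ≤ 1 / 2, χ r = 0 := fun r hr =>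
    Real.smoothTransition.zero_of_nonpos (by linarith)
  have hχ1 : ∀ r, 3 / 4 ≤ r → χ r = 1 := fun r hr =>
    Real.smoothTransition.one_of_one_le (by linarith)
  let Ψ : ℝ × E4 → E4 := fun x => ‖x.2‖ • (H x.1 (dir x.2) : E4)
  have hΨ : ∀ t p, p ≠ 0 → ContDiffAt ℝ ∞ Ψ (t, p) := by
    intro t p hp
    have h1 : ContMDiffAt 𝓘(ℝ, ℝ × E4) (𝓘(ℝ, ℝ).prod (𝓡 3)) ∞
        (fun x : ℝ × E4 => (x.1, dir x.2)) (t, p) := by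
      refine ContMDiffAt.prodMk contDiff_fst.contMDiff.contMDiffAt ?_
      exact ContMDiffAt.comp (t, p) (contMDiffAt_dir hp) contDiff_snd.contMDiff.contMDiffAt
    have h2 := (hH _).comp (t, p) h1
    have h3 := (contMDiff_coe_S3 _).comp (t, p) h2
    exact (contDiffAt_snd.norm ℝ hp).smul h3.contDiffAt
  have hG : ∀ t p, p ≠ 0 → ContDiffAt ℝ ∞ (fun q => ‖q‖ • ((H t).symm (dir q) : E4)) p := by
    intro t p hp
    have h2 := ((H t).symm.contMDiff _).comp p (contMDiffAt_dir hp)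
    have h3 := (contMDiff_coe_S3 _).comp p h2
    exact (contDiffAt_id.norm ℝ hp).smul h3.contDiffAt
  let f : E4 → E4 := fun p => Ψ (χ ‖p‖, p)
  have hn : ∀ p, ‖f p‖ = ‖p‖ := fun p => by simp [f, Ψ, norm_smul]
  have hid : ∀ p, ‖p‖ ≤ 1 / 2 → f p = p := fun p hp => by
    simp only [f, Ψ, hχ0 _ hp, hH0, norm_smul_dir]
  have hid' : ∀ p, ‖p‖ < 1 / 2 → f =ᶠ[𝓝 p] id := fun p hp => by
    filter_upwards [(isOpen_lt continuous_norm continuous_const).mem_nhds hp] with q hq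
    exact hid q (le_of_lt hq)
  have hdir : ∀ p, p ≠ 0 → dir (f p) = H (χ ‖p‖) (dir p) := fun p hp =>
    dir_smul (norm_pos_iff.2 hp) _
  have hf : ContDiff ℝ ∞ f := by
    rw [contDiff_iff_contDiffAt]
    intro p
    by_cases hp : ‖p‖ < 1 / 2
    · exact contDiffAt_id.congr_of_eventuallyEq (hid' p hp)
    · have hp0 : p ≠ 0 := by rintro rfl; simp at hp
      exact ContDiffAt.comp (g := Ψ) (f := fun q : E4 => (χ ‖q‖, q)) p (hΨ _ p hp0) ((hχ.contDiffAt.comp p (contDiffAt_id.norm ℝ hp0)).prodMk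
        contDiffAt_id)
  have hinj : Function.Injective f := by
    intro p q hpq
    have hnn : ‖p‖ = ‖q‖ := by rw [← hn p, ← hn q, hpq]
    by_cases hp : p = 0
    · rw [hp, norm_zero] at hnn
      rw [hp, norm_eq_zero.1 hnn.symm]
    · have hq : q ≠ 0 := by rw [← norm_ne_zero_iff, ← hnn]; exact norm_ne_zero_iff.2 hp
      have := hdir p hp
      rw [hpq, hdir q hq, hnn] at this
      have hd := (H (χ ‖q‖)).injective this
      rw [← norm_smul_dir p, ← norm_smul_dir q, hnn, hd]
  have hd : ∀ p v, fderiv ℝ f p v = 0 → v = 0 := by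
    intro p v hv
    by_cases hp : ‖p‖ < 1 / 2
    · rw [(hid' p hp).fderiv_eq] at hv
      simpa using hv
    · have hp0 : p ≠ 0 := by rintro rfl; simp at hp
      -- A vector in the kernel is tangent to the sphere, so the isotopy time does not vary along
      -- it. It is then killed by the derivative of the cone map at the fixed time `χ ‖p‖`, which
      -- has the smooth local inverse used in `hG`.
      have horth := fderiv_orthogonal_of_norm_preserving (hf.differentiable (by simp) p) hn hv
      have hΨd := ((hΨ (χ ‖p‖) p hp0).differentiableAt (by simp)).hasFDerivAt
      have hχd : HasFDerivAt (fun q : E4 => χ ‖q‖) (fderiv ℝ (fun q : E4 => χ ‖q‖) p) p :=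
        ((hχ.contDiffAt.comp p (contDiffAt_id.norm ℝ hp0)).differentiableAt (by simp)).hasFDerivAt
      have hχv : fderiv ℝ (fun q : E4 => χ ‖q‖) p v = 0 := by
        have h1 : DifferentiableAt ℝ (fun q : E4 => ‖q‖) p :=
          (contDiffAt_id.norm ℝ hp0 (n := 1)).differentiableAt (by simp)
        have h2 : fderiv ℝ (fun q : E4 => ‖q‖) p v = 0 := by
          have h3 := h1.hasFDerivAt.pow 2
          have h4 := (hasFDerivAt_id (𝕜 := ℝ) p).norm_sq
          have := DFunLike.congr_fun (h3.unique h4) v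
          simp [horth] at this
          rcases this with h | h
          · exact absurd h hp0
          · exact h
        have h5 := ((hχ.differentiable (by simp) ‖p‖).hasFDerivAt).comp p h1.hasFDerivAt
        rw [show (χ ∘ fun q : E4 => ‖q‖) = fun q => χ ‖q‖ from rfl] at h5
        rw [h5.fderiv]
        simp [h2]
      have h6 := HasFDerivAt.comp (g := Ψ) (f := fun q : E4 => (χ ‖q‖, id q)) p hΨd
        (hχd.prodMk (hasFDerivAt_id p))
      have h7 := HasFDerivAt.comp (g := Ψ) (f := fun q : E4 => (χ ‖p‖, id q)) p hΨd
        ((hasFDerivAt_const (χ ‖p‖) p).prodMk (hasFDerivAt_id p))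
      have h8 : fderiv ℝ Ψ (χ ‖p‖, p) (0, v) = 0 := by
        have e : (Ψ ∘ fun q : E4 => (χ ‖q‖, id q)) = f := rfl
        rw [e] at h6
        rw [h6.fderiv] at hv
        simpa [hχv] using hv
      have hΨp : Ψ (χ ‖p‖, p) ≠ 0 := by
        rw [← norm_ne_zero_iff]; exact (hn p).trans_ne (norm_ne_zero_iff.2 hp0)
      have h9 := ((hG (χ ‖p‖) (Ψ (χ ‖p‖, p)) hΨp).differentiableAt (by simp)).hasFDerivAt
      have h10 := h9.comp p h7
      have h11 : ((fun q => ‖q‖ • ((H (χ ‖p‖)).symm (dir q) : E4)) ∘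
          (Ψ ∘ fun x : E4 => (χ ‖p‖, id x))) =ᶠ[𝓝 p] id := by
        filter_upwards [isOpen_ne.mem_nhds hp0] with q hq
        have e1 : ‖Ψ (χ ‖p‖, q)‖ = ‖q‖ := by simp [Ψ, norm_smul]
        have e2 : dir (Ψ (χ ‖p‖, q)) = H (χ ‖p‖) (dir q) := dir_smul (norm_pos_iff.2 hq) _
        change ‖Ψ (χ ‖p‖, q)‖ • ((H (χ ‖p‖)).symm (dir (Ψ (χ ‖p‖, q))) : E4) = q
        rw [e1, e2, Diffeomorph.symm_apply_apply, norm_smul_dir]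
      have h12 := DFunLike.congr_fun ((h10.congr_of_eventuallyEq h11.symm).unique
        (hasFDerivAt_id p)) v
      simp [h8] at h12
      exact h12.symm
  obtain ⟨Φ, hΦ⟩ := exists_ballDiffeo hf hn hinj hd
  refine ⟨Φ, fun p hp => ?_⟩
  have hp0 : p ≠ 0 := by rintro rfl; norm_num at hp
  have hfp0 : f p ≠ 0 := by
    rw [← norm_ne_zero_iff, hn]; exact norm_ne_zero_iff.2 hp0
  rw [hΦ, coneOver, coneOver, Set.mem_ofPred_eq, Set.mem_ofPred_eq, hdir p hp0, hχ1 _ hp, ← hH1]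
  simp [hp0, hfp0]

end Isotopy
end FourGenus

namespace FourGenus

open scoped ContDiff Manifold
open Topology

/-! ### A smooth retraction onto a knot -/

section Retraction

/-- The inverse function theorem, with smoothness on open sets. -/
lemma exists_smooth_openPartialHomeomorph {E E' : Type} [NormedAddCommGroup E] [NormedSpace ℝ E]
    [CompleteSpace E] [NormedAddCommGroup E'] [NormedSpace ℝ E'] {f : E → E'} {U : Set E}
    (hU : IsOpen U) (hf : ContDiffOn ℝ ∞ f U) {p : E} (hp : p ∈ U) (f' : E ≃L[ℝ] E')
    (hf' : HasFDerivAt f (f' : E →L[ℝ] E') p) :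
    ∃ φ : OpenPartialHomeomorph E E', p ∈ φ.source ∧ φ.source ⊆ U ∧ (∀ x, φ x = f x) ∧
      ContDiffOn ℝ ∞ φ φ.source ∧ ContDiffOn ℝ ∞ φ.symm φ.target := by
  have hfa : ∀ x ∈ U, ContDiffAt ℝ ∞ f x := fun x hx => hf.contDiffAt (hU.mem_nhds hx)
  let φ₀ := (hfa p hp).toOpenPartialHomeomorph f hf' (by simp)
  have hcont : ContinuousOn (fderiv ℝ f) U := hf.continuousOn_fderiv_of_isOpen hU (by simp)
  -- Shrinking to the open set where the derivative is invertible makes the inverse smooth on the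
  -- whole target, not only at the image of `p`.
  let V := U ∩ fderiv ℝ f ⁻¹' Set.range ((↑) : (E ≃L[ℝ] E') → E →L[ℝ] E')
  have hV : IsOpen V := hcont.isOpen_inter_preimage hU ContinuousLinearEquiv.isOpen
  let φ := φ₀.restrOpen V hV
  have hsrc : ∀ x ∈ φ.source, x ∈ V := fun x hx => hx.2
  refine ⟨φ, ?_, fun x hx => (hsrc x hx).1, fun x => rfl, fun x hx => ?_, fun y hy => ?_⟩
  · exact ⟨(hfa p hp).mem_toOpenPartialHomeomorph_source hf' (by simp), hp, by
      rw [Set.mem_preimage, hf'.fderiv]; exact ⟨f', rfl⟩⟩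
  · exact (hfa x (hsrc x hx).1).contDiffWithinAt
  · have hx := φ.map_target hy
    obtain ⟨hxU, e, he⟩ := hsrc _ hx
    have hd : HasFDerivAt φ (e : E →L[ℝ] E') (φ.symm y) := by
      rw [he]
      exact ((hfa _ hxU).differentiableAt (by simp)).hasFDerivAt
    exact (φ.contDiffAt_symm hy hd (hfa _ hxU)).contDiffWithinAt

variable (K : Knot)

/-- The knot as a curve in four-space. -/
noncomputable def Knot.curve (s : ℝ) : E4 := (K.toFun s : E4)

lemma Knot.contDiff_curve : ContDiff ℝ ∞ K.curve := K.contDiff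

lemma Knot.curve_periodic : Function.Periodic K.curve 1 := fun s => by
  unfold Knot.curve; rw [K.periodic]

lemma Knot.curve_add_int (s : ℝ) (n : ℤ) : K.curve (s + n) = K.curve s := by
  have := K.curve_periodic.int_mul n s
  simpa using this

lemma Knot.norm_curve (s : ℝ) : ‖K.curve s‖ = 1 := norm_coe_S3 _

lemma Knot.curve_ne_zero (s : ℝ) : K.curve s ≠ 0 := by
  rw [← norm_ne_zero_iff, K.norm_curve]; exact one_ne_zero

lemma Knot.exists_int_of_curve_eq {s t : ℝ} (h : K.curve s = K.curve t) : ∃ n : ℤ, t = s + n :=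
  K.injective_mod s t (Subtype.ext h)

lemma Knot.range_curve : Set.range K.curve = K.curve '' Set.Icc 0 1 := by
  refine Set.Subset.antisymm ?_ (Set.image_subset_range _ _)
  rintro _ ⟨s, rfl⟩
  refine ⟨Int.fract s, ⟨Int.fract_nonneg s, (Int.fract_lt_one s).le⟩, ?_⟩
  conv_rhs => rw [← Int.fract_add_floor s, K.curve_add_int]

lemma Knot.isCompact_range_curve : IsCompact (Set.range K.curve) := by
  rw [K.range_curve]
  exact isCompact_Icc.image K.contDiff_curve.continuous

lemma Knot.coe_image_carrier : Subtype.val '' K.carrier = Set.range K.curve := by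
  rw [Knot.carrier, ← Set.range_comp]; rfl

/-- A local smooth left inverse of the parametrization of a knot. -/
lemma Knot.exists_local_parameter (s₀ : ℝ) : ∃ (U : Set E4) (σ : E4 → ℝ), IsOpen U ∧
    K.curve s₀ ∈ U ∧ ContDiffOn ℝ ∞ σ U ∧ σ (K.curve s₀) = s₀ ∧
    ∀ s, K.curve s ∈ U → ∃ n : ℤ, s = σ (K.curve s) + n := by
  let v := deriv K.curve s₀
  have hv : v ≠ 0 := K.deriv_ne_zero s₀
  -- Projection to the tangent line is a local coordinate along the knot; its inverse function gives
  -- the parameter.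
  let ℓ : E4 →L[ℝ] ℝ := innerSL ℝ v
  have hℓγ : ContDiff ℝ ∞ (fun s => ℓ (K.curve s)) := ℓ.contDiff.comp K.contDiff_curve
  have hder : HasDerivAt (fun s => ℓ (K.curve s)) (ℓ v) s₀ := by
    have := (K.contDiff_curve.differentiable (by simp) s₀).hasDerivAt
    exact ℓ.hasFDerivAt.comp_hasDerivAt s₀ this
  have hℓv : ℓ v ≠ 0 := by
    simp [ℓ, hv]
  let e : ℝ ≃L[ℝ] ℝ := ContinuousLinearEquiv.unitsEquivAut ℝ (Units.mk0 (ℓ v) hℓv)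
  have hd : HasFDerivAt (fun s => ℓ (K.curve s)) (e : ℝ →L[ℝ] ℝ) s₀ := by
    rw [hasFDerivAt_iff_hasDerivAt]
    convert hder using 1
    simp [e]
  obtain ⟨φ, hs, -, hφ, -, hsymm⟩ := exists_smooth_openPartialHomeomorph isOpen_univ
    hℓγ.contDiffOn (Set.mem_univ s₀) e hd
  -- The rest of one period has compact image, which misses the base point by injectivity. Removing
  -- this image ensures that every parameter landing in the neighbourhood is, modulo one, in the
  -- source of `φ`.
  have hcomp : IsCompact (K.curve '' (Set.Icc (s₀ - 1 / 2) (s₀ + 1 / 2) \ φ.source)) :=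
    (isCompact_Icc.diff φ.open_source).image K.contDiff_curve.continuous
  refine ⟨(K.curve '' (Set.Icc (s₀ - 1 / 2) (s₀ + 1 / 2) \ φ.source))ᶜ ∩ ℓ ⁻¹' φ.target,
    fun q => φ.symm (ℓ q), ?_, ⟨?_, ?_⟩, ?_, ?_, ?_⟩
  · exact hcomp.isClosed.isOpen_compl.inter (φ.open_target.preimage ℓ.continuous)
  · rintro ⟨s, ⟨hs1, hs2⟩, hs3⟩
    obtain ⟨n, hn⟩ := K.exists_int_of_curve_eq hs3
    have : n = 0 := by
      have h1 : |(n : ℝ)| < 1 := by rw [abs_lt]; constructor <;> linarith [hs1.1, hs1.2]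
      rw [← Int.cast_abs] at h1
      exact Int.abs_lt_one_iff.1 (by exact_mod_cast h1)
    rw [this, Int.cast_zero, add_zero] at hn
    exact hs2 (hn ▸ hs)
  · have := φ.map_source hs
    rwa [hφ] at this
  · exact hsymm.comp ℓ.contDiff.contDiffOn fun q hq => hq.2
  · have := φ.left_inv hs
    rwa [hφ] at this
  · intro s hsU
    let n : ℤ := round (s - s₀)
    have hr := abs_sub_round (s - s₀)
    rw [abs_le] at hr
    have e1 : K.curve (s - n) = K.curve s := by
      have := K.curve_add_int (s - n) n
      rw [sub_add_cancel] at this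
      exact this.symm
    have hmem : s - n ∈ φ.source := by
      by_contra hcon
      exact hsU.1 ⟨s - n, ⟨⟨by linarith [hr.1], by linarith [hr.2]⟩, hcon⟩, e1⟩
    have := φ.left_inv hmem
    rw [hφ, e1] at this
    exact ⟨n, by change s = φ.symm (ℓ (K.curve s)) + n; rw [this]; ring⟩

/-- A smooth retraction of a neighbourhood of a knot to the knot. -/
lemma Knot.exists_retraction : ∃ (O : Set E4) (r : E4 → S3), IsOpen O ∧ Set.range K.curve ⊆ O ∧
    ContDiffOn ℝ ∞ (fun q => (r q : E4)) O ∧ (∀ q, r q ∈ K.carrier) ∧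
    ∀ s, r (K.curve s) = K.toFun s := by
  let ex : ℝ → ℂ := fun s => Complex.exp (2 * Real.pi * s * Complex.I)
  have hex : ContDiff ℝ ∞ ex := by
    have : ContDiff ℝ ∞ (fun s : ℝ => (2 * Real.pi * s * Complex.I : ℂ)) := by
      have := Complex.ofRealCLM.contDiff (n := ∞)
      exact (contDiff_const.mul this).mul contDiff_const
    exact (Complex.contDiff_exp (𝕜 := ℂ).restrict_scalars ℝ).comp this
  have hexint : ∀ (s : ℝ) (n : ℤ), ex (s + n) = ex s := by
    intro s n
    have : (2 * Real.pi * ((s + n : ℝ) : ℂ) * Complex.I : ℂ) =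
        2 * Real.pi * s * Complex.I + n * (2 * Real.pi * Complex.I) := by push_cast; ring
    simp only [ex]
    rw [this, Complex.exp_periodic.int_mul n]
  -- The parameter is only defined modulo one, so `exp (2πis)` is extended instead. Prescribing its
  -- value on the knot is a convex condition, hence local extensions glue. Where the extension is
  -- non-zero its argument returns a parameter.
  obtain ⟨f, hf⟩ := exists_contMDiffMap_forall_mem_convex_of_local (n := ⊤) 𝓘(ℝ, E4)
    (t := fun q : E4 => {z : ℂ | ∀ s, K.curve s = q → z = ex s}) (by
      intro q z hz w hw a b ha hb hab s hs
      rw [hz s hs, hw s hs, ← add_smul, hab, one_smul]) (by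
      intro q
      by_cases hq : q ∈ Set.range K.curve
      · obtain ⟨s₀, rfl⟩ := hq
        obtain ⟨U, σ, hU, h0, hσ, -, h⟩ := K.exists_local_parameter s₀
        refine ⟨U, hU.mem_nhds h0, fun q => ex (σ q), (hex.comp_contDiffOn hσ).contMDiffOn, ?_⟩
        rintro y hy s rfl
        obtain ⟨n, hn⟩ := h s hy
        conv_rhs => rw [hn, hexint]
      · refine ⟨(Set.range K.curve)ᶜ, K.isCompact_range_curve.isClosed.isOpen_compl.mem_nhds hq,
          fun _ => 0, contMDiffOn_const, ?_⟩
        rintro y hy s rfl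
        exact (hy ⟨s, rfl⟩).elim)
  have hfs : ContDiff ℝ ∞ f := f.contMDiff.contDiff
  have hKint : ∀ (s : ℝ) (n : ℤ), K.toFun (s + n) = K.toFun s := fun s n =>
    Subtype.ext (K.curve_add_int s n)
  refine ⟨{q | f q ≠ 0}, fun q => K.toFun ((f q).arg / (2 * Real.pi)),
    isOpen_ne_fun hfs.continuous continuous_const, ?_, ?_, fun q => ⟨_, rfl⟩, ?_⟩
  · rintro _ ⟨s, rfl⟩
    change f (K.curve s) ≠ 0
    rw [hf _ s rfl]
    exact Complex.exp_ne_zero _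
  · intro q₀ hq₀
    have hq₀' : f q₀ ≠ 0 := hq₀
    refine ContDiffAt.contDiffWithinAt ?_
    -- The argument has a branch cut. Comparing with the value at `q₀` through the logarithm near
    -- `1` changes it only by an integral number of periods, which the knot does not see.
    have hsm : ContDiffAt ℝ ∞ (fun q => K.curve ((f q₀).arg / (2 * Real.pi) +
        (Complex.log (f q / f q₀)).im / (2 * Real.pi))) q₀ := by
      refine K.contDiff_curve.contDiffAt.comp q₀ (contDiffAt_const.add (ContDiffAt.div_const ?_ _))
      have h1 : ContDiffAt ℝ ∞ (fun q => Complex.log (f q / f q₀)) q₀ := by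
        refine ContDiffAt.comp q₀ (g := Complex.log) (f := fun q => f q / f q₀) ?_ ?_
        · rw [div_self hq₀']
          exact (Complex.contDiffAt_log (by simp)).restrict_scalars ℝ
        · exact hfs.contDiffAt.div_const _
      exact Complex.imCLM.contDiff.contDiffAt.comp q₀ h1
    refine hsm.congr_of_eventuallyEq ?_
    filter_upwards [(isOpen_ne_fun hfs.continuous continuous_const).mem_nhds hq₀'] with q hq
    have hang : ((f q).arg : Real.Angle) = ((f q₀).arg + (f q / f q₀).arg : ℝ) := by
      have := Complex.arg_mul_coe_angle hq₀' (div_ne_zero hq hq₀')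
      rw [mul_div_cancel₀ _ hq₀'] at this
      rw [this]; simp
    obtain ⟨n, hn⟩ := Real.Angle.angle_eq_iff_two_pi_dvd_sub.1 hang
    have : (f q).arg / (2 * Real.pi) = (f q₀).arg / (2 * Real.pi) +
        (Complex.log (f q / f q₀)).im / (2 * Real.pi) + n := by
      rw [Complex.log_im]
      field_simp
      linarith
    change K.curve _ = _
    rw [this, K.curve_add_int]
  · intro s
    change K.toFun _ = _
    have h1 : f (K.curve s) = ex s := hf _ s rfl
    have hang : ((ex s).arg : Real.Angle) = ((2 * Real.pi * s : ℝ) : Real.Angle) := by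
      simp only [ex]
      rw [Complex.arg_exp, Real.Angle.coe_toIocMod]
      simp
    obtain ⟨n, hn⟩ := Real.Angle.angle_eq_iff_two_pi_dvd_sub.1 hang
    have : (f (K.curve s)).arg / (2 * Real.pi) = s + n := by
      rw [h1]
      field_simp
      linarith
    rw [this, hKint]

end Retraction
end FourGenus

namespace FourGenus

open scoped ContDiff Manifold
open Topology

/-! ### A displacement field that carries the surface to a cone -/

section Straightening

/-- The chart is a homeomorphism that matches the ball with a half-space, so it matches their
topological boundaries too. -/
lemma norm_eq_one_iff_of_chart {φ : OpenPartialHomeomorph E4 E4}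
    (h : ∀ x ∈ φ.source, x ∈ D4 ↔ 0 ≤ φ x 0) {x : E4} (hx : x ∈ φ.source) :
    ‖x‖ = 1 ↔ φ x 0 = 0 := by
  have hc0 : Continuous (fun y : E4 => y 0) := by fun_prop
  constructor
  · intro hn
    have h0 : 0 ≤ φ x 0 := (h x hx).1 (by simp [hn])
    by_contra hne
    have hpos : 0 < φ x 0 := lt_of_le_of_ne h0 (Ne.symm hne)
    have hev : ∀ᶠ y in 𝓝 x, y ∈ D4 := by
      have h1 := (φ.continuousAt hx).eventually (hc0.continuousAt.eventually (lt_mem_nhds hpos))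
      filter_upwards [h1, φ.open_source.mem_nhds hx] with y hy hys
      exact (h y hys).2 hy.le
    have hint : x ∈ interior D4 := mem_interior_iff_mem_nhds.2 hev
    rw [interior_closedBall _ one_ne_zero, mem_ball_zero_iff, hn] at hint
    exact lt_irrefl _ hint
  · intro h0
    have hx1 : x ∈ D4 := (h x hx).2 h0.ge
    rw [mem_closedBall_zero_iff] at hx1
    by_contra hne
    have hlt : ‖x‖ < 1 := lt_of_le_of_ne hx1 hne
    have hev : ∀ᶠ y in 𝓝 x, y ∈ D4 := by
      filter_upwards [(isOpen_lt continuous_norm continuous_const).mem_nhds hlt] with y hy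
      exact mem_closedBall_zero_iff.2 (le_of_lt hy)
    have h2 : ∀ᶠ z in 𝓝 (φ x), 0 ≤ z 0 := by
      have h3 := (φ.symm.continuousAt (φ.map_source hx))
      rw [ContinuousAt, φ.left_inv hx] at h3
      filter_upwards [h3.eventually hev, h3.eventually (φ.open_source.mem_nhds hx),
        φ.open_target.mem_nhds (φ.map_source hx)] with z hz hz' hzt
      have := (h _ hz').1 hz
      rwa [φ.right_inv hzt] at this
    have h4 : Filter.Tendsto (fun a : ℝ => φ x - a • EuclideanSpace.single 0 1) (𝓝[>] 0)
        (𝓝 (φ x)) := by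
      have : Continuous (fun a : ℝ => φ x - a • (EuclideanSpace.single 0 1 : E4)) := by fun_prop
      have h5 := this.tendsto 0
      simp only [zero_smul, sub_zero] at h5
      exact h5.mono_left nhdsWithin_le_nhds
    obtain ⟨a, ha, ha'⟩ := ((h4.eventually h2).and self_mem_nhdsWithin).exists
    simp [h0] at ha
    exact absurd ha' (not_lt.2 ha)

/-- The projection of four-space to the first two coordinates, as a map to four-space. -/
noncomputable def planeProj : E4 →L[ℝ] E4 :=
  LinearMap.toContinuousLinearMap
    { toFun := fun x => !₂[x 0, x 1, 0, 0]
      map_add' := fun x y => by ext i; fin_cases i <;> simp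
      map_smul' := fun a x => by ext i; fin_cases i <;> simp }

@[simp] lemma planeProj_zero (x : E4) : planeProj x 0 = x 0 := rfl
@[simp] lemma planeProj_one (x : E4) : planeProj x 1 = x 1 := rfl
@[simp] lemma planeProj_two (x : E4) : planeProj x 2 = 0 := rfl
@[simp] lemma planeProj_three (x : E4) : planeProj x 3 = 0 := rfl

lemma planeProj_eq_self {x : E4} (h2 : x 2 = 0) (h3 : x 3 = 0) : planeProj x = x := by
  ext i; fin_cases i <;> simp [h2, h3]

variable {K : Knot} {F : Set E4}

lemma HasBoundary.norm_eq_one_iff (hK : HasBoundary F K) {p : E4} (hp : p ∈ F) :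
    ‖p‖ = 1 ↔ p ∈ Set.range K.curve := by
  rw [← K.coe_image_carrier, ← hK]
  simp [hp]

lemma HasBoundary.curve_mem (hK : HasBoundary F K) (s : ℝ) : K.curve s ∈ F := by
  have : K.curve s ∈ F ∩ Metric.sphere 0 1 := by
    rw [hK, K.coe_image_carrier]; exact ⟨s, rfl⟩
  exact this.1

/-- A smooth vector field that vanishes on the sphere and moves the surface near its boundary to
the cone over the boundary. -/
lemma exists_straightening_field (hF : IsProperSurface F) (hK : HasBoundary F K) :
    ∃ (Z : Set E4) (d : E4 → E4) (r : E4 → S3), Z ∈ 𝓝ˢ (Set.range K.curve) ∧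
      ContDiff ℝ ∞ d ∧ (∀ p, ‖p‖ = 1 → d p = 0) ∧ (∀ p, r p ∈ K.carrier) ∧
      (∀ p ∈ F ∩ Z, p + d p = ‖p‖ • (r p : E4)) := by
  obtain ⟨O, r, hO, hCO, hr, hrK, hrs⟩ := K.exists_retraction
  have hCO' : Set.range K.curve ⊆ O ∩ {p | p ≠ 0} := fun p hp => ⟨hCO hp, by
    obtain ⟨s, rfl⟩ := hp; exact K.curve_ne_zero s⟩
  have hO' : IsOpen (O ∩ {p : E4 | p ≠ 0}) := hO.inter isOpen_ne
  obtain ⟨δ, hδ, hδO⟩ := K.isCompact_range_curve.exists_cthickening_subset_open hO' hCO'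
  set Z := Metric.cthickening δ (Set.range K.curve) with hZ
  have hZc : IsClosed Z := Metric.isClosed_cthickening
  have hFc : IsClosed F := hF.isCompact.isClosed
  let R : E4 → E4 := fun p => ‖p‖ • (r p : E4)
  have hR : ContDiffOn ℝ ∞ R (O ∩ {p : E4 | p ≠ 0}) := by
    intro p hp
    exact ((contDiffAt_id.norm ℝ hp.2).contDiffWithinAt).smul (hr.mono Set.inter_subset_left p hp)
  have hRC : ∀ p ∈ Set.range K.curve, R p = p := by
    rintro _ ⟨s, rfl⟩
    simp only [R, hrs, K.norm_curve, one_smul]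
    rfl
  -- Both requirements, a prescribed value on the surface near the knot and zero on the sphere, are
  -- affine in the value of `d`. It suffices to satisfy them locally.
  obtain ⟨d, hd⟩ := exists_contMDiffMap_forall_mem_convex_of_local (n := ⊤) 𝓘(ℝ, E4)
    (t := fun q : E4 => {v : E4 | (q ∈ F ∩ Z → v = R q - q) ∧ (‖q‖ = 1 → v = 0)}) (by
      intro q v hv w hw a b ha hb hab
      refine ⟨fun hq => ?_, fun hq => ?_⟩
      · rw [hv.1 hq, hw.1 hq, ← add_smul, hab, one_smul]
      · rw [hv.2 hq, hw.2 hq, ← add_smul, hab, one_smul]) (by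
      intro q
      by_cases hq1 : ‖q‖ = 1
      · by_cases hqF : q ∈ F
        · have hqC := (hK.norm_eq_one_iff hqF).1 hq1
          obtain ⟨φ, hqφ, h1, h2, h3, h4⟩ := hF.chart q hqF
          have hproj : planeProj (φ q) = φ q := planeProj_eq_self ((h4 q hqφ).1 hqF).2.1
            ((h4 q hqφ).1 hqF).2.2
          let V := φ.source ∩ φ ⁻¹' (planeProj ⁻¹' φ.target)
          have hV : IsOpen V := φ.isOpen_inter_preimage
            (φ.open_target.preimage planeProj.continuous)
          -- In a surface chart, `ρ` forgets the two normal coordinates. It fixes the points of `F`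
          -- and sends points of the sphere to the knot, where `R` is the identity, so `R ∘ ρ - ρ`
          -- meets both requirements.
          let ρ : E4 → E4 := fun x => φ.symm (planeProj (φ x))
          have hρ : ContDiffOn ℝ ∞ ρ V := h2.comp
            (planeProj.contDiff.comp_contDiffOn (h1.mono Set.inter_subset_left)) fun x hx => hx.2
          have hρq : ρ q = q := by simp only [ρ, hproj]; exact φ.left_inv hqφ
          let W := V ∩ ρ ⁻¹' (O ∩ {p : E4 | p ≠ 0})
          have hW : IsOpen W := hρ.continuousOn.isOpen_inter_preimage hV hO'
          refine ⟨W, hW.mem_nhds ⟨⟨hqφ, ?_⟩, ?_⟩, fun x => R (ρ x) - ρ x,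
            ((hR.comp (hρ.mono Set.inter_subset_left) fun x hx => hx.2).sub
              (hρ.mono Set.inter_subset_left)).contMDiffOn, fun x hx => ⟨?_, ?_⟩⟩
          · change planeProj (φ q) ∈ φ.target
            rw [hproj]; exact φ.map_source hqφ
          · change ρ q ∈ O ∩ {p : E4 | p ≠ 0}
            rw [hρq]; exact hCO' hqC
          · rintro ⟨hxF, -⟩
            have hxs := hx.1.1
            have : ρ x = x := by
              simp only [ρ]
              rw [planeProj_eq_self ((h4 x hxs).1 hxF).2.1 ((h4 x hxs).1 hxF).2.2]
              exact φ.left_inv hxs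
            change R (ρ x) - ρ x = _
            rw [this]
          · intro hx1
            have hxs := hx.1.1
            have hxt : planeProj (φ x) ∈ φ.target := hx.1.2
            have hρs : ρ x ∈ φ.source := φ.map_target hxt
            have hφρ : φ (ρ x) = planeProj (φ x) := φ.right_inv hxt
            have h0 : φ x 0 = 0 := (norm_eq_one_iff_of_chart h3 hxs).1 hx1
            have hρF : ρ x ∈ F := by
              rw [h4 _ hρs, hφρ]
              simp [h0]
            have hρ1 : ‖ρ x‖ = 1 := by
              rw [norm_eq_one_iff_of_chart h3 hρs, hφρ]
              simp [h0]
            change R (ρ x) - ρ x = 0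
            rw [hRC _ ((hK.norm_eq_one_iff hρF).1 hρ1), sub_self]
        · refine ⟨Fᶜ, hFc.isOpen_compl.mem_nhds hqF, fun _ => 0, contMDiffOn_const, fun x hx =>
            ⟨fun h => (hx h.1).elim, fun _ => rfl⟩⟩
      · have hns : IsOpen {x : E4 | ‖x‖ ≠ 1} := isOpen_ne_fun continuous_norm continuous_const
        by_cases hqF : q ∈ F ∩ Z
        · refine ⟨(O ∩ {p : E4 | p ≠ 0}) ∩ {x : E4 | ‖x‖ ≠ 1},
            (hO'.inter hns).mem_nhds ⟨hδO hqF.2, hq1⟩, fun x => R x - x,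
            ((hR.mono Set.inter_subset_left).sub contDiffOn_id).contMDiffOn, fun x hx =>
            ⟨fun _ => rfl, fun h => (hx.2 h).elim⟩⟩
        · refine ⟨(F ∩ Z)ᶜ, (hFc.inter hZc).isOpen_compl.mem_nhds hqF, fun _ => 0,
            contMDiffOn_const, fun x hx => ⟨fun h => (hx h).elim, fun _ => rfl⟩⟩)
  refine ⟨Z, d, r, ?_, d.contMDiff.contDiff, fun p hp => (hd p).2 hp, hrK, fun p hp => ?_⟩
  · exact Filter.mem_of_superset (Metric.isOpen_thickening.mem_nhdsSet.2
      (Metric.self_subset_thickening hδ _)) (Metric.thickening_subset_cthickening δ _)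
  · rw [(hd p).1 hp]
    simp [R]

/-- A smooth map that vanishes on the unit sphere is small and has small Lipschitz constants on
the nearby spheres. -/
lemma exists_lipschitz_on_spheres {d : E4 → E4} (hd : ContDiff ℝ ∞ d)
    (hd1 : ∀ p, ‖p‖ = 1 → d p = 0) {m : ℝ} (hm : 0 < m) :
    ∃ ε > 0, ∀ p q : E4, ‖p‖ = ‖q‖ → |‖p‖ - 1| < ε →
      ‖d p‖ ≤ m ∧ ‖d p - d q‖ ≤ m * ‖p - q‖ := by
  have hd' : Continuous (fderiv ℝ d) := hd.continuous_fderiv (by simp)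
  have c1 : Continuous (fun x : ℝ × E4 => x.1 • fderiv ℝ d (x.1 • x.2) - fderiv ℝ d x.2) := by
    fun_prop
  have c2 : Continuous (fun x : ℝ × E4 => d (x.1 • x.2) - d x.2) := by
    have := hd.continuous
    fun_prop
  -- This bounds the derivative of `x ↦ d (r • x) - d x`, whose second term vanishes on the unit
  -- sphere. The bound is `m / 2` because passing from radius one to a radius above `1/2` costs a
  -- factor at most two.
  have e1 : ∀ᶠ r : ℝ in 𝓝 1, ∀ x ∈ Metric.closedBall (0 : E4) 1,
      ‖r • fderiv ℝ d (r • x) - fderiv ℝ d x‖ < m / 2 := by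
    refine (isCompact_closedBall (0 : E4) 1).eventually_forall_of_forall_eventually fun x _ => ?_
    refine c1.norm.continuousAt.eventually (gt_mem_nhds ?_)
    simpa using hm
  have e2 : ∀ᶠ r : ℝ in 𝓝 1, ∀ x ∈ Metric.closedBall (0 : E4) 1, ‖d (r • x) - d x‖ < m := by
    refine (isCompact_closedBall (0 : E4) 1).eventually_forall_of_forall_eventually fun x _ => ?_
    refine c2.norm.continuousAt.eventually (gt_mem_nhds ?_)
    simpa using hm
  obtain ⟨ε, hε, hb⟩ := Metric.eventually_nhds_iff.1 (e1.and e2)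
  refine ⟨min ε (1 / 2), by positivity, fun p q hpq hp => ?_⟩
  obtain ⟨b1, b2⟩ := hb (y := ‖p‖) (by
    rw [Real.dist_eq]; exact hp.trans_le (min_le_left _ _))
  have hp2 : 1 / 2 < ‖p‖ := by
    have := (abs_lt.1 (hp.trans_le (min_le_right _ _))).1
    linarith
  have hx : ∀ p' : E4, ‖p'‖ = ‖p‖ → ∃ x : E4, ‖x‖ = 1 ∧ ‖p‖ • x = p' := fun p' hp' =>
    ⟨dir p', norm_coe_S3 _, by rw [← hp', norm_smul_dir]⟩
  obtain ⟨x, hx1, hxp⟩ := hx p rfl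
  obtain ⟨y, hy1, hyq⟩ := hx q hpq.symm
  have hxb : x ∈ Metric.closedBall (0 : E4) 1 := by simp [hx1]
  have hyb : y ∈ Metric.closedBall (0 : E4) 1 := by simp [hy1]
  constructor
  · have := b2 x hxb
    rw [hxp, hd1 x hx1, sub_zero] at this
    exact this.le
  · have key := (convex_closedBall (0 : E4) 1).norm_image_sub_le_of_norm_hasFDerivWithin_le
      (f := fun x => d (‖p‖ • x) - d x)
      (f' := fun x => ‖p‖ • fderiv ℝ d (‖p‖ • x) - fderiv ℝ d x) (C := m / 2)
      (fun x _ => by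
        have h1 := (hd.differentiable (by simp) (‖p‖ • x)).hasFDerivAt
        have h2 := h1.comp x ((hasFDerivAt_id (𝕜 := ℝ) x).const_smul ‖p‖)
        have h3 := (h2.sub (hd.differentiable (by simp) x).hasFDerivAt).hasFDerivWithinAt
          (s := Metric.closedBall (0 : E4) 1)
        convert! h3 using 1
        ext v
        simp) (fun x hx => (b1 x hx).le) hyb hxb
    simp only [hxp, hyq, hd1 x hx1, hd1 y hy1, sub_zero] at key
    refine key.trans ?_
    have : ‖p - q‖ = ‖p‖ * ‖x - y‖ := by
      conv_lhs => rw [← hxp, ← hyq, ← smul_sub, norm_smul]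
      rw [norm_norm]
    rw [this]
    nlinarith [mul_nonneg hm.le (norm_nonneg (x-y)), mul_nonneg (mul_nonneg hm.le (norm_nonneg (x - y))) (by linarith : (0:ℝ) ≤ ‖p‖ - 1/2)]

end Straightening
end FourGenus

namespace FourGenus

open scoped ContDiff Manifold
open Topology

/-! ### Moving a collar of the surface into the cone over its boundary -/

section Collar

/-- The curve is the great circle through `x` with velocity `v`. -/
lemma exists_curve_on_sphere {x v : E4} (hx : ‖x‖ = 1) (hv : inner ℝ x v = 0) :
    ∃ c : ℝ → E4, c 0 = x ∧ HasDerivAt c v 0 ∧ ∀ τ, ‖c τ‖ = 1 := by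
  by_cases h0 : v = 0
  · exact ⟨fun _ => x, rfl, by rw [h0]; exact hasDerivAt_const _ _, fun _ => hx⟩
  have hn : ‖v‖ ≠ 0 := norm_ne_zero_iff.2 h0
  refine ⟨fun τ => Real.cos (‖v‖ * τ) • x + (Real.sin (‖v‖ * τ) / ‖v‖) • v, by simp, ?_, fun τ => ?_⟩
  · have hl : HasDerivAt (fun τ : ℝ => ‖v‖ * τ) ‖v‖ 0 := by
      simpa using (hasDerivAt_id (0 : ℝ)).const_mul ‖v‖
    have h1 := (hl.cos.smul_const x).add ((hl.sin.div_const ‖v‖).smul_const v)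
    convert! h1 using 1
    simp [hn]
  · have : ‖Real.cos (‖v‖ * τ) • x + (Real.sin (‖v‖ * τ) / ‖v‖) • v‖ ^ 2 = 1 := by
      rw [norm_add_sq_real, norm_smul, norm_smul, inner_smul_left, inner_smul_right, hv, hx]
      simp only [mul_zero, add_zero, mul_one, Real.norm_eq_abs, mul_pow, sq_abs, div_pow]
      rw [div_mul_cancel₀ _ (pow_ne_zero 2 hn)]
      exact Real.cos_sq_add_sin_sq _
    nlinarith [norm_nonneg (Real.cos (‖v‖ * τ) • x + (Real.sin (‖v‖ * τ) / ‖v‖) • v)]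

/-- A function that is constant on the sphere near a point has no derivative along the sphere. -/
lemma eq_zero_of_const_on_sphere {G : Type} [NormedAddCommGroup G] [NormedSpace ℝ G] {f : E4 → G}
    {f' : E4 →L[ℝ] G} {x v : E4} (hx : ‖x‖ = 1) (hf : HasFDerivAt f f' x)
    (h : ∀ᶠ y in 𝓝 x, ‖y‖ = 1 → f y = f x) (hv : inner ℝ x v = 0) : f' v = 0 := by
  obtain ⟨c, c0, hc, hn⟩ := exists_curve_on_sphere hx hv
  rw [← c0] at hf h
  have h1 := hf.comp_hasDerivAt (0 : ℝ) hc
  have h2 : f ∘ c =ᶠ[𝓝 0] fun _ => f (c 0) := by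
    filter_upwards [hc.continuousAt.eventually h] with τ hτ
    exact hτ (hn τ)
  exact (h1.congr_of_eventuallyEq h2.symm).unique (hasDerivAt_const _ _)

/-- On the unit sphere itself the tangential derivative of `d` vanishes, and the derivative is
uniformly continuous near the sphere. -/
lemma exists_lipschitz_deriv_on_spheres {d : E4 → E4} (hd : ContDiff ℝ ∞ d)
    (hd1 : ∀ p, ‖p‖ = 1 → d p = 0) {m : ℝ} (hm : 0 < m) :
    ∃ ε > 0, ∀ p v : E4, |‖p‖ - 1| < ε → inner ℝ p v = 0 → ‖fderiv ℝ d p v‖ ≤ m * ‖v‖ := by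
  have hd' : Continuous (fderiv ℝ d) := hd.continuous_fderiv (by simp)
  have c1 : Continuous (fun x : ℝ × E4 => fderiv ℝ d (x.1 • x.2) - fderiv ℝ d x.2) := by
    fun_prop
  have e1 : ∀ᶠ r : ℝ in 𝓝 1, ∀ x ∈ Metric.closedBall (0 : E4) 1,
      ‖fderiv ℝ d (r • x) - fderiv ℝ d x‖ < m := by
    refine (isCompact_closedBall (0 : E4) 1).eventually_forall_of_forall_eventually fun x _ => ?_
    refine c1.norm.continuousAt.eventually (gt_mem_nhds ?_)
    simpa using hm
  obtain ⟨ε, hε, hb⟩ := Metric.eventually_nhds_iff.1 e1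
  refine ⟨min ε (1 / 2), by positivity, fun p v hp hv => ?_⟩
  have b1 := hb (y := ‖p‖) (by rw [Real.dist_eq]; exact hp.trans_le (min_le_left _ _)) (dir p)
    (by simp)
  rw [norm_smul_dir] at b1
  have hz : fderiv ℝ d (dir p) v = 0 := by
    refine eq_zero_of_const_on_sphere (norm_coe_S3 _) (hd.differentiable (by simp) _).hasFDerivAt
      (Filter.Eventually.of_forall fun y hy => by rw [hd1 y hy, hd1 _ (norm_coe_S3 _)]) ?_
    have h0 : p ≠ 0 := by
      rintro rfl
      have := hp.trans_le (min_le_right _ _)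
      norm_num at this
    rw [coe_dir h0, inner_smul_left, hv, mul_zero]
  have : fderiv ℝ d p v = (fderiv ℝ d p - fderiv ℝ d (dir p)) v := by simp [hz]
  rw [this]
  exact (ContinuousLinearMap.le_opNorm _ _).trans (by gcongr)

/-- Gives injectivity after radial rescaling. Since `p - q ⟂ p + q` and `p + e` is nearly parallel
to `p + q`, the factor `1 - k` is controlled by `m ‖p - q‖`. Then `‖p - q‖ ≤ 5m ‖p - q‖`, which
forces `p = q`. -/
lemma radial_injective_aux {p q e e' : E4} {m : ℝ} (hm : m = 1 / 100) (hpq : ‖p‖ = ‖q‖)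
    (hp : 1 / 2 < ‖p‖) (he : ‖e‖ ≤ m) (he' : ‖e'‖ ≤ m) (hee : ‖e - e'‖ ≤ m * ‖p - q‖) {k : ℝ}
    (hk : 0 < k) (h : q + e' = k • (p + e)) : p = q := by
  set a := p + e with ha
  have hpq' : p - q = (1 - k) • a - (e - e') := by
    rw [sub_smul, one_smul, ← h, ha]; abel
  have horth : inner ℝ (p - q) (p + q) = 0 := by
    rw [real_inner_comm, real_inner_add_sub_eq_zero_iff]; exact hpq
  have hpplus : p + q = (1 + k) • a - (e + e') := by
    rw [add_smul, one_smul, ← h, ha]; abel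
  have han : ‖p‖ - m ≤ ‖a‖ := by
    have := norm_sub_le a e
    rw [ha, add_sub_cancel_right] at this
    rw [ha]; linarith
  have hap : ‖a‖ * (‖a‖ - 2 * m) ≤ inner ℝ a (p + q) := by
    rw [hpplus, inner_sub_right, inner_smul_right, real_inner_self_eq_norm_sq]
    have h1 := (real_inner_le_norm a (e + e')).trans
      (mul_le_mul_of_nonneg_left (norm_add_le e e') (norm_nonneg a))
    have h2 : ‖a‖ * (‖e‖ + ‖e'‖) ≤ ‖a‖ * (2 * m) := by
      gcongr; linarith
    nlinarith [sq_nonneg ‖a‖, mul_nonneg hk.le (sq_nonneg ‖a‖)]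
  have hapos : 0 < ‖a‖ := by linarith
  have hEq : (1 - k) * inner ℝ a (p + q) = inner ℝ (e - e') (p + q) := by
    rw [hpq', inner_sub_left, inner_smul_left] at horth
    simpa [sub_eq_zero] using horth
  have hE : |1 - k| * inner ℝ a (p + q) ≤ m * ‖p - q‖ * (2 * ‖p‖) := by
    have h0 : 0 ≤ inner ℝ a (p + q) := le_trans (by
      apply mul_nonneg hapos.le; linarith) hap
    have h1 : |1 - k| * inner ℝ a (p + q) = |inner ℝ (e - e') (p + q)| := by
      rw [← hEq, abs_mul, abs_of_nonneg h0]
    rw [h1]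
    refine (abs_real_inner_le_norm _ _).trans ?_
    have : ‖p + q‖ ≤ 2 * ‖p‖ := (norm_add_le _ _).trans (by linarith)
    gcongr
  have hD : ‖p - q‖ ≤ |1 - k| * ‖a‖ + m * ‖p - q‖ := by
    conv_lhs => rw [hpq']
    refine (norm_sub_le _ _).trans ?_
    rw [norm_smul, Real.norm_eq_abs]
    gcongr
  have h3 : (|1 - k| * ‖a‖) * (‖a‖ - 2 * m) ≤ m * ‖p - q‖ * (2 * ‖p‖) := by
    refine le_trans ?_ hE
    rw [mul_assoc]
    exact mul_le_mul_of_nonneg_left hap (abs_nonneg _)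
  have h4 : (|1 - k| * ‖a‖) * (‖p‖ / 2) ≤ m * ‖p - q‖ * (2 * ‖p‖) := by
    refine le_trans (mul_le_mul_of_nonneg_left ?_ (by positivity)) h3
    linarith
  have h5 : |1 - k| * ‖a‖ ≤ 4 * m * ‖p - q‖ := by
    by_contra hc
    push Not at hc
    nlinarith
  rw [← sub_eq_zero, ← norm_eq_zero]
  nlinarith [norm_nonneg (p - q)]

/-- The infinitesimal counterpart of `radial_injective_aux`: pairing with `p ⟂ v` bounds `k` by a
multiple of `m ‖v‖`, and then `‖v‖` is bounded by a small multiple of itself. -/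
lemma radial_deriv_aux {p v e e' : E4} {m : ℝ} (hm : m = 1 / 100) (hv : inner ℝ p v = 0)
    (hp : 1 / 2 < ‖p‖) (he : ‖e‖ ≤ m) (he' : ‖e'‖ ≤ m * ‖v‖) {k : ℝ}
    (h : v + e' = k • (p + e)) : v = 0 := by
  have h1 : k * inner ℝ p (p + e) = inner ℝ p e' := by
    rw [← inner_smul_right, ← h, inner_add_right, hv, zero_add]
  have h2 : ‖p‖ * (‖p‖ - m) ≤ inner ℝ p (p + e) := by
    rw [inner_add_right, real_inner_self_eq_norm_sq]
    have := (abs_le.1 (abs_real_inner_le_norm p e)).1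
    have h3 : ‖p‖ * ‖e‖ ≤ ‖p‖ * m := by gcongr
    nlinarith
  have h0 : 0 ≤ inner ℝ p (p + e) := le_trans (by
      apply mul_nonneg (norm_nonneg _); linarith) h2
  have h4 : |k| * (‖p‖ * (‖p‖ - m)) ≤ ‖p‖ * (m * ‖v‖) := by
    refine (mul_le_mul_of_nonneg_left h2 (abs_nonneg k)).trans ?_
    rw [← abs_of_nonneg h0, ← abs_mul, h1]
    refine (abs_real_inner_le_norm _ _).trans (by gcongr)
  have h5 : |k| * (‖p‖ - m) ≤ m * ‖v‖ := by
    have hpos : 0 < ‖p‖ := by linarith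
    refine le_of_mul_le_mul_left ?_ hpos
    linarith
  have h6 : ‖v‖ ≤ |k| * ‖p + e‖ + m * ‖v‖ := by
    have : v = k • (p + e) - e' := by rw [← h]; abel
    conv_lhs => rw [this]
    refine (norm_sub_le _ _).trans ?_
    rw [norm_smul, Real.norm_eq_abs]
    gcongr
  have h7 : ‖p + e‖ ≤ 2 * (‖p‖ - m) := (norm_add_le _ _).trans (by linarith)
  have h8 : |k| * ‖p + e‖ ≤ |k| * (2 * (‖p‖ - m)) := by gcongr
  rw [← norm_eq_zero]
  nlinarith [norm_nonneg v]

variable {K : Knot} {F : Set E4}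

/-- A norm preserving diffeomorphism that moves the surface, near its boundary, into the cone over
the boundary. -/
lemma exists_ballDiffeo_into_cone (hF : IsProperSurface F) (hK : HasBoundary F K) :
    ∃ Φ : BallDiffeo, (∀ p, ‖p‖ = 1 → Φ.toHomeomorph p = p) ∧
      ∃ ε > 0, ∀ p ∈ F, 1 - ε < ‖p‖ → dir (Φ.toHomeomorph p) ∈ K.carrier := by
  obtain ⟨Z, d, r, hZ, hd, hd1, hr, hFZ⟩ := exists_straightening_field hF hK
  set m : ℝ := 1 / 100 with hm
  obtain ⟨ε₁, hε₁, h1⟩ := exists_lipschitz_on_spheres hd hd1 (m := m) (by norm_num)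
  obtain ⟨ε₂, hε₂, h2⟩ := exists_lipschitz_deriv_on_spheres hd hd1 (m := m) (by norm_num)
  set ε := min (min ε₁ ε₂) (1 / 4) with hε
  have hεpos : 0 < ε := by positivity
  have hεq : ε ≤ 1 / 4 := min_le_right _ _
  let β : ContDiffBump (1 : ℝ) := ⟨ε / 2, ε, by positivity, by linarith⟩
  have hβ0 : ∀ t, ε ≤ |t - 1| → β t = 0 := fun t ht => β.zero_of_le_dist (by
    rw [Real.dist_eq]; exact ht)
  let E : E4 → E4 := fun p => β ‖p‖ • d p
  have hE0 : ∀ p, ε ≤ |‖p‖ - 1| → E p = 0 := fun p hp => by simp [E, hβ0 _ hp]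
  have hE : ∀ p, ‖E p‖ ≤ m := by
    intro p
    by_cases hp : |‖p‖ - 1| < ε
    · have := (h1 p p rfl (hp.trans_le ((min_le_left _ _).trans (min_le_left _ _)))).1
      rw [norm_smul, Real.norm_eq_abs, abs_of_nonneg β.nonneg]
      calc _ ≤ 1 * ‖d p‖ := by gcongr; exact β.le_one
        _ ≤ m := by linarith
    · rw [hE0 p (not_lt.1 hp)]; simp [hm]
  have hEE : ∀ p q, ‖p‖ = ‖q‖ → ‖E p - E q‖ ≤ m * ‖p - q‖ := by
    intro p q hpq
    by_cases hp : |‖p‖ - 1| < ε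
    · have := (h1 p q hpq (hp.trans_le ((min_le_left _ _).trans (min_le_left _ _)))).2
      simp only [E]
      rw [← hpq, ← smul_sub, norm_smul, Real.norm_eq_abs, abs_of_nonneg β.nonneg]
      calc _ ≤ 1 * ‖d p - d q‖ := by gcongr; exact β.le_one
        _ ≤ _ := by linarith
    · rw [hE0 p (not_lt.1 hp), hE0 q (by rw [← hpq]; exact not_lt.1 hp)]
      simp only [sub_self, norm_zero]; positivity
  have hfar : ∀ p : E4, ‖p‖ ≤ 3 / 4 → E p = 0 := fun p hp => hE0 p (by
    rw [abs_of_nonpos (by linarith)]; linarith)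
  have hw0 : ∀ p : E4, p ≠ 0 → p + E p ≠ 0 := by
    intro p hp h0
    by_cases hp2 : ‖p‖ ≤ 3 / 4
    · rw [hfar p hp2, add_zero] at h0; exact hp h0
    · have h3 : ‖p‖ = ‖E p‖ := by 
        have := congrArg norm (eq_neg_of_add_eq_zero_left h0)
        rwa [norm_neg] at this
      have := hE p
      rw [hm] at this
      linarith
  -- The displacement is cut off away from the sphere and then rescaled to the original norm; the
  -- rescaling does not change the direction, which is all that membership in the cone depends on.
  let f : E4 → E4 := fun p => (‖p‖ / ‖p + E p‖) • (p + E p)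
  have hfn : ∀ p, ‖f p‖ = ‖p‖ := by
    intro p
    by_cases hp : p = 0
    · simp [f, hp]
    · have := norm_ne_zero_iff.2 (hw0 p hp)
      simp only [f]
      rw [norm_smul, norm_div, norm_norm, norm_norm, div_mul_cancel₀ _ this]
  have hfnear : ∀ p, ‖p‖ ≤ 3 / 4 → f p = p := by
    intro p hp
    by_cases hp0 : p = 0
    · simp [f, hp0]
    · simp only [f, hfar p hp, add_zero]
      rw [div_self (norm_ne_zero_iff.2 hp0), one_smul]
  have hfnear' : ∀ p : E4, ‖p‖ < 3 / 4 → f =ᶠ[𝓝 p] id := fun p hp => by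
    filter_upwards [(isOpen_lt continuous_norm continuous_const).mem_nhds hp] with q hq
    exact hfnear q (le_of_lt hq)
  have hEd : ∀ p : E4, p ≠ 0 → ContDiffAt ℝ ∞ (fun p => p + E p) p := fun p hp =>
    contDiffAt_id.add (((β.contDiff (n := ⊤)).contDiffAt.comp p (contDiffAt_id.norm ℝ hp)).smul
      hd.contDiffAt)
  have hfd : ContDiff ℝ ∞ f := by
    rw [contDiff_iff_contDiffAt]
    intro p
    by_cases hp : p = 0
    · exact contDiffAt_id.congr_of_eventuallyEq (hfnear' p (by rw [hp, norm_zero]; norm_num))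
    · exact ((contDiffAt_id.norm ℝ hp).div ((hEd p hp).norm ℝ (hw0 p hp))
        (norm_ne_zero_iff.2 (hw0 p hp))).smul (hEd p hp)
  have hinj : Function.Injective f := by
    intro p q hpq
    have hn : ‖p‖ = ‖q‖ := by rw [← hfn p, hpq, hfn]
    by_cases hp : ‖p‖ ≤ 3 / 4
    · rwa [hfnear p hp, hfnear q (by rwa [← hn])] at hpq
    · push Not at hp
      have hp0 : 0 < ‖p‖ := by linarith
      have hq0 : 0 < ‖q‖ := by linarith
      have hwp := norm_pos_iff.2 (hw0 p (norm_pos_iff.1 hp0))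
      have hwq := norm_pos_iff.2 (hw0 q (norm_pos_iff.1 hq0))
      refine radial_injective_aux hm hn (by linarith) (hE p) (hE q) (hEE p q hn)
        (k := (‖q‖ / ‖q + E q‖)⁻¹ * (‖p‖ / ‖p + E p‖)) (by positivity) ?_
      rw [mul_smul]
      change _ = _ • f p
      rw [hpq]
      change _ = _ • _ • _
      rw [smul_smul, inv_mul_cancel₀ (by positivity), one_smul]
  have hder : ∀ p v, fderiv ℝ f p v = 0 → v = 0 := by
    intro p v hv
    by_cases hp : ‖p‖ < 3 / 4
    · rw [(hfnear' p hp).fderiv_eq] at hv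
      simpa using hv
    · have hp' : 3 / 4 ≤ ‖p‖ := not_lt.1 hp
      have hp0 : p ≠ 0 := norm_pos_iff.1 (by linarith)
      have horth : inner ℝ p v = 0 := by
        have := fderiv_orthogonal_of_norm_preserving (v := v) (hfd.differentiable (by simp) p) hfn hv
        exact this
      have hw := ((hEd p hp0).differentiableAt (by simp)).hasFDerivAt
      set w' := fderiv ℝ (fun p => p + E p) p with hw'
      have hk : DifferentiableAt ℝ (fun p : E4 => ‖p‖ / ‖p + E p‖) p :=
        ((contDiffAt_id.norm ℝ hp0).div ((hEd p hp0).norm ℝ (hw0 p hp0))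
        (norm_ne_zero_iff.2 (hw0 p hp0))).differentiableAt (n := ∞) (by simp)
      have hf' := (hk.hasFDerivAt.smul hw).fderiv
      -- By the product rule, a kernel vector `v` makes `w' v` a multiple of `p + E p`, the
      -- hypothesis of `radial_deriv_aux`.
      have hv2 : (‖p‖ / ‖p + E p‖) • w' v +
          (fderiv ℝ (fun p : E4 => ‖p‖ / ‖p + E p‖) p v) • (p + E p) = 0 := by
        rw [← hv]
        change _ = fderiv ℝ (fun p => (‖p‖ / ‖p + E p‖) • (p + E p)) p v
        rw [show (fun p => (‖p‖ / ‖p + E p‖) • (p + E p)) =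
          (fun p => ‖p‖ / ‖p + E p‖) • (fun p => p + E p) from rfl, hf']
        simp
      have hkpos : 0 < ‖p‖ / ‖p + E p‖ := div_pos (norm_pos_iff.2 hp0)
        (norm_pos_iff.2 (hw0 p hp0))
      -- the derivative of `p + E p` in the direction `v`
      have hw'v : w' v = v + β ‖p‖ • fderiv ℝ d p v := by
        have hb : HasFDerivAt (fun p : E4 => β ‖p‖) _ p :=
          ((β.contDiff (n := ⊤)).contDiffAt.differentiableAt (by simp)).hasFDerivAt.comp p
          ((contDiffAt_id.norm ℝ hp0).differentiableAt (n := ∞) (by simp)).hasFDerivAt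
        have hb2 := (hasFDerivAt_id (𝕜 := ℝ) p).add
          (hb.smul (hd.differentiable (by simp) p).hasFDerivAt)
        have := hw.unique hb2
        rw [this]
        have hnv : fderiv ℝ (fun x : E4 => ‖x‖) p v = 0 := by
          have hN : HasFDerivAt (fun x : E4 => ‖x‖) _ p :=
            ((contDiffAt_id.norm ℝ hp0).differentiableAt (n := ∞) (by simp)).hasFDerivAt
          have h3 := DFunLike.congr_fun ((hN.pow 2).unique (hasFDerivAt_id (𝕜 := ℝ) p).norm_sq) v
          simpa [horth, hp0] using h3
        simp [hnv]
      · refine radial_deriv_aux hm horth (by linarith) (hE p)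
          (e' := β ‖p‖ • fderiv ℝ d p v)
          (k := -((‖p‖ / ‖p + E p‖)⁻¹ * fderiv ℝ (fun p : E4 => ‖p‖ / ‖p + E p‖) p v)) ?_ ?_
        · by_cases hpε : |‖p‖ - 1| < ε
          · have := h2 p v (hpε.trans_le ((min_le_left _ _).trans (min_le_right _ _))) horth
            rw [norm_smul, Real.norm_eq_abs, abs_of_nonneg β.nonneg]
            calc _ ≤ 1 * ‖fderiv ℝ d p v‖ := by gcongr; exact β.le_one
              _ ≤ _ := by linarith
          · rw [hβ0 _ (not_lt.1 hpε), zero_smul, norm_zero]; positivity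
        · rw [← hw'v, neg_smul, mul_smul, ← eq_neg_of_add_eq_zero_left hv2 |> neg_eq_iff_eq_neg.2,
            smul_neg, neg_neg, smul_smul, inv_mul_cancel₀ hkpos.ne', one_smul]
  obtain ⟨Φ, hΦ⟩ := exists_ballDiffeo hfd hfn hinj hder
  refine ⟨Φ, fun p hp => ?_, ?_⟩
  · rw [hΦ]
    simp only [f, E, hd1 p hp, smul_zero, add_zero, hp]
    simp
  -- Outside the neighbourhood `Z` of the knot the surface is compact and misses the sphere, so a
  -- thin enough collar of the surface lies in `Z`.
  · have hcpt : IsCompact (F \ interior Z) := hF.isCompact.diff isOpen_interior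
    have hlt : ∀ p ∈ F \ interior Z, ‖p‖ < 1 := by
      intro p hp
      have h3 : ‖p‖ ≤ 1 := mem_closedBall_zero_iff.1 (hF.subset_ball hp.1)
      refine lt_of_le_of_ne h3 fun h4 => hp.2 ?_
      exact subset_interior_iff_mem_nhdsSet.2 hZ ((hK.norm_eq_one_iff hp.1).1 h4)
    obtain ⟨ε₃, hε₃, h3⟩ : ∃ ε₃ > 0, ∀ p ∈ F \ interior Z, ‖p‖ ≤ 1 - ε₃ := by
      rcases (F \ interior Z).eq_empty_or_nonempty with he | hne
      · exact ⟨1, one_pos, by simp [he]⟩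
      · obtain ⟨x, hx, hmax⟩ := hcpt.exists_isMaxOn hne continuous_norm.continuousOn
        exact ⟨1 - ‖x‖, by linarith [hlt x hx], fun p hp => by linarith [isMaxOn_iff.1 hmax p hp]⟩
    refine ⟨min ε₃ (ε / 2), by positivity, fun p hp hpn => ?_⟩
    have hpZ : p ∈ Z := by
      by_contra hcon
      have := h3 p ⟨hp, fun h => hcon (interior_subset h)⟩
      linarith [min_le_left ε₃ (ε / 2)]
    have hp1 : ‖p‖ ≤ 1 := mem_closedBall_zero_iff.1 (hF.subset_ball hp)
    have hβ1 : β ‖p‖ = 1 := β.one_of_mem_closedBall (by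
      rw [Metric.mem_closedBall, Real.dist_eq, abs_of_nonpos (by linarith)]
      change _ ≤ ε / 2
      linarith [min_le_right ε₃ (ε / 2)])
    have hpos : 0 < ‖p‖ := by linarith [min_le_right ε₃ (ε / 2)]
    have hfp : f p = ‖p‖ • (r p : E4) := by
      simp only [f, E, hβ1, one_smul]
      rw [hFZ p ⟨hp, hpZ⟩, norm_smul, norm_coe_S3, norm_norm, mul_one, div_self hpos.ne', one_smul]
    rw [hΦ, hfp, dir_smul hpos]
    exact hr p

end Collar
end FourGenus

namespace FourGenus

open scoped ContDiff Manifold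
open Topology

/-! ### The surface coincides with the cone near the sphere -/

section Straight

section Chart

variable {E E' : Type} [NormedAddCommGroup E] [NormedSpace ℝ E] [NormedAddCommGroup E']
  [NormedSpace ℝ E']

lemma chart_hasFDerivAt {φ : OpenPartialHomeomorph E E'} (h : ContDiffOn ℝ ∞ φ φ.source) {x : E}
    (hx : x ∈ φ.source) : HasFDerivAt φ (fderiv ℝ φ x) x :=
  ((h.contDiffAt (φ.open_source.mem_nhds hx)).differentiableAt (by simp)).hasFDerivAt

lemma chart_fderiv_symm_apply {φ : OpenPartialHomeomorph E E'} (h : ContDiffOn ℝ ∞ φ φ.source)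
    (h' : ContDiffOn ℝ ∞ φ.symm φ.target) {x : E} (hx : x ∈ φ.source) (v : E) :
    fderiv ℝ φ.symm (φ x) (fderiv ℝ φ x v) = v := by
  have h1 := (chart_hasFDerivAt (φ := φ.symm) h' (φ.map_source hx)).comp x (chart_hasFDerivAt h hx)
  have h2 : φ.symm ∘ φ =ᶠ[𝓝 x] id := by
    filter_upwards [φ.open_source.mem_nhds hx] with y hy
    exact φ.left_inv hy
  have := (h1.congr_of_eventuallyEq h2.symm).unique (hasFDerivAt_id x)
  exact DFunLike.congr_fun this v

lemma chart_fderiv_apply_symm {φ : OpenPartialHomeomorph E E'} (h : ContDiffOn ℝ ∞ φ φ.source)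
    (h' : ContDiffOn ℝ ∞ φ.symm φ.target) {x : E} (hx : x ∈ φ.source) (v : E') :
    fderiv ℝ φ x (fderiv ℝ φ.symm (φ x) v) = v := by
  have := chart_fderiv_symm_apply (φ := φ.symm) h' h (φ.map_source hx) v
  rwa [φ.left_inv hx] at this

end Chart

lemma HasFDerivAt.coord {f : E4 → E4} {f' : E4 →L[ℝ] E4} {x : E4} (h : HasFDerivAt f f' x)
    (i : Fin 4) : HasFDerivAt (fun y => f y i) ((EuclideanSpace.proj i).comp f') x :=
  (EuclideanSpace.proj (𝕜 := ℝ) i).hasFDerivAt.comp x h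

variable {K : Knot} {F : Set E4}

/-- If the surface lies near its boundary in the cone over the boundary, then it contains the cone
near the boundary. -/
lemma exists_cone_subset (hF : IsProperSurface F) (hK : HasBoundary F K) {ε : ℝ} (hε : 0 < ε)
    (hcone : ∀ p ∈ F, 1 - ε < ‖p‖ → dir p ∈ K.carrier) (s₀ : ℝ) :
    ∀ᶠ p in 𝓝 (K.curve s₀), p ∈ D4 → dir p ∈ K.carrier → p ∈ F := by
  set c := K.curve s₀ with hc
  have hc1 : ‖c‖ = 1 := K.norm_curve s₀
  have hcF : c ∈ F := hK.curve_mem s₀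
  obtain ⟨φ, hcφ, h1, h2, h3, h4⟩ := hF.chart c hcF
  obtain ⟨U, σ, hU, hcU, hσ, hσ0, hσU⟩ := K.exists_local_parameter s₀
  set A := fderiv ℝ φ c with hA
  have hAd := chart_hasFDerivAt h1 hcφ
  have hAinj : ∀ v, A v = 0 → v = 0 := fun v hv => by
    rw [← chart_fderiv_symm_apply h1 h2 hcφ v, ← hA, hv, map_zero]
  have hγ : HasDerivAt K.curve (deriv K.curve s₀) s₀ :=
    (K.contDiff_curve.differentiable (by simp) s₀).hasDerivAt
  have hγne : deriv K.curve s₀ ≠ 0 := K.deriv_ne_zero s₀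
  have hγs : ∀ᶠ s in 𝓝 s₀, K.curve s ∈ φ.source :=
    hγ.continuousAt.eventually (φ.open_source.mem_nhds hcφ)
  -- In the chart the knot satisfies `u₀ = u₂ = u₃ = 0`, so its velocity has only a `u₁` component.
  have hAγ : ∀ i : Fin 4, i ≠ 1 → A (deriv K.curve s₀) i = 0 := by
    intro i hi
    have e1 := (HasFDerivAt.coord hAd i).comp_hasDerivAt s₀ hγ
    have e2 : (fun y => φ y i) ∘ K.curve =ᶠ[𝓝 s₀] fun _ => 0 := by
      filter_upwards [hγs] with s hs
      have h5 := (h4 _ hs).1 (hK.curve_mem s)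
      have h6 := (norm_eq_one_iff_of_chart h3 hs).1 (K.norm_curve s)
      change φ (K.curve s) i = 0
      fin_cases i
      · exact h6
      · exact (hi rfl).elim
      · exact h5.2.1
      · exact h5.2.2
    exact (e1.congr_of_eventuallyEq e2.symm).unique (hasDerivAt_const _ _)
  have hA1 : A (deriv K.curve s₀) 1 ≠ 0 := by
    intro h0
    refine hγne (hAinj _ ?_)
    ext i
    by_cases hi : i = 1
    · rw [hi]; exact h0
    · exact hAγ i hi
  -- Otherwise the differential of `u₀` would vanish on the radial direction as well as along the
  -- sphere, contradicting that `u₀` is a coordinate.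
  have hA0 : A c 0 ≠ 0 := by
    intro h0
    set u := fderiv ℝ φ.symm (φ c) (EuclideanSpace.single 0 1) with hu
    have hAu : A u = EuclideanSpace.single 0 1 := chart_fderiv_apply_symm h1 h2 hcφ _
    have h5 : A (u - (inner ℝ c u) • c) 0 = 0 := by
      refine eq_zero_of_const_on_sphere (v := u - (inner ℝ c u) • c) hc1
        (HasFDerivAt.coord hAd 0) ?_ ?_
      · filter_upwards [φ.open_source.mem_nhds hcφ] with y hy hy1
        rw [(norm_eq_one_iff_of_chart h3 hy).1 hy1, (norm_eq_one_iff_of_chart h3 hcφ).1 hc1]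
      · rw [inner_sub_right, inner_smul_right, real_inner_self_eq_norm_sq, hc1]; ring
    simp [hAu, h0] at h5
  -- the two surface coordinates, in polar coordinates on the cone
  let Ψ : ℝ × ℝ → ℝ × ℝ := fun x => (φ (x.2 • K.curve x.1) 0, φ (x.2 • K.curve x.1) 1)
  let pol : ℝ × ℝ → E4 := fun x => x.2 • K.curve x.1
  have hpol : ContDiff ℝ ∞ pol := contDiff_snd.smul (K.contDiff_curve.comp contDiff_fst)
  have hpol0 : pol (s₀, 1) = c := by simp [pol, hc]
  let W : Set (ℝ × ℝ) := pol ⁻¹' φ.source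
  have hW : IsOpen W := φ.open_source.preimage hpol.continuous
  have hWs : ((s₀, 1) : ℝ × ℝ) ∈ W := by
    change pol (s₀, 1) ∈ φ.source; rw [hpol0]; exact hcφ
  have hφpol : ContDiffOn ℝ ∞ (fun x => φ (pol x)) W := h1.comp hpol.contDiffOn fun x hx => hx
  have hcoord : ∀ i : Fin 4, ContDiffOn ℝ ∞ (fun x => φ (pol x) i) W := fun i =>
    (EuclideanSpace.proj (𝕜 := ℝ) i).contDiff.comp_contDiffOn hφpol
  have hΨ : ContDiffOn ℝ ∞ Ψ W := (hcoord 0).prodMk (hcoord 1)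
  have hpd : HasFDerivAt pol ((ContinuousLinearMap.fst ℝ ℝ ℝ).smulRight (deriv K.curve s₀) +
      (ContinuousLinearMap.snd ℝ ℝ ℝ).smulRight c) (s₀, 1) := by
    have e1 : HasFDerivAt (fun x : ℝ × ℝ => K.curve x.1)
        ((ContinuousLinearMap.fst ℝ ℝ ℝ).smulRight (deriv K.curve s₀)) (s₀, 1) := by
      have := HasFDerivAt.comp (g := K.curve) (f := Prod.fst) ((s₀, 1) : ℝ × ℝ) hγ.hasFDerivAt
        hasFDerivAt_fst
      convert! this using 1
    have e2 := (hasFDerivAt_snd (𝕜 := ℝ) (p := ((s₀, 1) : ℝ × ℝ))).smul e1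
    convert! e2 using 1
    ext <;> simp [hc]
  have hφd := hAd
  rw [← hpol0] at hφd
  have hcomp := hφd.comp _ hpd
  rw [hpol0] at hcomp
  let L : ℝ × ℝ →L[ℝ] ℝ × ℝ := ((EuclideanSpace.proj (𝕜 := ℝ) (0 : Fin 4)).comp
    (A.comp ((ContinuousLinearMap.fst ℝ ℝ ℝ).smulRight (deriv K.curve s₀) +
      (ContinuousLinearMap.snd ℝ ℝ ℝ).smulRight c))).prod ((EuclideanSpace.proj (𝕜 := ℝ)
    (1 : Fin 4)).comp (A.comp ((ContinuousLinearMap.fst ℝ ℝ ℝ).smulRight (deriv K.curve s₀) +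
      (ContinuousLinearMap.snd ℝ ℝ ℝ).smulRight c)))
  have hL : HasFDerivAt Ψ L (s₀, 1) :=
    ((EuclideanSpace.proj (𝕜 := ℝ) (0 : Fin 4)).hasFDerivAt.comp _ hcomp).prodMk
      ((EuclideanSpace.proj (𝕜 := ℝ) (1 : Fin 4)).hasFDerivAt.comp _ hcomp)
  have hLinj : Function.Injective (L : ℝ × ℝ →ₗ[ℝ] ℝ × ℝ) := by
    rw [injective_iff_map_eq_zero]
    rintro ⟨x, y⟩ hxy
    have g0 : A (x • deriv K.curve s₀ + y • c) 0 = 0 := congrArg Prod.fst hxy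
    have g1 : A (x • deriv K.curve s₀ + y • c) 1 = 0 := congrArg Prod.snd hxy
    have hy : y = 0 := by simpa [hAγ 0 (by decide), hA0] using g0
    have hx : x = 0 := by simpa [hy, hA1] using g1
    simp [hx, hy]
  let Le : (ℝ × ℝ) ≃L[ℝ] ℝ × ℝ :=
    (LinearEquiv.ofInjectiveEndo (L : ℝ × ℝ →ₗ[ℝ] ℝ × ℝ) hLinj).toContinuousLinearEquiv
  obtain ⟨χ, hsχ, hχW, hχ, -, -⟩ := exists_smooth_openPartialHomeomorph hW hΨ hWs Le hL
  -- polar coordinates of a point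
  let P : E4 → ℝ × ℝ := fun y => (σ (dir y), ‖y‖)
  have hdirc : ContinuousAt dir c := (contMDiffAt_dir (K.curve_ne_zero s₀)).continuousAt
  have hdc : (dir c : E4) = c := by
    rw [coe_dir (K.curve_ne_zero s₀), hc1, inv_one, one_smul]
  have hdcE : ContinuousAt (fun y => (dir y : E4)) c := continuous_subtype_val.continuousAt.comp hdirc
  have hP : ContinuousAt P c := by
    refine ContinuousAt.prodMk ?_ continuous_norm.continuousAt
    refine ContinuousAt.comp (g := σ) (f := fun y => (dir y : E4)) ?_ hdcE
    rw [hdc]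
    exact hσ.continuousOn.continuousAt (hU.mem_nhds hcU)
  have hPc : P c = (s₀, 1) := by simp only [P, hdc, hc1]; rw [hσ0]
  have hPpol : ∀ y : E4, (dir y : E4) ∈ U → dir y ∈ K.carrier → pol (P y) = y := by
    intro y hyU hyK
    obtain ⟨s, hs⟩ := hyK
    have hs' : K.curve s = dir y := congrArg Subtype.val hs
    obtain ⟨n, hn⟩ := hσU s (by rw [hs']; exact hyU)
    simp only [pol, P]
    rw [← hs', ← K.curve_add_int _ n, ← hn, hs', norm_smul_dir]
  have hgood : ∀ᶠ y in 𝓝 c, P y ∈ χ.source ∧ (dir y : E4) ∈ U ∧ y ∈ φ.source := by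
    refine (hP.eventually ?_).and ((hdcE.eventually ?_).and (φ.open_source.mem_nhds hcφ))
    · rw [hPc]; exact χ.open_source.mem_nhds hsχ
    · change ∀ᶠ y in 𝓝 (dir c : E4), y ∈ U
      rw [hdc]; exact hU.mem_nhds hcU
  -- For a ball point `y` close to `c`, dropping the normal coordinates gives a point of `F` with
  -- the same `u₀` and `u₁`.
  let ρ : E4 → E4 := fun x => φ.symm (planeProj (φ x))
  have hproj : planeProj (φ c) = φ c := planeProj_eq_self ((h4 c hcφ).1 hcF).2.1
    ((h4 c hcφ).1 hcF).2.2
  have hρc : ρ c = c := by simp only [ρ, hproj]; exact φ.left_inv hcφ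
  have hpc : ContinuousAt (fun x => planeProj (φ x)) c :=
    planeProj.continuous.continuousAt.comp (φ.continuousAt hcφ)
  have hρ : ContinuousAt ρ c := by
    refine ContinuousAt.comp (g := φ.symm) (f := fun x => planeProj (φ x)) ?_ hpc
    rw [hproj]
    exact φ.symm.continuousAt (φ.map_source hcφ)
  have hnear : ∀ᶠ y in 𝓝 c, 1 - ε < ‖y‖ :=
    continuous_norm.continuousAt.eventually (lt_mem_nhds (by change 1 - ε < ‖c‖; rw [hc1]; linarith))
  have hρev : ∀ᶠ y in 𝓝 c, (P (ρ y) ∈ χ.source ∧ (dir (ρ y) : E4) ∈ U ∧ ρ y ∈ φ.source) ∧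
      1 - ε < ‖ρ y‖ := by
    refine hρ.eventually (p := fun y => (P y ∈ χ.source ∧ (dir y : E4) ∈ U ∧ y ∈ φ.source) ∧
      1 - ε < ‖y‖) ?_
    rw [hρc]
    exact hgood.and hnear
  have htev : ∀ᶠ y in 𝓝 c, planeProj (φ y) ∈ φ.target := by
    refine hpc.eventually (p := fun z => z ∈ φ.target) ?_
    change ∀ᶠ y in 𝓝 (planeProj (φ c)), y ∈ φ.target
    rw [hproj]
    exact φ.open_target.mem_nhds (φ.map_source hcφ)
  filter_upwards [hgood, hρev, htev] with y hy hy' hyt hyD hyK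
  have hφρ : φ (ρ y) = planeProj (φ y) := φ.right_inv hyt
  have hρF : ρ y ∈ F := by
    rw [h4 _ hy'.1.2.2, hφρ]
    simp only [planeProj_zero, planeProj_two, planeProj_three, and_true]
    exact (h3 y hy.2.2).1 hyD
  have hρK := hcone _ hρF hy'.2
  have e1 := hPpol y hy.2.1 hyK
  have e2 := hPpol _ hy'.1.2.1 hρK
  -- Both `y` and `ρ y` lie in the cone and have the same `u₀` and `u₁`. These two functions
  -- determine the polar coordinates locally, so `y = ρ y`, a point of `F`.
  have : P y = P (ρ y) := by
    refine χ.injOn hy.1 hy'.1.1 ?_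
    rw [hχ, hχ]
    change (φ (pol (P y)) 0, φ (pol (P y)) 1) = (φ (pol (P (ρ y))) 0, φ (pol (P (ρ y))) 1)
    rw [e1, e2, hφρ, planeProj_zero, planeProj_one]
  rw [← e1, this, e2]
  exact hρF

/-- Every surface can be made conical near the boundary, by a diffeomorphism of the ball that is
the identity on the sphere. -/
theorem exists_conical (hF : IsProperSurface F) (hK : HasBoundary F K) :
    ∃ F₁ : Set E4, IsProperSurface F₁ ∧ firstBetti F₁ = firstBetti F ∧
      ∃ ε > 0, ∀ p, 1 - ε < ‖p‖ → ‖p‖ ≤ 1 → (p ∈ F₁ ↔ dir p ∈ K.carrier) := by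
  obtain ⟨Φ, hΦ1, ε, hε, hΦ⟩ := exists_ballDiffeo_into_cone hF hK
  have hF₁ := Φ.isProperSurface hF
  have hK₁ : HasBoundary (Φ.toHomeomorph '' F) K := by
    rw [HasBoundary, ← hK]
    ext p
    simp only [Set.mem_inter_iff, mem_sphere_zero_iff_norm]
    constructor
    · rintro ⟨⟨q, hq, rfl⟩, hp⟩
      rw [Φ.norm_map] at hp
      rw [hΦ1 q hp]
      exact ⟨hq, hp⟩
    · rintro ⟨hp, hp1⟩
      exact ⟨⟨p, hp, hΦ1 p hp1⟩, hp1⟩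
  have hcone : ∀ p ∈ Φ.toHomeomorph '' F, 1 - ε < ‖p‖ → dir p ∈ K.carrier := by
    rintro _ ⟨q, hq, rfl⟩ hn
    rw [Φ.norm_map] at hn
    exact hΦ q hq hn
  have hev : ∀ᶠ p in 𝓝ˢ (Set.range K.curve), p ∈ D4 → dir p ∈ K.carrier →
      p ∈ Φ.toHomeomorph '' F := by
    rw [eventually_nhdsSet_iff_forall]
    rintro _ ⟨s, rfl⟩
    exact exists_cone_subset hF₁ hK₁ hε hcone s
  obtain ⟨δ, hδ, hδO⟩ := K.isCompact_range_curve.exists_cthickening_subset_open isOpen_interior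
    (subset_interior_iff_mem_nhdsSet.2 hev)
  refine ⟨_, hF₁, Φ.firstBetti_image F, min ε (min δ (1 / 2)), by positivity, fun p h1 h2 =>
    ⟨fun h => hcone p h (by linarith [min_le_left ε (min δ (1 / 2))]), fun h => ?_⟩⟩
  have h3 : min ε (min δ (1 / 2)) ≤ δ := (min_le_right _ _).trans (min_le_left _ _)
  have h4 : min ε (min δ (1 / 2)) ≤ 1 / 2 := (min_le_right _ _).trans (min_le_right _ _)
  refine interior_subset (hδO (Metric.mem_cthickening_of_dist_le p (dir p : E4) δ _ ?_ ?_))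
    (mem_closedBall_zero_iff.2 h2) h
  · obtain ⟨s, hs⟩ := h
    exact ⟨s, congrArg Subtype.val hs⟩
  · have hp0 : 0 < ‖p‖ := by linarith
    rw [dist_eq_norm]
    have : p - (dir p : E4) = (‖p‖ - 1) • (dir p : E4) := by
      rw [sub_smul, norm_smul_dir, one_smul]
    rw [this, norm_smul, norm_coe_S3, mul_one, Real.norm_eq_abs, abs_of_nonpos (by linarith)]
    linarith

end Straight
end FourGenus

namespace FourGenus

open scoped ContDiff Manifold unitInterval
open Topology

/-! ### Monotone functions of the depth -/

section Sweep

/-- A function that moves smoothly and monotonically between `0` and `1` in the time interval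
`[0, e]` and is constant outside. The number `z` is a time where it vanishes and `τ` is an inverse
function. -/
structure IsSweep (s τ : ℝ → ℝ) (e z : ℝ) : Prop where
  pos : 0 < e
  contDiff : ContDiff ℝ ∞ s
  nonneg : ∀ t, 0 ≤ s t
  le_one : ∀ t, s t ≤ 1
  eq_end : ∀ t, e ≤ t → s t = s e
  start_eq : s 0 = 1 - s e
  deriv_ne_zero : ∀ t, 0 < s t → s t < 1 → 0 < t ∧ t < e ∧ deriv s t ≠ 0
  zero_mem : 0 ≤ z ∧ z < 3 * e / 2
  apply_zero : s z = 0
  le_of_mem : ∀ t, 0 ≤ t → t < 3 * e / 2 → ∀ t' ∈ segment ℝ t z, s t' ≤ s t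
  continuousOn_inv : ContinuousOn τ (Set.Ioc 0 1)
  inv_mem : ∀ u ∈ Set.Ioc (0 : ℝ) 1, 0 ≤ τ u ∧ τ u < 3 * e / 2
  apply_inv : ∀ u ∈ Set.Ioc (0 : ℝ) 1, s (τ u) = u
  eq_of_mem : ∀ t, 0 ≤ t → t < 3 * e / 2 → 0 < s t → ∀ t' ∈ segment ℝ t (τ (s t)), s t' = s t

/-- On the open interval the function is logistic, `1 / (1 + exp (1/y - 1/(1-y)))`, with visibly
positive derivative. This strict monotonicity later makes the saddle regular in the radial
direction. -/
lemma smoothTransition_hasDerivAt {x : ℝ} (h0 : 0 < x) (h1 : x < 1) :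
    ∃ d > 0, HasDerivAt Real.smoothTransition d x := by
  have hE : ∀ y : ℝ, 0 < y → expNegInvGlue y = Real.exp (-y⁻¹) := fun y hy => by
    simp [expNegInvGlue, not_le.2 hy]
  have hev : Real.smoothTransition =ᶠ[𝓝 x] fun y => (1 + Real.exp (y⁻¹ - (1 - y)⁻¹))⁻¹ := by
    filter_upwards [Ioo_mem_nhds h0 h1] with y hy
    have h2 : 0 < 1 - y := by linarith [hy.2]
    rw [Real.smoothTransition, hE y hy.1, hE _ h2]
    have : Real.exp (y⁻¹ - (1 - y)⁻¹) = Real.exp (-(1 - y)⁻¹) / Real.exp (-y⁻¹) := by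
      rw [← Real.exp_sub]; congr 1; ring
    rw [this]
    field_simp
  have h2 : (1 : ℝ) - x ≠ 0 := by linarith
  have hh := (hasDerivAt_inv h0.ne').sub (((hasDerivAt_id x).const_sub 1).inv h2)
  have hd := ((hh.exp).const_add 1).inv (by positivity)
  refine ⟨_, ?_, hd.congr_of_eventuallyEq hev⟩
  have h3 : 0 < (x ^ 2)⁻¹ := by positivity
  have h4 : 0 < ((1 - x) ^ 2)⁻¹ := by positivity
  apply div_pos _ (by positivity)
  rw [neg_pos]
  apply mul_neg_of_pos_of_neg (Real.exp_pos _)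
  simp only [neg_neg, id_eq, one_div]
  linarith

lemma strictMonoOn_smoothTransition : StrictMonoOn Real.smoothTransition (Set.Icc 0 1) := by
  refine strictMonoOn_of_deriv_pos (convex_Icc 0 1) Real.smoothTransition.continuous.continuousOn ?_
  intro x hx
  rw [interior_Icc] at hx
  obtain ⟨d, hd, h⟩ := smoothTransition_hasDerivAt hx.1 hx.2
  rw [h.deriv]; exact hd

/-- A continuous inverse of the smooth transition function. -/
lemma exists_smoothTransition_inv : ∃ ρ : ℝ → ℝ, ContinuousOn ρ (Set.Icc 0 1) ∧
    (∀ u ∈ Set.Icc (0 : ℝ) 1, ρ u ∈ Set.Icc (0 : ℝ) 1 ∧ Real.smoothTransition (ρ u) = u) ∧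
    ∀ t ∈ Set.Icc (0 : ℝ) 1, ρ (Real.smoothTransition t) = t := by
  have hm : Set.MapsTo Real.smoothTransition (Set.Icc 0 1) (Set.Icc 0 1) := fun t _ =>
    ⟨Real.smoothTransition.nonneg t, Real.smoothTransition.le_one t⟩
  let f : Set.Icc (0 : ℝ) 1 → Set.Icc (0 : ℝ) 1 := hm.restrict
  have hf : StrictMono f := fun x y hxy => strictMonoOn_smoothTransition x.2 y.2 hxy
  have hsurj : Function.Surjective f := by
    rintro ⟨u, hu⟩
    have := intermediate_value_Icc (zero_le_one' ℝ) Real.smoothTransition.continuous.continuousOn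
    rw [Real.smoothTransition.zero, Real.smoothTransition.one] at this
    obtain ⟨t, ht, h⟩ := this hu
    exact ⟨⟨t, ht⟩, Subtype.ext h⟩
  let e := hf.orderIsoOfSurjective f hsurj
  refine ⟨fun u => e.symm (Set.projIcc 0 1 zero_le_one u), ?_, fun u hu => ⟨Subtype.coe_prop _, ?_⟩,
    fun t ht => ?_⟩
  · exact (continuous_subtype_val.comp (e.symm.continuous.comp continuous_projIcc)).continuousOn
  · have h1 : f (e.symm (Set.projIcc 0 1 zero_le_one u)) = Set.projIcc 0 1 zero_le_one u :=
      e.apply_symm_apply _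
    have := congrArg Subtype.val h1
    simp only [Set.projIcc_of_mem _ hu] at this ⊢
    exact this
  · have h1 : Set.projIcc 0 1 zero_le_one (Real.smoothTransition t) = e ⟨t, ht⟩ := by
      rw [Set.projIcc_of_mem _ (hm ht)]; rfl
    simp only [h1, OrderIso.symm_apply_apply]

/-- The sweep that increases from `0` to `1`. -/
lemma exists_increasing_sweep {e : ℝ} (he : 0 < e) :
    ∃ s τ z, IsSweep s τ e z ∧ s 0 = 0 ∧ s e = 1 := by
  obtain ⟨ρ, hρ, hρ1, hρ2⟩ := exists_smoothTransition_inv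
  have hs1 : Real.smoothTransition (e / e) = 1 := by
    rw [div_self he.ne', Real.smoothTransition.one]
  have hend : ∀ t, e ≤ t → Real.smoothTransition (t / e) = 1 := fun t ht =>
    Real.smoothTransition.one_of_one_le (by rwa [le_div_iff₀ he, one_mul])
  refine ⟨fun t => Real.smoothTransition (t / e), fun u => e * ρ u, 0, ?_, by simp, hs1⟩
  refine ⟨he, ?_, fun t => Real.smoothTransition.nonneg _, fun t => Real.smoothTransition.le_one _,
    fun t ht => by rw [hend t ht, hs1], by simp [hs1], fun t h0 h1 => ?_, ⟨le_rfl, by positivity⟩,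
    by simp, fun t h0 h1 t' ht' => ?_, ?_, fun u hu => ?_, fun u hu => ?_, fun t h0 h1 h2 t' ht' => ?_⟩
  · exact (Real.smoothTransition.contDiff (n := ⊤)).comp (contDiff_id.div_const e)
  · have h0' : 0 < t / e := by
      by_contra h
      rw [Real.smoothTransition.zero_of_nonpos (not_lt.1 h)] at h0
      exact lt_irrefl _ h0
    have h1' : t / e < 1 := by
      by_contra h
      rw [Real.smoothTransition.one_of_one_le (not_lt.1 h)] at h1
      exact lt_irrefl _ h1
    obtain ⟨d, hd, h⟩ := smoothTransition_hasDerivAt h0' h1'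
    refine ⟨by simpa [he] using h0', by rwa [div_lt_one he] at h1', ?_⟩
    have := h.comp t ((hasDerivAt_id t).div_const e)
    rw [show (fun t => Real.smoothTransition (t / e)) = Real.smoothTransition ∘ fun t => id t / e
      from rfl, this.deriv]
    positivity
  · rw [segment_symm, segment_eq_Icc h0] at ht'
    exact Real.smoothTransition.monotone (by gcongr; exact ht'.2)
  · exact (hρ.mono Set.Ioc_subset_Icc_self).const_mul e |>.congr fun _ _ => rfl
  · have := (hρ1 u ⟨hu.1.le, hu.2⟩).1
    exact ⟨mul_nonneg he.le this.1, by nlinarith [this.2]⟩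
  · simp only [mul_div_cancel_left₀ _ he.ne']
    exact (hρ1 u ⟨hu.1.le, hu.2⟩).2
  · by_cases h : t ≤ e
    · have hmem : t / e ∈ Set.Icc (0 : ℝ) 1 := ⟨by positivity, by rwa [div_le_one he]⟩
      have h3 : e * ρ (Real.smoothTransition (t / e)) = t := by
        rw [hρ2 _ hmem]; field_simp
      simp only [h3, segment_same, Set.mem_singleton_iff] at ht'
      rw [ht']
    -- Beyond `e` the sweep is constantly one and the inverse of one is `e`, so the segment stays in
    -- the region where the sweep is constant.
    · push Not at h
      have h3 : e * ρ (Real.smoothTransition (t / e)) = e := by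
        rw [hend t h.le, ← Real.smoothTransition.one, hρ2 1 (by simp), mul_one]
      simp only [h3] at ht'
      rw [segment_symm, segment_eq_Icc h.le] at ht'
      simp only [hend t' ht'.1, hend t h.le]

/-- The sweep that decreases from `1` to `0`. -/
lemma exists_decreasing_sweep {e : ℝ} (he : 0 < e) :
    ∃ s τ z, IsSweep s τ e z ∧ s 0 = 1 ∧ s e = 0 := by
  obtain ⟨ρ, hρ, hρ1, hρ2⟩ := exists_smoothTransition_inv
  have hs1 : Real.smoothTransition (1 - e / e) = 0 := by
    rw [div_self he.ne', sub_self, Real.smoothTransition.zero]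
  have hend : ∀ t, e ≤ t → Real.smoothTransition (1 - t / e) = 0 := fun t ht =>
    Real.smoothTransition.zero_of_nonpos (by rwa [sub_nonpos, le_div_iff₀ he, one_mul])
  -- The decreasing sweep vanishes from `e` on; the zero `5e/4` is a time strictly between `e` and
  -- the end `3e/2` of the collar.
  refine ⟨fun t => Real.smoothTransition (1 - t / e), fun u => e * (1 - ρ u), 5 * e / 4, ?_,
    by simp, hs1⟩
  refine ⟨he, ?_, fun t => Real.smoothTransition.nonneg _, fun t => Real.smoothTransition.le_one _,
    fun t ht => by rw [hend t ht, hs1], by simp [hs1], fun t h0 h1 => ?_,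
    ⟨by positivity, by linarith⟩,
    hend _ (by linarith), fun t h0 h1 t' ht' => ?_, ?_, fun u hu => ?_, fun u hu => ?_,
    fun t h0 h1 h2 t' ht' => ?_⟩
  · exact (Real.smoothTransition.contDiff (n := ⊤)).comp (contDiff_const.sub (contDiff_id.div_const e))
  · have h0' : 0 < 1 - t / e := by
      by_contra h
      rw [Real.smoothTransition.zero_of_nonpos (not_lt.1 h)] at h0
      exact lt_irrefl _ h0
    have h1' : 1 - t / e < 1 := by
      by_contra h
      rw [Real.smoothTransition.one_of_one_le (not_lt.1 h)] at h1
      exact lt_irrefl _ h1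
    obtain ⟨d, hd, h⟩ := smoothTransition_hasDerivAt h0' h1'
    refine ⟨?_, ?_, ?_⟩
    · have : 0 < t / e := by linarith
      simpa [he] using this
    · have : t / e < 1 := by linarith
      rwa [div_lt_one he] at this
    have := h.comp t (((hasDerivAt_id t).div_const e).const_sub 1)
    rw [show (fun t => Real.smoothTransition (1 - t / e)) =
      Real.smoothTransition ∘ fun t => 1 - id t / e from rfl, this.deriv]
    have : 0 < 1 / e := by positivity
    exact mul_ne_zero hd.ne' (by linarith)
  · rcases le_total t (5 * e / 4) with h | h
    · rw [segment_eq_Icc h] at ht'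
      exact Real.smoothTransition.monotone (by gcongr; exact ht'.1)
    · rw [segment_symm, segment_eq_Icc h] at ht'
      simp only [hend t (by linarith), hend t' (by linarith [ht'.1]), le_rfl]
  · exact continuousOn_const.mul (continuousOn_const.sub (hρ.mono Set.Ioc_subset_Icc_self))
  · have := (hρ1 u ⟨hu.1.le, hu.2⟩).1
    exact ⟨mul_nonneg he.le (by linarith [this.2]), by nlinarith [this.1]⟩
  · simp only [mul_div_cancel_left₀ _ he.ne', sub_sub_cancel]
    exact (hρ1 u ⟨hu.1.le, hu.2⟩).2
  · have h : t ≤ e := by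
      by_contra h
      rw [hend t (not_le.1 h).le] at h2
      exact lt_irrefl _ h2
    have hmem : 1 - t / e ∈ Set.Icc (0 : ℝ) 1 :=
      ⟨by rw [sub_nonneg, div_le_one he]; exact h, by linarith [div_nonneg h0 he.le]⟩
    have h3 : e * (1 - ρ (Real.smoothTransition (1 - t / e))) = t := by
      rw [hρ2 _ hmem]; field_simp; ring
    simp only [h3, segment_same, Set.mem_singleton_iff] at ht'
    rw [ht']

end Sweep

/-! ### Sublevel sets of a rounding profile -/

section Profile

variable {g : ℝ → ℝ} {a b : ℝ}

lemma IsRoundingProfile.reflect (h : IsRoundingProfile g a b) :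
    IsRoundingProfile (fun x => g (1 - x)) (1 - b) (1 - a) where
  zero_lt := by linarith [h.lt_one]
  lt := by linarith [h.lt]
  lt_one := by linarith [h.zero_lt]
  contDiff := h.contDiff.comp (contDiff_const.sub contDiff_id)
  eq_one x hx := h.eq_one _ (by rcases hx with hx | hx; exacts [.inr (by linarith), .inl (by linarith)])
  le_one x := h.le_one _
  pos x hx := h.pos _ (by rcases hx with hx | hx; exacts [.inr (by linarith), .inl (by linarith)])
  neg x h1 h2 := h.neg _ (by linarith) (by linarith)
  deriv_left := by
    rw [deriv_comp_const_sub, sub_sub_cancel]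
    linarith [h.deriv_right]
  deriv_right := by
    rw [deriv_comp_const_sub, sub_sub_cancel]
    linarith [h.deriv_left]

lemma IsRoundingProfile.apply_left (h : IsRoundingProfile g a b) : g a = 0 := by
  have hc : Continuous g := h.contDiff.continuous
  refine le_antisymm ?_ ?_
  · have : a ∈ closure (Set.Ioo a b) := by
      rw [closure_Ioo h.lt.ne]; exact ⟨le_rfl, h.lt.le⟩
    exact closure_minimal (fun x hx => (h.neg x hx.1 hx.2).le)
      (isClosed_le hc continuous_const) this
  · have : a ∈ closure (Set.Iio a) := by rw [closure_Iio]; exact Set.self_mem_Iic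
    exact closure_minimal (fun x hx => (h.pos x (.inl hx)).le)
      (isClosed_le continuous_const hc) this

lemma IsRoundingProfile.apply_right (h : IsRoundingProfile g a b) : g b = 0 := by
  have := h.reflect.apply_left
  simpa using this

lemma IsRoundingProfile.nonneg_left (h : IsRoundingProfile g a b) {x : ℝ} (hx : x ≤ a) :
    0 ≤ g x := by
  rcases hx.lt_or_eq with hx | rfl
  · exact (h.pos x (.inl hx)).le
  · exact h.apply_left.ge

lemma IsRoundingProfile.nonneg_right (h : IsRoundingProfile g a b) {x : ℝ} (hx : b ≤ x) :
    0 ≤ g x := by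
  rcases hx.lt_or_eq with hx | rfl
  · exact (h.pos x (.inr hx)).le
  · exact h.apply_right.ge

lemma IsRoundingProfile.nonpos (h : IsRoundingProfile g a b) {x : ℝ} (h1 : a ≤ x) (h2 : x ≤ b) :
    g x ≤ 0 := by
  rcases h1.lt_or_eq with h1 | rfl
  · rcases h2.lt_or_eq with h2 | rfl
    · exact (h.neg x h1 h2).le
    · exact h.apply_right.le
  · exact h.apply_left.le

/-- Just left of `a` the profile decreases because its derivative at `a` is negative; further left
it is bounded below by a positive constant. Small values are therefore attained only in the monotone
region. -/
lemma IsRoundingProfile.exists_antitone_left (h : IsRoundingProfile g a b) :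
    ∃ μ > 0, ∀ x ≤ a, ∀ y < μ, g x ≤ y → ∀ x', x ≤ x' → x' ≤ a → g x' ≤ y := by
  have hc' : Continuous (deriv g) := h.contDiff.continuous_deriv (by simp)
  obtain ⟨ρ, hρ, hball⟩ := Metric.eventually_nhds_iff.1
    (hc'.continuousAt.eventually (gt_mem_nhds h.deriv_left))
  have hanti : AntitoneOn g (Set.Icc (a - ρ / 2) a) := by
    refine antitoneOn_of_deriv_nonpos (convex_Icc _ _) h.contDiff.continuous.continuousOn
      (h.contDiff.differentiable (by simp)).differentiableOn fun x hx => ?_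
    rw [interior_Icc] at hx
    refine (hball ?_).le
    rw [Real.dist_eq, abs_of_nonpos (by linarith [hx.2])]
    linarith [hx.1]
  obtain ⟨μ, hμ, hmin⟩ : ∃ μ > 0, ∀ x ≤ a - ρ / 2, μ ≤ g x := by
    rcases le_or_gt 0 (a - ρ / 2) with hle | hlt
    · obtain ⟨x₀, hx₀, hmin⟩ := isCompact_Icc.exists_isMinOn (Set.nonempty_Icc.2 hle)
        h.contDiff.continuous.continuousOn
      have hpos := h.pos x₀ (.inl (by linarith [hx₀.2]))
      refine ⟨min (g x₀) 1, by positivity, fun x hx => ?_⟩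
      rcases le_total x 0 with h0 | h0
      · rw [h.eq_one x (.inl h0)]; exact min_le_right _ _
      · exact (min_le_left _ _).trans (isMinOn_iff.1 hmin x ⟨h0, hx⟩)
    · exact ⟨1, one_pos, fun x hx => by rw [h.eq_one x (.inl (by linarith))]⟩
  refine ⟨μ, hμ, fun x hx y hy hxy x' h1 h2 => ?_⟩
  have hx2 : a - ρ / 2 ≤ x := by
    by_contra hcon
    linarith [hmin x (not_le.1 hcon).le]
  exact (hanti ⟨hx2, hx⟩ ⟨hx2.trans h1, h2⟩ h1).trans hxy

/-- The small sublevel sets of a rounding profile are star-shaped. -/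
lemma IsRoundingProfile.exists_star (h : IsRoundingProfile g a b) :
    ∃ κ > 0, κ < 1 ∧ ∀ x y, 0 ≤ y → y < κ ^ 2 → g x ≤ y →
      ∀ x' ∈ segment ℝ x ((a + b) / 2), g x' ≤ y := by
  obtain ⟨μ, hμ, h1⟩ := h.exists_antitone_left
  obtain ⟨ν, hν, h2⟩ := h.reflect.exists_antitone_left
  -- The bound `1/2` gives `κ² ≤ κ`, so any `y < κ²` lies below the thresholds on both sides.
  set κ := min (min μ ν) (1 / 2) with hκ
  have hκ0 : 0 < κ := by positivity
  have hκ1 : κ ≤ 1 / 2 := min_le_right _ _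
  have hκμ : κ ≤ μ := (min_le_left _ _).trans (min_le_left _ _)
  have hκν : κ ≤ ν := (min_le_left _ _).trans (min_le_right _ _)
  have hsq : κ ^ 2 ≤ κ := by nlinarith
  have hab := h.lt
  refine ⟨κ, hκ0, by linarith, fun x y hy hyκ hxy x' hx' => ?_⟩
  by_cases hx'1 : a ≤ x'
  · by_cases hx'2 : x' ≤ b
    · exact (h.nonpos hx'1 hx'2).trans hy
    · push Not at hx'2
      have hx : x' ≤ x := by
        rcases le_total x ((a + b) / 2) with hle | hle
        · rw [segment_eq_Icc hle] at hx'; linarith [hx'.2]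
        · rw [segment_symm, segment_eq_Icc hle] at hx'; exact hx'.2
      have := h2 (1 - x) (by linarith) y (by linarith) (by simpa using hxy) (1 - x') (by linarith)
        (by linarith)
      simpa using this
  · push Not at hx'1
    have hx : x ≤ x' := by
      rcases le_total x ((a + b) / 2) with hle | hle
      · rw [segment_eq_Icc hle] at hx'; exact hx'.1
      · rw [segment_symm, segment_eq_Icc hle] at hx'; linarith [hx'.1]
    exact h1 x (by linarith) y (by linarith) hxy x' hx hx'1.le

end Profile
end FourGenus

namespace FourGenus

open scoped ContDiff Manifold unitInterval
open Topology

/-! ### Topology of the model saddle -/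

section Model

/-- The trace of the family of curves `Y² = 1 - s t (1 - g x)`, where `t` runs through a collar. -/
def model (s g : ℝ → ℝ) (e δ : ℝ) : Set (ℝ × ℝ × ℝ) :=
  {p | -δ < p.1 ∧ p.1 < 1 + δ ∧ 0 ≤ p.2.2 ∧ p.2.2 < 3 * e / 2 ∧
    p.2.1 ^ 2 = 1 - s p.2.2 * (1 - g p.1)}

variable {s τ g : ℝ → ℝ} {e z δ a b : ℝ}

/-- The three phases of a motion. -/
noncomputable def phase (i : ℝ) (u : I) : ℝ := max 0 (min 1 (3 * (u : ℝ) - i))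

@[fun_prop] lemma continuous_phase (i : ℝ) : Continuous (phase i) := by
  unfold phase; fun_prop

lemma phase_nonneg (i : ℝ) (u : I) : 0 ≤ phase i u := le_max_left _ _

lemma phase_le_one (i : ℝ) (u : I) : phase i u ≤ 1 := max_le zero_le_one (min_le_left _ _)

lemma phase_eq_one {i : ℝ} {u : I} (h : i + 1 ≤ 3 * (u : ℝ)) : phase i u = 1 := by
  rw [phase, min_eq_left (by linarith), max_eq_right zero_le_one]

lemma phase_eq_zero {i : ℝ} {u : I} (h : 3 * (u : ℝ) ≤ i) : phase i u = 0 := by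
  rw [phase, min_eq_right (by linarith), max_eq_left (by linarith)]

lemma phases (u : I) : (phase 1 u = 0 ∧ phase 2 u = 0) ∨ (phase 0 u = 1 ∧ phase 2 u = 0) ∨
    (phase 0 u = 1 ∧ phase 1 u = 1) := by
  rcases le_total (3 * (u : ℝ)) 1 with h | h
  · exact .inl ⟨phase_eq_zero h, phase_eq_zero (by linarith)⟩
  · rcases le_total (3 * (u : ℝ)) 2 with h' | h'
    · exact .inr (.inl ⟨phase_eq_one (by linarith), phase_eq_zero h'⟩)
    · exact .inr (.inr ⟨phase_eq_one (by linarith), phase_eq_one (by linarith)⟩)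

lemma phase_zero {i : ℝ} (hi : 0 ≤ i) : phase i 0 = 0 := phase_eq_zero (by simpa using hi)

lemma phase_one {i : ℝ} (hi : i ≤ 2) : phase i 1 = 1 := phase_eq_one (by norm_num; linarith)

lemma lineMap_mem_segment {x y r : ℝ} (h0 : 0 ≤ r) (h1 : r ≤ 1) : x + r * (y - x) ∈ segment ℝ x y := by
  refine ⟨1 - r, r, by linarith, h0, by ring, ?_⟩
  simp only [smul_eq_mul]; ring

lemma lineMap_mem_of_convex {S : Set ℝ} (hS : Convex ℝ S) {x y r : ℝ} (hx : x ∈ S) (hy : y ∈ S)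
    (h0 : 0 ≤ r) (h1 : r ≤ 1) : x + r * (y - x) ∈ S :=
  hS.segment_subset hx hy (lineMap_mem_segment h0 h1)

lemma model.one_sub_nonneg (hg : IsRoundingProfile g a b) (x : ℝ) : 0 ≤ 1 - g x := by
  linarith [hg.le_one x]

lemma IsRoundingProfile.mid_mem (hg : IsRoundingProfile g a b) :
    0 < (a + b) / 2 ∧ (a + b) / 2 < 1 ∧ g ((a + b) / 2) < 0 := by
  have := hg.zero_lt; have := hg.lt; have := hg.lt_one
  exact ⟨by linarith, by linarith, hg.neg _ (by linarith) (by linarith)⟩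

/-- The upper or the lower sheet of the model can be contracted. -/
lemma model_sheet_contraction (hs : IsSweep s τ e z) (hg : IsRoundingProfile g a b) (hδ : 0 < δ)
    {ς : ℝ} (hς : ς ^ 2 = 1) :
    ∃ H : C(I × {p : model s g e δ | 0 < ς * p.1.2.1}, model s g e δ),
      (∀ p, H (0, p) = p) ∧ (∀ p q, H (1, p) = H (1, q)) ∧ ∀ u p, 0 < ς * (H (u, p)).1.2.1 := by
  obtain ⟨hm0, hm1, -⟩ := hg.mid_mem
  have hgc := hg.contDiff.continuous
  have hsc := hs.contDiff.continuous
  set X : I × {p : model s g e δ | 0 < ς * p.1.2.1} → ℝ := fun w =>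
    w.2.1.1.1 + phase 1 w.1 * ((a + b) / 2 - w.2.1.1.1) with hX
  set T : I × {p : model s g e δ | 0 < ς * p.1.2.1} → ℝ := fun w =>
    w.2.1.1.2.2 + phase 0 w.1 * (z - w.2.1.1.2.2) with hT
  have hXc : Continuous X := by fun_prop
  have hTc : Continuous T := by fun_prop
  -- While the time moves to `z` the sweep does not exceed its initial value, so the right hand side
  -- stays positive. Once the sweep is zero the right hand side is `1`, and `x` can move freely to
  -- the middle.
  have hG : ∀ w, 0 < 1 - s (T w) * (1 - g (X w)) := by
    rintro ⟨u, ⟨⟨⟨x, y, t⟩, h1, h2, h3, h4, h5⟩, h6⟩⟩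
    have hy : 0 < y ^ 2 := by
      have : ς * y ≠ 0 := ne_of_gt h6
      have : y ≠ 0 := right_ne_zero_of_mul this
      positivity
    rcases phases u with h | h | h
    · simp only [hX, hT, h.1, zero_mul, add_zero]
      have hle := hs.le_of_mem t h3 h4 _ (lineMap_mem_segment (phase_nonneg 0 u) (phase_le_one 0 u))
      have := mul_le_mul_of_nonneg_right hle (model.one_sub_nonneg hg x)
      simp only at h5
      linarith
    all_goals
      simp only [hX, hT, h.1, one_mul, add_sub_cancel, hs.apply_zero, zero_mul, sub_zero]
      exact one_pos
  refine ⟨⟨fun w => ⟨(X w, ς * √(1 - s (T w) * (1 - g (X w))), T w), ?_⟩, ?_⟩, ?_, ?_, ?_⟩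
  · have hx := lineMap_mem_of_convex (convex_Ioo (-δ) (1 + δ)) ⟨w.2.1.2.1, w.2.1.2.2.1⟩
      (y := (a + b) / 2) ⟨by linarith, by linarith⟩ (phase_nonneg 1 w.1) (phase_le_one 1 w.1)
    have ht := lineMap_mem_of_convex (convex_Ico 0 (3 * e / 2)) ⟨w.2.1.2.2.2.1, w.2.1.2.2.2.2.1⟩
      (y := z) hs.zero_mem (phase_nonneg 0 w.1) (phase_le_one 0 w.1)
    refine ⟨hx.1, hx.2, ht.1, ht.2, ?_⟩
    simp only
    rw [mul_pow, hς, Real.sq_sqrt (hG w).le, one_mul]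
  · fun_prop
  · rintro ⟨⟨⟨x, y, t⟩, h1, h2, h3, h4, h5⟩, h6⟩
    simp only [ContinuousMap.coe_mk, hX, hT, phase_zero le_rfl, phase_zero zero_le_one, zero_mul,
      add_zero]
    refine Subtype.ext (Prod.ext rfl (Prod.ext ?_ rfl))
    simp only at h5 h6 ⊢
    rw [← h5, Real.sqrt_sq_eq_abs]
    have h7 : |ς| = 1 := by
      rwa [← sq_eq_sq₀ (abs_nonneg _) zero_le_one, sq_abs, one_pow]
    have h8 : |y| = ς * y := by
      rw [← one_mul |y|, ← h7, ← abs_mul, abs_of_pos h6]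
    rw [h8, ← mul_assoc, ← sq, hς, one_mul]
  · intro p q
    simp only [ContinuousMap.coe_mk, hX, hT, phase_one (i := 0) (by norm_num),
      phase_one (i := 1) (by norm_num), one_mul, add_sub_cancel]
  · intro u p
    simp only [ContinuousMap.coe_mk]
    rw [← mul_assoc, ← sq, hς, one_mul]
    exact Real.sqrt_pos.2 (hG _)

/-- The part of the model near the saddle can be contracted. -/
lemma model_saddle_contraction (hs : IsSweep s τ e z) (hg : IsRoundingProfile g a b)
    {κ : ℝ} (hκ1 : κ < 1) (hstar : ∀ x y, 0 ≤ y → y < κ ^ 2 → g x ≤ y →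
      ∀ x' ∈ segment ℝ x ((a + b) / 2), g x' ≤ y) (hδ : 0 < δ)
    {y₀ : ℝ} (hy₀ : |y₀| < κ) :
    ∃ H : C(I × {p : model s g e δ | |p.1.2.1| < κ}, model s g e δ),
      (∀ p, H (0, p) = p) ∧ (∀ p q, H (1, p) = H (1, q)) ∧
      ∀ u p, (H (u, p)).1.2.1 ∈ segment ℝ p.1.1.2.1 y₀ := by
  obtain ⟨hm0, hm1, hgm⟩ := hg.mid_mem
  have hgc := hg.contDiff.continuous
  have hsc := hs.contDiff.continuous
  have hκ0 : 0 < κ := (abs_nonneg _).trans_lt hy₀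
  set X : I × {p : model s g e δ | |p.1.2.1| < κ} → ℝ := fun w => w.2.1.1.1 + phase 1 w.1 * ((a + b) / 2 - w.2.1.1.1) with hX
  set Y : I × {p : model s g e δ | |p.1.2.1| < κ} → ℝ := fun w => w.2.1.1.2.1 + phase 2 w.1 * (y₀ - w.2.1.1.2.1) with hY
  have hXc : Continuous X := by fun_prop
  have hYc : Continuous Y := by fun_prop
  have hsq : ∀ y : ℝ, |y| < κ → y ^ 2 < κ ^ 2 := fun y hy => by
    rw [← sq_abs]; gcongr
  have hYκ : ∀ w, |Y w| < κ := fun w => by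
    have := lineMap_mem_of_convex (convex_Ioo (-κ) κ) (abs_lt.1 w.2.2) (abs_lt.1 hy₀)
      (phase_nonneg 2 w.1) (phase_le_one 2 w.1)
    exact abs_lt.2 this
  have hκsq : κ ^ 2 < 1 := by nlinarith
  have hgle : ∀ w : I × {p : model s g e δ | |p.1.2.1| < κ}, g w.2.1.1.1 ≤ w.2.1.1.2.1 ^ 2 := by
    rintro ⟨u, ⟨⟨⟨x, y, t⟩, h1, h2, h3, h4, h5⟩, h6⟩⟩
    simp only at h5 ⊢
    have := mul_le_mul_of_nonneg_right (hs.le_one t) (model.one_sub_nonneg hg x)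
    linarith
  have hXY : ∀ w : I × {p : model s g e δ | |p.1.2.1| < κ}, g (X w) ≤ Y w ^ 2 := by
    intro w
    have h0 := hgle w
    have hst := hstar _ _ (sq_nonneg w.2.1.1.2.1) (hsq _ w.2.2) h0 (X w)
      (lineMap_mem_segment (phase_nonneg 1 w.1) (phase_le_one 1 w.1))
    rcases phases w.1 with h | h | h
    · simpa only [hY, h.2, zero_mul, add_zero] using hst
    · simpa only [hY, h.2, zero_mul, add_zero] using hst
    · simp only [hX, h.2, one_mul, add_sub_cancel]
      exact hgm.le.trans (sq_nonneg _)
  -- Near the saddle the equation can be solved for the value of the sweep, so `x` and `Y` with `g x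
  -- ≤ Y²` determine the time except where the sweep is constant.
  let q : ℝ → ℝ → ℝ := fun x y => (1 - y ^ 2) / (1 - g x)
  have hgpos : ∀ {x y : ℝ}, g x ≤ y ^ 2 → |y| < κ → 0 < 1 - g x := fun h h' => by
    linarith [hsq _ h']
  have hq : ∀ {x y : ℝ}, g x ≤ y ^ 2 → |y| < κ → q x y ∈ Set.Ioc (0 : ℝ) 1 := fun h h' => by
    refine ⟨div_pos (by linarith [hsq _ h']) (hgpos h h'), ?_⟩
    rw [div_le_one (hgpos h h')]
    linarith
  have hs0 : ∀ w : I × {p : model s g e δ | |p.1.2.1| < κ}, s w.2.1.1.2.2 = q w.2.1.1.1 w.2.1.1.2.1 := by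
    intro w
    have h5 := w.2.1.2.2.2.2.2
    have := (hgpos (hgle w) w.2.2).ne'
    rw [eq_div_iff this]
    linarith
  -- The first phase brings the time to the standard inverse `τ` along an interval where the sweep
  -- is constant. Afterwards the time follows `q (X, Y)`, while `x` moves in the star-shaped
  -- sublevel set and then `Y` moves to `y₀`.
  set T : I × {p : model s g e δ | |p.1.2.1| < κ} → ℝ := fun w => τ (q (X w) (Y w)) +
    (1 - phase 0 w.1) * (w.2.1.1.2.2 - τ (q w.2.1.1.1 w.2.1.1.2.1)) with hT
  have hqc1 : Continuous (fun w => q (X w) (Y w)) :=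
    (continuous_const.sub (hYc.pow 2)).div (continuous_const.sub (hgc.comp hXc))
      fun w => (hgpos (hXY w) (hYκ w)).ne'
  have hqc0 : Continuous (fun w : I × {p : model s g e δ | |p.1.2.1| < κ} => q w.2.1.1.1 w.2.1.1.2.1) :=
    Continuous.div (by fun_prop) (by fun_prop) fun w => (hgpos (hgle w) w.2.2).ne'
  have hTc : Continuous T := by
    have c1 := hs.continuousOn_inv.comp_continuous hqc1 fun w => hq (hXY w) (hYκ w)
    have c0 := hs.continuousOn_inv.comp_continuous hqc0 fun w => hq (hgle w) w.2.2
    exact Continuous.add c1 (Continuous.mul (by fun_prop) (Continuous.sub (by fun_prop) c0))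
  have hTs : ∀ w, (0 ≤ T w ∧ T w < 3 * e / 2) ∧ s (T w) = q (X w) (Y w) := by
    intro w
    rcases phases w.1 with h | h | h
    · have hx : X w = w.2.1.1.1 := by simp only [hX, h.1, zero_mul, add_zero]
      have hy : Y w = w.2.1.1.2.1 := by simp only [hY, h.2, zero_mul, add_zero]
      have hseg : T w ∈ segment ℝ w.2.1.1.2.2 (τ (s w.2.1.1.2.2)) := by
        rw [hs0]
        have := lineMap_mem_segment (x := w.2.1.1.2.2) (y := τ (q w.2.1.1.1 w.2.1.1.2.1))
          (phase_nonneg 0 w.1) (phase_le_one 0 w.1)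
        convert this using 1
        simp only [hT, hx, hy]; ring
      have hin := hs.inv_mem _ (hq (hgle w) w.2.2)
      constructor
      · refine (convex_Ico 0 (3 * e / 2)).segment_subset ⟨w.2.1.2.2.2.1, w.2.1.2.2.2.2.1⟩ ?_ hseg
        rw [hs0]; exact hin
      · rw [hx, hy, ← hs0]
        refine hs.eq_of_mem _ w.2.1.2.2.2.1 w.2.1.2.2.2.2.1 ?_ _ hseg
        rw [hs0]; exact (hq (hgle w) w.2.2).1
    all_goals
      have hTw : T w = τ (q (X w) (Y w)) := by simp only [hT, h.1, sub_self, zero_mul, add_zero]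
      rw [hTw]
      exact ⟨hs.inv_mem _ (hq (hXY w) (hYκ w)), hs.apply_inv _ (hq (hXY w) (hYκ w))⟩
  have hmem : ∀ w, (X w, Y w, T w) ∈ model s g e δ := by
    intro w
    have hx := lineMap_mem_of_convex (convex_Ioo (-δ) (1 + δ)) ⟨w.2.1.2.1, w.2.1.2.2.1⟩
      (y := (a + b) / 2) ⟨by linarith, by linarith⟩ (phase_nonneg 1 w.1) (phase_le_one 1 w.1)
    refine ⟨hx.1, hx.2, (hTs w).1.1, (hTs w).1.2, ?_⟩
    have := (hgpos (hXY w) (hYκ w)).ne'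
    simp only [(hTs w).2, q]
    rw [div_mul_cancel₀ _ this]
    ring
  refine ⟨⟨fun w => ⟨(X w, Y w, T w), hmem w⟩,
    Continuous.subtype_mk (hXc.prodMk (hYc.prodMk hTc)) hmem⟩, ?_, ?_, ?_⟩
  · rintro p
    simp only [ContinuousMap.coe_mk, hX, hY, hT, phase_zero le_rfl, phase_zero zero_le_one,
      phase_zero zero_le_two, zero_mul, add_zero, sub_zero, one_mul, add_sub_cancel]
  · intro p q
    simp only [ContinuousMap.coe_mk, hX, hY, hT, phase_one (i := 0) (by norm_num),
      phase_one (i := 1) (by norm_num), phase_one (i := 2) (by norm_num), one_mul, sub_self,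
      zero_mul, add_sub_cancel]
  · intro u p
    exact lineMap_mem_segment (phase_nonneg 2 u) (phase_le_one 2 u)

lemma joinedIn_of_homotopy {X : Type} [TopologicalSpace X] {A B : Set X} (H : C(I × A, X))
    (h0 : ∀ p, H (0, p) = p) (hB : ∀ u (p : A), p.1 ∈ B → H (u, p) ∈ B) {p : X} (hp : p ∈ A)
    (hpB : p ∈ B) : JoinedIn B p (H (1, ⟨p, hp⟩)) := by
  refine ⟨⟨⟨fun u => H (u, ⟨p, hp⟩), by fun_prop⟩, h0 _, rfl⟩, fun u => hB u ⟨p, hp⟩ hpB⟩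

lemma joinedIn_of_contraction {X : Type} [TopologicalSpace X] {A B : Set X} (H : C(I × A, X))
    (h0 : ∀ p, H (0, p) = p) (h1 : ∀ p q, H (1, p) = H (1, q))
    (hB : ∀ u (p : A), p.1 ∈ B → H (u, p) ∈ B) {p q : X} (hp : p ∈ A) (hq : q ∈ A)
    (hpB : p ∈ B) (hqB : q ∈ B) : JoinedIn B p q := by
  have := joinedIn_of_homotopy H h0 hB hp hpB
  rw [h1 _ ⟨q, hq⟩] at this
  exact this.trans (joinedIn_of_homotopy H h0 hB hq hqB).symm

lemma exists_trivializedOn_of_contraction' {X : Type} [TopologicalSpace X] (c : PathCocycle X)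
    {A : Set X} (H : C(I × A, X)) (h0 : ∀ p, H (0, p) = p) (h1 : ∀ p q, H (1, p) = H (1, q)) :
    ∃ f, c.TrivializedOn A f := by
  rcases A.eq_empty_or_nonempty with rfl | ⟨x, hx⟩
  · exact ⟨0, fun x y γ hγ => (hγ 0).elim⟩
  · exact c.exists_trivializedOn_of_contraction H h0 (H (1, ⟨x, hx⟩)) fun p => h1 _ _

lemma exists_model_saddle_point (hs : IsSweep s τ e z) (hg : IsRoundingProfile g a b) (hδ : 0 < δ)
    {y : ℝ} (hy : |y| < 1) : ∃ p : model s g e δ, p.1.2.1 = y := by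
  obtain ⟨hm0, hm1, hgm⟩ := hg.mid_mem
  have hy2 : y ^ 2 < 1 := (sq_lt_one_iff_abs_lt_one y).2 hy
  have hu : (1 - y ^ 2) / (1 - g ((a + b) / 2)) ∈ Set.Ioc (0 : ℝ) 1 := by
    refine ⟨div_pos (by linarith) (by linarith), ?_⟩
    rw [div_le_one (by linarith)]
    nlinarith [sq_nonneg y]
  refine ⟨⟨((a + b) / 2, y, τ ((1 - y ^ 2) / (1 - g ((a + b) / 2)))), ?_⟩, rfl⟩
  refine ⟨?_, ?_, (hs.inv_mem _ hu).1, (hs.inv_mem _ hu).2, ?_⟩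
  · change -δ < (a + b) / 2; linarith
  · change (a + b) / 2 < 1 + δ; linarith
  · simp only
    rw [hs.apply_inv _ hu, div_mul_cancel₀ _ (by linarith)]
    ring

/-- The model is path connected. -/
lemma model_joined (hs : IsSweep s τ e z) (hg : IsRoundingProfile g a b) (hδ : 0 < δ)
    (p q : model s g e δ) : Joined p q := by
  obtain ⟨κ, hκ0, hκ1, hstar⟩ := hg.exists_star
  have hκ : |κ / 2| < κ := by rw [abs_of_pos (by positivity)]; linarith
  have hκ' : |-(κ / 2)| < κ := by rwa [abs_neg]
  obtain ⟨H, H0, H1, H2⟩ := model_saddle_contraction (y₀ := κ / 2) hs hg hκ1 hstar hδ hκ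
  obtain ⟨J, J0, J1, J2⟩ := model_sheet_contraction (ς := 1) hs hg hδ (by norm_num)
  obtain ⟨J', J0', J1', J2'⟩ := model_sheet_contraction (ς := -1) hs hg hδ (by norm_num)
  obtain ⟨p₁, hp₁⟩ := exists_model_saddle_point hs hg hδ (hκ.trans hκ1)
  obtain ⟨p₂, hp₂⟩ := exists_model_saddle_point hs hg hδ (hκ'.trans hκ1)
  have hall : ∀ q, Joined q p₁ := by
    intro q
    have h21 : Joined p₂ p₁ := by
      rw [← joinedIn_univ]
      exact joinedIn_of_contraction (B := Set.univ) H H0 H1 (fun _ _ _ => trivial) (by simpa [hp₂] using hκ)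
        (by simpa [hp₁] using hκ) trivial trivial
    rcases lt_trichotomy q.1.2.1 0 with h | h | h
    · refine Joined.trans ?_ h21
      rw [← joinedIn_univ]
      exact joinedIn_of_contraction (B := Set.univ) J' J0' J1' (fun _ _ _ => trivial) (by simpa using h)
        (by simp [hp₂, hκ0]) trivial trivial
    · rw [← joinedIn_univ]
      exact joinedIn_of_contraction (B := Set.univ) H H0 H1 (fun _ _ _ => trivial) (by simp [h, hκ0])
        (by simpa [hp₁] using hκ) trivial trivial
    · rw [← joinedIn_univ]
      exact joinedIn_of_contraction (B := Set.univ) J J0 J1 (fun _ _ _ => trivial) (by simpa using h)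
        (by simp [hp₁, hκ0]) trivial trivial
  exact (hall p).trans (hall q).symm

/-- Every cocycle on the model is a coboundary. -/
lemma model_isCoboundary (hs : IsSweep s τ e z) (hg : IsRoundingProfile g a b) (hδ : 0 < δ)
    (c : PathCocycle (model s g e δ)) : c.IsCoboundary := by
  obtain ⟨κ, hκ0, hκ1, hstar⟩ := hg.exists_star
  have hκ : |κ / 2| < κ := by rw [abs_of_pos (by positivity)]; linarith
  have hκ' : |-(κ / 2)| < κ := by rwa [abs_neg]
  set A₀ : Set (model s g e δ) := {p | |p.1.2.1| < κ} with hA₀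
  set A₁ : Set (model s g e δ) := {p | 0 < 1 * p.1.2.1} with hA₁
  set A₂ : Set (model s g e δ) := {p | 0 < -1 * p.1.2.1} with hA₂
  -- Two contractions of the saddle part are used, ending at height `κ / 2` and `-(κ / 2)`. The
  -- height moves along a segment, so the first preserves the upper sheet and the second the lower
  -- one. Hence the overlaps in the cover are path connected.
  obtain ⟨H, H0, H1, H2⟩ := model_saddle_contraction (y₀ := κ / 2) hs hg hκ1 hstar hδ hκ
  obtain ⟨H', H0', H1', H2'⟩ := model_saddle_contraction (y₀ := -(κ / 2)) hs hg hκ1 hstar hδ hκ'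
  obtain ⟨J, J0, J1, J2⟩ := model_sheet_contraction (ς := 1) hs hg hδ (by norm_num)
  obtain ⟨J', J0', J1', J2'⟩ := model_sheet_contraction (ς := -1) hs hg hδ (by norm_num)
  have o₀ : IsOpen A₀ := isOpen_lt (by fun_prop) continuous_const
  have o₁ : IsOpen A₁ := isOpen_lt continuous_const (by fun_prop)
  have o₂ : IsOpen A₂ := isOpen_lt continuous_const (by fun_prop)
  have t₀ := exists_trivializedOn_of_contraction' c H H0 H1
  have t₁ := exists_trivializedOn_of_contraction' c J J0 J1
  have t₂ := exists_trivializedOn_of_contraction' c J' J0' J1'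
  have t₀₁ := PathCocycle.exists_trivializedOn_union o₀ o₁ t₀ t₁ (by
    intro p hp q hq
    refine joinedIn_of_contraction H H0 H1 (fun u w hw => ?_) hp.1 hq.1 hp hq
    have hseg := H2 u w
    refine ⟨abs_lt.2 ((convex_Ioo (-κ) κ).segment_subset (abs_lt.1 hw.1) (abs_lt.1 hκ) hseg), ?_⟩
    have : (H (u, w)).1.2.1 ∈ Set.Ioi (0 : ℝ) := (convex_Ioi (0 : ℝ)).segment_subset
      (show (0 : ℝ) < w.1.1.2.1 by simpa [hA₁] using hw.2) (show 0 < κ / 2 by positivity) hseg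
    simpa [hA₁] using this)
  obtain ⟨f, hf⟩ := PathCocycle.exists_trivializedOn_union (o₀.union o₁) o₂ t₀₁ t₂ (by
    have hsub : ∀ p, p ∈ (A₀ ∪ A₁) ∩ A₂ → p ∈ A₀ := by
      rintro p ⟨h | h, h'⟩
      · exact h
      · simp only [hA₁, hA₂, Set.mem_ofPred_eq] at h h'
        linarith
    intro p hp q hq
    refine joinedIn_of_contraction H' H0' H1' (fun u w hw => ?_) (hsub p hp) (hsub q hq) hp hq
    have hseg := H2' u w
    refine ⟨.inl (abs_lt.2 ((convex_Ioo (-κ) κ).segment_subset (abs_lt.1 (hsub _ hw))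
      (abs_lt.1 hκ') hseg)), ?_⟩
    have : (H' (u, w)).1.2.1 ∈ Set.Iio (0 : ℝ) := (convex_Iio (0 : ℝ)).segment_subset
      (show w.1.1.2.1 < (0 : ℝ) by simpa [hA₂] using hw.2) (show -(κ / 2) < 0 by linarith) hseg
    simpa [hA₂] using this)
  refine ⟨f, fun x y γ => hf γ fun t => ?_⟩
  rcases lt_trichotomy (γ t).1.2.1 0 with h | h | h
  · exact .inr (by simpa [hA₂] using h)
  · exact .inl (.inl (by simp [hA₀, h, hκ0]))
  · exact .inl (.inr (by simpa [hA₁] using h))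

/-- The part of the model that is not moved. -/
def modelRim (s g : ℝ → ℝ) (e δ : ℝ) : Set (model s g e δ) :=
  {p | ¬ (p.1.1 ∈ Set.Icc (0 : ℝ) 1 ∧ p.1.2.2 ≤ e)}

/-- The motion of the rim to the time `5 e / 4`. -/
lemma modelRim_joinedIn (hs : IsSweep s τ e z) (hg : IsRoundingProfile g a b)
    {p : model s g e δ} (hp : p ∈ modelRim s g e δ) :
    ∃ q : model s g e δ, q.1 = (p.1.1, p.1.2.1, 5 * e / 4) ∧ JoinedIn (modelRim s g e δ) p q := by
  obtain ⟨⟨x, y, t⟩, h1, h2, h3, h4, h5⟩ := p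
  have he := hs.pos
  simp only at h1 h2 h3 h4 h5
  have hmem : ∀ u : I, ((x, y, t + u * (5 * e / 4 - t)) : ℝ × ℝ × ℝ) ∈ model s g e δ ∧
      (¬ x ∈ Set.Icc (0 : ℝ) 1 ∨ e < t + u * (5 * e / 4 - t)) := by
    intro u
    have hu : t + u * (5 * e / 4 - t) ∈ Set.Ico 0 (3 * e / 2) :=
      lineMap_mem_of_convex (convex_Ico _ _) ⟨h3, h4⟩ ⟨by positivity, by linarith⟩ u.2.1 u.2.2
    by_cases hx : x ∈ Set.Icc (0 : ℝ) 1
    · have ht : e < t := by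
        by_contra hcon
        exact hp ⟨hx, not_lt.1 hcon⟩
      have hu' : t + u * (5 * e / 4 - t) ∈ Set.Ioi e :=
        lineMap_mem_of_convex (convex_Ioi _) ht (show e < _ by linarith) u.2.1 u.2.2
      refine ⟨⟨h1, h2, hu.1, hu.2, ?_⟩, .inr hu'⟩
      simp only
      rw [h5, hs.eq_end t ht.le, hs.eq_end _ (le_of_lt hu')]
    · refine ⟨⟨h1, h2, hu.1, hu.2, ?_⟩, .inl hx⟩
      simp only
      have : g x = 1 := hg.eq_one x (by
        by_contra hcon
        push Not at hcon
        exact hx ⟨hcon.1.le, hcon.2.le⟩)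
      rw [h5, this]; simp
  refine ⟨⟨(x, y, 5 * e / 4), by simpa using (hmem 1).1⟩, rfl, ⟨⟨⟨fun u => ⟨_, (hmem u).1⟩,
    by fun_prop⟩, ?_, ?_⟩, fun u => ?_⟩⟩
  · simp
  · simp
  · rintro ⟨hx, ht⟩
    rcases (hmem u).2 with h | h
    · exact h hx
    · exact absurd h (not_lt.2 ht)

/-- The depth `5e/4` exceeds `e`, so the whole level there belongs to the rim and points can slide
along the graph of the square root. -/
lemma modelRim_joinedIn_horizontal (hs : IsSweep s τ e z) {ς x x' : ℝ} (hς : ς ^ 2 = 1)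
    {p q : model s g e δ}
    (h : ∀ x'' ∈ segment ℝ x x', 0 ≤ 1 - s e * (1 - g x''))
    (hp : p.1 = (x, ς * √(1 - s e * (1 - g x)), 5 * e / 4))
    (hq : q.1 = (x', ς * √(1 - s e * (1 - g x')), 5 * e / 4)) (hg : Continuous g) :
    JoinedIn (modelRim s g e δ) p q := by
  have he := hs.pos
  have hse : s (5 * e / 4) = s e := hs.eq_end _ (by linarith)
  have hmem : ∀ u : I, ((x + u * (x' - x), ς * √(1 - s e * (1 - g (x + u * (x' - x)))), 5 * e / 4)
      : ℝ × ℝ × ℝ) ∈ model s g e δ := by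
    intro u
    have hx := p.2.1; have hx2 := p.2.2.1; have hx' := q.2.1; have hx2' := q.2.2.1
    rw [hp] at hx hx2; rw [hq] at hx' hx2'
    have hu := lineMap_mem_of_convex (convex_Ioo (-δ) (1 + δ)) ⟨hx, hx2⟩ ⟨hx', hx2'⟩ u.2.1 u.2.2
    refine ⟨hu.1, hu.2, by positivity, by change 5 * e / 4 < _; linarith, ?_⟩
    simp only
    rw [mul_pow, hς, one_mul, Real.sq_sqrt (h _ (lineMap_mem_segment u.2.1 u.2.2)), hse]
  refine ⟨⟨⟨fun u => ⟨_, hmem u⟩, by fun_prop⟩, ?_, ?_⟩, fun u => ?_⟩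
  · exact Subtype.ext (by simp [hp])
  · exact Subtype.ext (by simp [hq])
  · rintro ⟨-, ht⟩
    change 5 * e / 4 ≤ e at ht
    linarith

lemma eq_sign_mul_sqrt (y : ℝ) : ∃ ς : ℝ, ς ^ 2 = 1 ∧ y = ς * √(y ^ 2) := by
  rcases le_total 0 y with h | h
  · exact ⟨1, by norm_num, by rw [Real.sqrt_sq h, one_mul]⟩
  · exact ⟨-1, by norm_num, by rw [Real.sqrt_sq_eq_abs, abs_of_nonpos h]; ring⟩

/-- The rim has at most two path components. -/
lemma exists_modelRim_components (hs : IsSweep s τ e z) (hg : IsRoundingProfile g a b) (hδ : 0 < δ)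
    (hse : s e = 0 ∨ s e = 1) : ∃ P Q : Set (model s g e δ), modelRim s g e δ ⊆ P ∪ Q ∧
      (∀ p ∈ P, ∀ q ∈ P, JoinedIn (modelRim s g e δ) p q) ∧
      (∀ p ∈ Q, ∀ q ∈ Q, JoinedIn (modelRim s g e δ) p q) := by
  have he := hs.pos
  have hgc := hg.contDiff.continuous
  obtain ⟨hm0, hm1, hgm⟩ := hg.mid_mem
  have h54 : s (5 * e / 4) = s e := hs.eq_end _ (by linarith)
  -- Every rim point can be moved to depth `5e/4` with fixed `x` and `Y`, so the components need
  -- only be joined there.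
  have hwrap : ∀ (R : ℝ → ℝ → Prop) (q₀ : model s g e δ), (∀ q : model s g e δ,
      R q.1.1 q.1.2.1 → q.1.2.2 = 5 * e / 4 → JoinedIn (modelRim s g e δ) q q₀) →
      ∀ p ∈ {p : model s g e δ | p ∈ modelRim s g e δ ∧ R p.1.1 p.1.2.1},
      ∀ q ∈ {p : model s g e δ | p ∈ modelRim s g e δ ∧ R p.1.1 p.1.2.1},
      JoinedIn (modelRim s g e δ) p q := by
    intro R q₀ hR
    have key : ∀ p ∈ {p : model s g e δ | p ∈ modelRim s g e δ ∧ R p.1.1 p.1.2.1},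
        JoinedIn (modelRim s g e δ) p q₀ := by
      rintro p ⟨hp, hp'⟩
      obtain ⟨q, hq, hpq⟩ := modelRim_joinedIn hs hg hp
      exact hpq.trans (hR q (by rw [hq]; exact hp') (by rw [hq]))
    exact fun p hp q hq => (key p hp).trans (key q hq).symm
  rcases hse with h0 | h1
  -- When the sweep ends at zero the level is `Y² = 1`, two lines.
  · have hcase : ∀ ς : ℝ, ς ^ 2 = 1 → ∃ q₀ : model s g e δ, ∀ q : model s g e δ, q.1.2.1 = ς →
        q.1.2.2 = 5 * e / 4 → JoinedIn (modelRim s g e δ) q q₀ := by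
      intro ς hς
      refine ⟨⟨(1 / 2, ς, 5 * e / 4), ?_⟩, fun q hq hq' => ?_⟩
      · refine ⟨?_, ?_, by positivity, ?_, by simp [h54, h0, hς]⟩
        · change -δ < 1 / 2; linarith
        · change 1 / 2 < 1 + δ; linarith
        · change 5 * e / 4 < _; linarith
      · refine modelRim_joinedIn_horizontal hs hς (x := q.1.1) (x' := 1 / 2) ?_ ?_ ?_ hgc
        · intro x'' _; simp [h0]
        · refine Prod.ext rfl (Prod.ext ?_ hq')
          simp [h0, hq]
        · simp [h0]
    obtain ⟨q₁, hq₁⟩ := hcase 1 (by norm_num)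
    obtain ⟨q₂, hq₂⟩ := hcase (-1) (by norm_num)
    refine ⟨_, _, ?_, hwrap (fun _ y => y = 1) q₁ hq₁, hwrap (fun _ y => y = -1) q₂ hq₂⟩
    intro p hp
    obtain ⟨q, hq, -⟩ := modelRim_joinedIn hs hg hp
    have h5 := q.2.2.2.2.2
    rw [hq] at h5
    simp only [h54, h0, zero_mul, sub_zero] at h5
    rcases sq_eq_sq_iff_eq_or_eq_neg.1 (h5.trans (one_pow 2).symm) with h | h
    · exact .inl ⟨hp, h⟩
    · exact .inr ⟨hp, h⟩
  -- When the sweep ends at one the level is `Y² = g x`, two arcs. All points of an arc slide to its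
  -- turning point, at `x = a` or `x = b`.
  · have hcase : ∀ (S : Set ℝ) (x₀ : ℝ), -δ < x₀ → x₀ < 1 + δ → g x₀ = 0 →
        (∀ x ∈ S, ∀ x' ∈ segment ℝ x x₀, 0 ≤ g x') → ∃ q₀ : model s g e δ, ∀ q : model s g e δ,
        q.1.1 ∈ S → q.1.2.2 = 5 * e / 4 → JoinedIn (modelRim s g e δ) q q₀ := by
      intro S x₀ hx₀ hx₀' hgx hS
      refine ⟨⟨(x₀, 0, 5 * e / 4), hx₀, hx₀', by positivity, ?_, by simp [h54, h1, hgx]⟩,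
        fun q hq hq' => ?_⟩
      · change 5 * e / 4 < _; linarith
      · obtain ⟨ς, hς, hy⟩ := eq_sign_mul_sqrt q.1.2.1
        refine modelRim_joinedIn_horizontal hs hς (x := q.1.1) (x' := x₀) ?_ ?_ ?_ hgc
        · intro x'' hx''
          rw [h1]; linarith [hS _ hq _ hx'']
        · refine Prod.ext rfl (Prod.ext ?_ hq')
          have h5 := q.2.2.2.2.2
          rw [hq', h54] at h5
          simp only
          rw [← h5]; exact hy
        · simp [h1, hgx]
    have hab := hg.lt; have ha := hg.zero_lt; have hb := hg.lt_one
    obtain ⟨q₁, hq₁⟩ := hcase (Set.Iic a) a (by linarith) (by linarith) hg.apply_left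
      fun x hx x' hx' => by
        rw [segment_eq_Icc hx] at hx'
        exact hg.nonneg_left hx'.2
    obtain ⟨q₂, hq₂⟩ := hcase (Set.Ici b) b (by linarith) (by linarith) hg.apply_right
      fun x hx x' hx' => by
        rw [segment_symm, segment_eq_Icc hx] at hx'
        exact hg.nonneg_right hx'.1
    refine ⟨_, _, ?_, hwrap (fun x _ => x ∈ Set.Iic a) q₁ hq₁,
      hwrap (fun x _ => x ∈ Set.Ici b) q₂ hq₂⟩
    intro p hp
    obtain ⟨q, hq, -⟩ := modelRim_joinedIn hs hg hp
    have h5 := q.2.2.2.2.2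
    rw [hq] at h5
    simp only [h54, h1, one_mul, sub_sub_cancel] at h5
    by_cases hxa : p.1.1 ≤ a
    · exact .inl ⟨hp, hxa⟩
    · refine .inr ⟨hp, ?_⟩
      by_contra hxb
      have := hg.neg p.1.1 (not_le.1 hxa) (not_le.1 hxb)
      nlinarith [sq_nonneg p.1.2.1]

end Model
end FourGenus

namespace FourGenus

open scoped ContDiff Manifold
open Topology

/-! ### Charts of the ball from charts of the sphere -/

section BandChart

/-- Euclidean three-space, the model of the three-sphere. -/
abbrev E3 : Type := EuclideanSpace ℝ (Fin 3)

variable {ψ : OpenPartialHomeomorph S3 E3}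

lemma continuousAt_dir {p : E4} (h : p ≠ 0) : ContinuousAt dir p := (contMDiffAt_dir h).continuousAt

lemma continuousOn_dir : ContinuousOn dir {p : E4 | p ≠ 0} := fun _ hp =>
  (continuousAt_dir hp).continuousWithinAt

/-- The coordinates `(ψ (p / ‖p‖), ‖p‖)` of the cone over the domain of a chart of the sphere. -/
noncomputable def coneChart (ψ : OpenPartialHomeomorph S3 E3) : OpenPartialHomeomorph E4 (E3 × ℝ) where
  toFun p := (ψ (dir p), ‖p‖)
  invFun w := w.2 • (ψ.symm w.1 : E4)
  source := {p | p ≠ 0} ∩ dir ⁻¹' ψ.source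
  target := ψ.target ×ˢ Set.Ioi 0
  map_source' p hp := ⟨ψ.map_source hp.2, norm_pos_iff.2 hp.1⟩
  map_target' w hw := by
    have hw2 : 0 < w.2 := hw.2
    refine ⟨?_, ?_⟩
    · rw [Set.mem_ofPred_eq, ← norm_pos_iff, norm_smul, norm_coe_S3, mul_one]
      exact norm_pos_iff.2 hw2.ne'
    · rw [Set.mem_preimage, dir_smul hw2]
      exact ψ.map_target hw.1
  left_inv' p hp := by simp only [ψ.left_inv hp.2, norm_smul_dir]
  right_inv' w hw := by
    have hw2 : 0 < w.2 := hw.2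
    rw [dir_smul hw2, norm_smul, norm_coe_S3, mul_one, Real.norm_of_nonneg hw2.le,
      ψ.right_inv hw.1]
  open_source := continuousOn_dir.isOpen_inter_preimage isOpen_ne ψ.open_source
  open_target := ψ.open_target.prod isOpen_Ioi
  continuousOn_toFun := (ψ.continuousOn.comp (continuousOn_dir.mono Set.inter_subset_left)
    fun p hp => hp.2).prodMk continuous_norm.continuousOn
  continuousOn_invFun := continuousOn_snd.smul (continuous_subtype_val.comp_continuousOn
    (ψ.symm.continuousOn.comp continuousOn_fst fun w hw => hw.1))

lemma coneChart_apply (p : E4) : coneChart ψ p = (ψ (dir p), ‖p‖) := rfl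

lemma contDiffOn_coneChart (hψ : ψ ∈ IsManifold.maximalAtlas (𝓡 3) ∞ S3) :
    ContDiffOn ℝ ∞ (coneChart ψ) (coneChart ψ).source := by
  have h1 : ContMDiffOn (𝓡 3) 𝓘(ℝ, E3) ∞ ψ ψ.source := contMDiffOn_of_mem_maximalAtlas hψ
  have h2 : ContMDiffOn 𝓘(ℝ, E4) (𝓡 3) ∞ dir (coneChart ψ).source := fun p hp =>
    (contMDiffAt_dir hp.1).contMDiffWithinAt
  have h3 : ContDiffOn ℝ ∞ (fun p => ψ (dir p)) (coneChart ψ).source :=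
    (h1.comp h2 fun p hp => hp.2).contDiffOn
  exact h3.prodMk fun p hp => (contDiffAt_id.norm ℝ hp.1).contDiffWithinAt

lemma contDiffOn_coneChart_symm (hψ : ψ ∈ IsManifold.maximalAtlas (𝓡 3) ∞ S3) :
    ContDiffOn ℝ ∞ (coneChart ψ).symm (coneChart ψ).target := by
  have h1 : ContMDiffOn 𝓘(ℝ, E3) (𝓡 3) ∞ ψ.symm ψ.target := contMDiffOn_symm_of_mem_maximalAtlas hψ
  have h2 : ContDiffOn ℝ ∞ (fun w => (ψ.symm w : E4)) ψ.target :=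
    (contMDiff_coe_S3.comp_contMDiffOn h1).contDiffOn
  exact contDiffOn_snd.smul (h2.comp contDiffOn_fst fun w hw => hw.1)

/-- Four functions with independent differentials form a chart. -/
lemma exists_chart_of_coords {U : Set E4} (hU : IsOpen U) {f : Fin 4 → E4 → ℝ}
    (hf : ∀ i, ContDiffOn ℝ ∞ (f i) U) {p : E4} (hp : p ∈ U)
    (hinj : ∀ v, (∀ i, fderiv ℝ (f i) p v = 0) → v = 0) :
    ∃ φ : OpenPartialHomeomorph E4 E4, p ∈ φ.source ∧ φ.source ⊆ U ∧ (∀ x i, φ x i = f i x) ∧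
      ContDiffOn ℝ ∞ φ φ.source ∧ ContDiffOn ℝ ∞ φ.symm φ.target := by
  let G : E4 → E4 := fun x => WithLp.toLp 2 fun i => f i x
  have hG : ContDiffOn ℝ ∞ G U := contDiffOn_euclidean.2 hf
  have hd : ∀ i, HasFDerivAt (f i) (fderiv ℝ (f i) p) p := fun i =>
    (((hf i).contDiffAt (hU.mem_nhds hp)).differentiableAt (by simp)).hasFDerivAt
  have hGd : HasFDerivAt G (fderiv ℝ G p) p :=
    ((hG.contDiffAt (hU.mem_nhds hp)).differentiableAt (by simp)).hasFDerivAt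
  have hinj' : Function.Injective (fderiv ℝ G p : E4 →ₗ[ℝ] E4) := by
    rw [injective_iff_map_eq_zero]
    intro v hv
    refine hinj v fun i => ?_
    have : fderiv ℝ (fun y => G y i) p v = (fderiv ℝ G p v) i := by
      rw [(HasFDerivAt.coord hGd i).fderiv]; rfl
    change fderiv ℝ (fun y => G y i) p v = 0
    rw [this]
    have h0 : fderiv ℝ G p v = 0 := hv
    rw [h0]; rfl
  obtain ⟨φ, h1, h2, h3, h4, h5⟩ := exists_smooth_openPartialHomeomorph hU hG hp
    (LinearEquiv.ofInjectiveEndo (fderiv ℝ G p : E4 →ₗ[ℝ] E4) hinj').toContinuousLinearEquiv hGd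
  exact ⟨φ, h1, h2, fun x i => by rw [h3], h4, h5⟩

/-- Four functions of the cone coordinates with independent differentials form a chart. -/
lemma exists_chart_of_coneChart (hψ : ψ ∈ IsManifold.maximalAtlas (𝓡 3) ∞ S3) {U : Set E4}
    (hU : IsOpen U) (hUs : U ⊆ (coneChart ψ).source) {h : Fin 4 → E3 × ℝ → ℝ}
    (hh : ∀ i, ContDiff ℝ ∞ (h i)) {p : E4} (hp : p ∈ U)
    (hinj : ∀ w, (∀ i, fderiv ℝ (h i) (coneChart ψ p) w = 0) → w = 0) :
    ∃ φ : OpenPartialHomeomorph E4 E4, p ∈ φ.source ∧ φ.source ⊆ U ∧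
      (∀ x i, φ x i = h i (coneChart ψ x)) ∧
      ContDiffOn ℝ ∞ φ φ.source ∧ ContDiffOn ℝ ∞ φ.symm φ.target := by
  have hs := contDiffOn_coneChart hψ
  have hs' := contDiffOn_coneChart_symm hψ
  refine exists_chart_of_coords hU (fun i => (hh i).comp_contDiffOn (hs.mono hUs)) hp ?_
  intro v hv
  have hd := chart_hasFDerivAt hs (hUs hp)
  have : fderiv ℝ (coneChart ψ) p v = 0 := by
    refine hinj _ fun i => ?_
    have h1 := (((hh i).differentiable (by simp) _).hasFDerivAt.comp p hd).fderiv
    rw [← hv i]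
    exact (DFunLike.congr_fun h1 v).symm
  rw [← chart_fderiv_symm_apply hs hs' (hUs hp) v, this, map_zero]

end BandChart

/-! ### The curves that interpolate between the knot and the surgery -/

section Level

variable {K : Knot} {ψ : OpenPartialHomeomorph S3 E3} {g : ℝ → ℝ} {a b : ℝ}

/-- The square of the band in the sphere. -/
def bandSquare (ψ : OpenPartialHomeomorph S3 E3) : Set S3 := {θ | θ ∈ ψ.source ∧ ψ θ ∈ flatSquare}

/-- The curves between the knot and the result of the surgery. -/
def bandLevel (K : Knot) (ψ : OpenPartialHomeomorph S3 E3) (g : ℝ → ℝ) (c : ℝ) : Set S3 :=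
  {θ | θ ∈ K.carrier ∧ θ ∉ bandSquare ψ} ∪
  {θ | θ ∈ bandSquare ψ ∧ (2 * ψ θ 1 - 1) ^ 2 = 1 - c * (1 - g (ψ θ 0))}

lemma mem_bandLevel_of_notMem {θ : S3} {c : ℝ} (h : θ ∉ bandSquare ψ) :
    θ ∈ bandLevel K ψ g c ↔ θ ∈ K.carrier := by
  simp [bandLevel, h]

/-- One equation describes the level in the whole chart, also across the edges of the square. For
`x` outside `[0,1]` the profile is `1` and the equation is that of the knot; for `y` outside `[0,1]`
the left side exceeds `1` and the right side does not. -/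
lemma mem_bandLevel_of_mem_source (hb : IsAttachedBand K ψ) (hg : IsRoundingProfile g a b) {c : ℝ}
    (hc : c ∈ Set.Icc (0 : ℝ) 1) {θ : S3} (hθ : θ ∈ ψ.source) :
    θ ∈ bandLevel K ψ g c ↔ (2 * ψ θ 1 - 1) ^ 2 = 1 - c * (1 - g (ψ θ 0)) ∧ ψ θ 2 = 0 := by
  have hgl := hg.le_one (ψ θ 0)
  have hle : 1 - c * (1 - g (ψ θ 0)) ≤ 1 := by nlinarith [hc.1]
  by_cases h : θ ∈ bandSquare ψ
  · have h2 : ψ θ 2 = 0 := h.2.2.2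
    simp [bandLevel, h, h2]
  · rw [mem_bandLevel_of_notMem h, hb.mem_knot_iff θ hθ]
    have hsq : ∀ y : ℝ, (y = 0 ∨ y = 1) ↔ (2 * y - 1) ^ 2 = 1 := by
      intro y
      constructor
      · rintro (rfl | rfl) <;> norm_num
      · intro hy
        have : y * (y - 1) = 0 := by linarith
        rcases mul_eq_zero.1 this with h | h
        · exact .inl h
        · exact .inr (by linarith)
    rw [hsq]
    by_cases h2 : ψ θ 2 = 0
    · simp only [h2, and_true]
      by_cases hx : ψ θ 0 ∈ Set.Icc (0 : ℝ) 1
      · have hy : ¬ ψ θ 1 ∈ Set.Icc (0 : ℝ) 1 := fun hy => h ⟨hθ, hx, hy, h2⟩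
        have hgt : 1 < (2 * ψ θ 1 - 1) ^ 2 := by
          by_contra hcon
          refine hy ⟨?_, ?_⟩ <;> nlinarith
        constructor <;> intro hh <;> linarith
      · rw [hg.eq_one (ψ θ 0) (by
          by_contra hcon
          push Not at hcon
          exact hx ⟨hcon.1.le, hcon.2.le⟩)]
        simp
    · simp [h2]

lemma bandLevel_one : bandLevel K ψ g 1 = bandSurgery K ψ g := by
  ext θ
  simp [bandLevel, bandSurgery, bandSquare, and_assoc]

lemma bandLevel_zero (hb : IsAttachedBand K ψ) (hg : IsRoundingProfile g a b) :
    bandLevel K ψ g 0 = K.carrier := by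
  ext θ
  by_cases h : θ ∈ bandSquare ψ
  · rw [mem_bandLevel_of_mem_source hb hg (by simp) h.1, hb.mem_knot_iff θ h.1]
    simp only [zero_mul, sub_zero]
    refine and_congr_left fun _ => ?_
    constructor
    · intro hy
      have : ψ θ 1 * (ψ θ 1 - 1) = 0 := by linarith
      rcases mul_eq_zero.1 this with h | h
      · exact .inl h
      · exact .inr (by linarith)
    · rintro (h | h) <;> rw [h] <;> norm_num
  · exact mem_bandLevel_of_notMem h

lemma isCompact_flatSquare : IsCompact flatSquare := by
  have : flatSquare = (EuclideanSpace.equiv (Fin 3) ℝ).symm ''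
      (Set.pi Set.univ ![Set.Icc (0 : ℝ) 1, Set.Icc (0 : ℝ) 1, {0}]) := by
    ext u
    simp only [Set.mem_image]
    constructor
    · intro hu
      refine ⟨u, fun i _ => ?_, rfl⟩
      fin_cases i
      · exact hu.1
      · exact hu.2.1
      · exact hu.2.2
    · rintro ⟨v, hv, rfl⟩
      exact ⟨hv 0 trivial, hv 1 trivial, hv 2 trivial⟩
  rw [this]
  refine (isCompact_univ_pi fun i => ?_).image (EuclideanSpace.equiv (Fin 3) ℝ).symm.continuous
  fin_cases i
  · exact isCompact_Icc
  · exact isCompact_Icc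
  · exact isCompact_singleton

lemma isCompact_bandSquare (hb : IsAttachedBand K ψ) : IsCompact (bandSquare ψ) := by
  have : bandSquare ψ = ψ.symm '' flatSquare := by
    ext θ
    constructor
    · rintro ⟨h1, h2⟩
      exact ⟨ψ θ, h2, ψ.left_inv h1⟩
    · rintro ⟨u, hu, rfl⟩
      exact ⟨ψ.map_target (hb.square_subset hu), by rwa [ψ.right_inv (hb.square_subset hu)]⟩
  rw [this]
  exact isCompact_flatSquare.image_of_continuousOn (ψ.symm.continuousOn.mono hb.square_subset)

end Level
end FourGenus

namespace FourGenus

open scoped ContDiff Manifold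
open Topology

/-! ### The changed surface and its charts -/

section Swap

/-- The equation of the family of curves in the cone coordinates. -/
def levelFun (s g : ℝ → ℝ) (w : E3 × ℝ) : ℝ :=
  (2 * w.1 1 - 1) ^ 2 - 1 + s (1 - w.2) * (1 - g (w.1 0))

lemma contDiff_coord (i : Fin 3) : ContDiff ℝ ∞ (fun w : E3 × ℝ => w.1 i) :=
  (EuclideanSpace.proj (𝕜 := ℝ) i).contDiff.comp contDiff_fst

lemma contDiff_levelFun {s g : ℝ → ℝ} (hs : ContDiff ℝ ∞ s) (hg : ContDiff ℝ ∞ g) :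
    ContDiff ℝ ∞ (levelFun s g) := by
  have h1 := contDiff_coord 1
  have h0 := hg.comp (contDiff_coord 0)
  have h2 := hs.comp ((contDiff_const (c := (1 : ℝ))).sub (contDiff_snd (E := E3) (F := ℝ)))
  exact ((((contDiff_const.mul h1).sub contDiff_const).pow 2).sub contDiff_const).add
    (h2.mul (contDiff_const.sub h0))

lemma hasFDerivAt_coord (i : Fin 3) (w : E3 × ℝ) : HasFDerivAt (fun w : E3 × ℝ => w.1 i)
    ((EuclideanSpace.proj (𝕜 := ℝ) i).comp (ContinuousLinearMap.fst ℝ E3 ℝ)) w :=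
  ((EuclideanSpace.proj (𝕜 := ℝ) i).comp (ContinuousLinearMap.fst ℝ E3 ℝ)).hasFDerivAt

lemma fderiv_coord_apply (i : Fin 3) (w v : E3 × ℝ) :
    fderiv ℝ (fun w : E3 × ℝ => w.1 i) w v = v.1 i := by
  rw [(hasFDerivAt_coord i w).fderiv]; rfl

lemma fderiv_levelFun_apply {s g : ℝ → ℝ} (hs : ContDiff ℝ ∞ s) (hg : ContDiff ℝ ∞ g)
    (w v : E3 × ℝ) : fderiv ℝ (levelFun s g) w v = 4 * (2 * w.1 1 - 1) * v.1 1 -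
      deriv s (1 - w.2) * (1 - g (w.1 0)) * v.2 - s (1 - w.2) * deriv g (w.1 0) * v.1 0 := by
  have hline : ∀ i : Fin 3, HasDerivAt (fun u : ℝ => (w + u • v).1 i) (v.1 i) 0 := fun i => by
    simpa using ((hasDerivAt_id (0 : ℝ)).mul_const (v.1 i)).const_add (w.1 i)
  have hr : HasDerivAt (fun u : ℝ => (w + u • v).2) v.2 0 := by
    simpa using ((hasDerivAt_id (0 : ℝ)).mul_const v.2).const_add w.2
  have hs' : HasDerivAt s (deriv s (1 - w.2)) (1 - (w + (0 : ℝ) • v).2) := by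
    simpa using (hs.differentiable (by simp) (1 - w.2)).hasDerivAt
  have hg' : HasDerivAt g (deriv g (w.1 0)) ((w + (0 : ℝ) • v).1 0) := by
    simpa using (hg.differentiable (by simp) (w.1 0)).hasDerivAt
  have h1 := ((((hline 1).const_mul 2).sub_const 1).pow 2).sub_const 1
  have h2 := hs'.comp (0 : ℝ) (hr.const_sub 1)
  have h3 := (hg'.comp (0 : ℝ) (hline 0)).const_sub 1
  have h4 := h1.add (h2.mul h3)
  have hL : HasDerivAt (fun u : ℝ => w + u • v) v 0 := by
    simpa using ((hasDerivAt_id (0 : ℝ)).smul_const v).const_add w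
  have h5 : HasFDerivAt (levelFun s g) (fderiv ℝ (levelFun s g) w) (w + (0 : ℝ) • v) := by
    simpa using ((contDiff_levelFun hs hg).differentiable (by simp) w).hasFDerivAt
  have h6 := (h5.comp_hasDerivAt (0 : ℝ) hL).unique
    (h4.congr_of_eventuallyEq (Filter.Eventually.of_forall fun u => rfl))
  rw [h6]
  simp
  ring

/-- The data for changing a surface along a band: the surface `F` is the cone over one of the two
sides of the band move. -/
structure SwapSetting (K : Knot) (ψ : OpenPartialHomeomorph S3 E3) (g : ℝ → ℝ) (a b : ℝ)
    (s τ : ℝ → ℝ) (e z : ℝ) (F : Set E4) : Prop where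
  band : IsAttachedBand K ψ
  profile : IsRoundingProfile g a b
  sweep : IsSweep s τ e z
  end_eq : s e = 0 ∨ s e = 1
  lt : e < 1 / 4
  proper : IsProperSurface F
  collar : ∀ p, 1 - 2 * e < ‖p‖ → ‖p‖ ≤ 1 → (p ∈ F ↔ dir p ∈ bandLevel K ψ g (s e))

/-- The surface that runs through the family of curves near the sphere. -/
def swapSurface (K : Knot) (ψ : OpenPartialHomeomorph S3 E3) (g s : ℝ → ℝ) (e : ℝ) (F : Set E4) :
    Set E4 :=
  {p | p ∈ F ∧ ‖p‖ < 1 - e} ∪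
  {p | 1 - 2 * e < ‖p‖ ∧ ‖p‖ ≤ 1 ∧ dir p ∈ bandLevel K ψ g (s (1 - ‖p‖))}

/-- The part of the ball where the surface is changed. -/
def swapCore (ψ : OpenPartialHomeomorph S3 E3) (e : ℝ) : Set E4 :=
  {p | 1 - e ≤ ‖p‖ ∧ ‖p‖ ≤ 1 ∧ dir p ∈ bandSquare ψ}

namespace SwapSetting

variable {K : Knot} {ψ : OpenPartialHomeomorph S3 E3} {g : ℝ → ℝ} {a b : ℝ}
  {s τ : ℝ → ℝ} {e z : ℝ} {F : Set E4} (h : SwapSetting K ψ g a b s τ e z F)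

include h

lemma mem_of_lt {p : E4} (hp : ‖p‖ < 1 - e) : p ∈ swapSurface K ψ g s e F ↔ p ∈ F := by
  have he := h.sweep.pos
  constructor
  · rintro (⟨h1, -⟩ | ⟨h1, h2, h3⟩)
    · exact h1
    · rw [h.collar p h1 h2]
      rwa [h.sweep.eq_end _ (by linarith)] at h3
  · exact fun hF => .inl ⟨hF, hp⟩

lemma mem_collar {p : E4} (h1 : 1 - 2 * e < ‖p‖) (h2 : ‖p‖ ≤ 1) :
    p ∈ swapSurface K ψ g s e F ↔ dir p ∈ bandLevel K ψ g (s (1 - ‖p‖)) := by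
  constructor
  · rintro (⟨h3, h4⟩ | ⟨-, -, h3⟩)
    · rw [h.collar p h1 h2] at h3
      rwa [h.sweep.eq_end _ (by linarith)]
    · exact h3
  · exact fun h3 => .inr ⟨h1, h2, h3⟩

lemma subset_ball : swapSurface K ψ g s e F ⊆ D4 := by
  rintro p (⟨hp, -⟩ | ⟨-, hp, -⟩)
  · exact h.proper.subset_ball hp
  · exact mem_closedBall_zero_iff.2 hp

/-- Off the band square all levels coincide with the knot, so the new collar equals the old conical
one. -/
lemma mem_iff_of_notMem_core {p : E4} (hp : p ∉ swapCore ψ e) :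
    p ∈ swapSurface K ψ g s e F ↔ p ∈ F := by
  have he := h.sweep.pos
  by_cases h1 : ‖p‖ < 1 - e
  · exact h.mem_of_lt h1
  · by_cases h2 : ‖p‖ ≤ 1
    · have hd : dir p ∉ bandSquare ψ := fun hd => hp ⟨not_lt.1 h1, h2, hd⟩
      rw [h.mem_collar (by linarith) h2, h.collar p (by linarith) h2, mem_bandLevel_of_notMem hd,
        mem_bandLevel_of_notMem hd]
    · exact ⟨fun hp => absurd (mem_closedBall_zero_iff.1 (h.subset_ball hp)) h2,
        fun hp => absurd (mem_closedBall_zero_iff.1 (h.proper.subset_ball hp)) h2⟩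

lemma isClosed_core : IsClosed (swapCore ψ e) := by
  have he := h.lt
  have : swapCore ψ e = (fun x : ℝ × S3 => x.1 • (x.2 : E4)) ''
      (Set.Icc (1 - e) 1 ×ˢ bandSquare ψ) := by
    ext p
    constructor
    · rintro ⟨h1, h2, h3⟩
      exact ⟨(‖p‖, dir p), ⟨⟨h1, h2⟩, h3⟩, norm_smul_dir p⟩
    · rintro ⟨⟨r, θ⟩, ⟨⟨h1, h2⟩, h3⟩, rfl⟩
      simp only at h1 h2 h3 ⊢
      have hr : 0 < r := by linarith
      have hn : ‖r • (θ : E4)‖ = r := by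
        rw [norm_smul, norm_coe_S3, mul_one, Real.norm_of_nonneg hr.le]
      exact ⟨by rw [hn]; exact h1, by rw [hn]; exact h2, by rw [dir_smul hr]; exact h3⟩
  rw [this]
  refine ((isCompact_Icc.prod (isCompact_bandSquare h.band)).image ?_).isClosed
  exact continuous_fst.smul (continuous_subtype_val.comp continuous_snd)

lemma mem_iff_level {p : E4} (h1 : 1 - 2 * e < ‖p‖) (h2 : ‖p‖ ≤ 1) (h3 : dir p ∈ ψ.source) :
    p ∈ swapSurface K ψ g s e F ↔
      levelFun s g (coneChart ψ p) = 0 ∧ (coneChart ψ p).1 2 = 0 := by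
  rw [h.mem_collar h1 h2, mem_bandLevel_of_mem_source h.band h.profile
    ⟨h.sweep.nonneg _, h.sweep.le_one _⟩ h3, levelFun, coneChart_apply]
  refine and_congr_left fun _ => ?_
  constructor <;> intro h4 <;> linarith

lemma mem_source_of_core {p : E4} (hp : p ∈ swapCore ψ e) : p ∈ (coneChart ψ).source ∧
    1 - 2 * e < ‖p‖ := by
  have := h.lt; have := h.sweep.pos; have := hp.1
  exact ⟨⟨norm_pos_iff.1 (by linarith), hp.2.2.1⟩, by linarith⟩

lemma isClosed : IsClosed (swapSurface K ψ g s e F) := by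
  rw [← isOpen_compl_iff, isOpen_iff_mem_nhds]
  intro p hp
  by_cases hc : p ∈ swapCore ψ e
  · obtain ⟨hps, hpn⟩ := h.mem_source_of_core hc
    have hp' := fun hh => hp ((h.mem_iff_level hpn hc.2.1 hps.2).2 hh)
    have hcont : ContinuousAt (coneChart ψ) p := (coneChart ψ).continuousAt hps
    have hev : ∀ᶠ w in 𝓝 (coneChart ψ p), ¬ (levelFun s g w = 0 ∧ w.1 2 = 0) := by
      have hcl : IsClosed {w : E3 × ℝ | levelFun s g w = 0 ∧ w.1 2 = 0} :=
        (isClosed_eq (contDiff_levelFun h.sweep.contDiff h.profile.contDiff).continuous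
          continuous_const).inter (isClosed_eq (contDiff_coord 2).continuous continuous_const)
      exact hcl.isOpen_compl.mem_nhds hp'
    filter_upwards [hcont.eventually hev, (coneChart ψ).open_source.mem_nhds hps,
      (isOpen_lt continuous_const continuous_norm).mem_nhds hpn] with q h1 h2 h3 hq
    exact h1 ((h.mem_iff_level h3 (mem_closedBall_zero_iff.1 (h.subset_ball hq)) h2.2).1 hq)
  · have hF : p ∉ F := fun hF => hp ((h.mem_iff_of_notMem_core hc).2 hF)
    filter_upwards [h.isClosed_core.isOpen_compl.mem_nhds hc,
      h.proper.isCompact.isClosed.isOpen_compl.mem_nhds hF] with q h1 h2 h3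
    exact h2 ((h.mem_iff_of_notMem_core h1).1 h3)

lemma isCompact : IsCompact (swapSurface K ψ g s e F) :=
  (isCompact_closedBall (0 : E4) 1).of_isClosed_subset h.isClosed h.subset_ball

/-- The differential of the equation does not vanish, not even on the boundary. -/
lemma regular {x y r : ℝ}
    (hQ : (2 * y - 1) ^ 2 - 1 + s (1 - r) * (1 - g x) = 0) :
    2 * y - 1 ≠ 0 ∨ s (1 - r) * deriv g x ≠ 0 ∨
      (r < 1 ∧ deriv s (1 - r) * (1 - g x) ≠ 0) := by
  -- On the centre line `s (1 - g) = 1`. If `s < 1` the sweep is strictly monotone there and the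
  -- point is interior. If `s = 1` then `g = 0`, so `x` is `a` or `b`, where the profile has
  -- non-zero slope.
  by_cases hy : 2 * y - 1 = 0
  · right
    rw [hy] at hQ
    have hprod : s (1 - r) * (1 - g x) = 1 := by linarith
    have hs0 : 0 < s (1 - r) := by
      refine lt_of_le_of_ne (h.sweep.nonneg _) fun h0 => ?_
      rw [← h0] at hprod; simp at hprod
    have hg0 : 1 - g x ≠ 0 := fun h0 => by rw [h0] at hprod; simp at hprod
    rcases (h.sweep.le_one (1 - r)).lt_or_eq with hlt | heq
    · obtain ⟨h1, h2, h3⟩ := h.sweep.deriv_ne_zero _ hs0 hlt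
      exact .inr ⟨by linarith, mul_ne_zero h3 hg0⟩
    · left
      rw [heq] at hprod ⊢
      have hgx : g x = 0 := by linarith
      rw [one_mul]
      have hxa : x = a ∨ x = b := by
        by_contra hcon
        push Not at hcon
        rcases lt_trichotomy x a with h1 | h1 | h1
        · linarith [h.profile.pos x (.inl h1)]
        · exact hcon.1 h1
        · rcases lt_trichotomy x b with h2 | h2 | h2
          · linarith [h.profile.neg x h1 h2]
          · exact hcon.2 h2
          · linarith [h.profile.pos x (.inr h2)]
      rcases hxa with rfl | rfl
      · exact h.profile.deriv_left.ne
      · exact h.profile.deriv_right.ne'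
  · exact .inl hy

/-- Near the core, `levelFun` and the third band coordinate serve as normal coordinates. If the
equation has a non-zero derivative in `x` or `y`, the other of these two and the depth `1 - ‖p‖` are
the surface coordinates. Where only the radial derivative is non-zero, the point is interior and `x,
y` are used instead. -/
lemma chart {p : E4} (hp : p ∈ swapSurface K ψ g s e F) :
    ∃ φ : OpenPartialHomeomorph E4 E4, p ∈ φ.source ∧
    ContDiffOn ℝ ∞ φ φ.source ∧ ContDiffOn ℝ ∞ φ.symm φ.target ∧
    (∀ x ∈ φ.source, x ∈ D4 ↔ 0 ≤ φ x 0) ∧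
    (∀ x ∈ φ.source, x ∈ swapSurface K ψ g s e F ↔ 0 ≤ φ x 0 ∧ φ x 2 = 0 ∧ φ x 3 = 0) := by
  by_cases hc : p ∈ swapCore ψ e
  · obtain ⟨hps, hpn⟩ := h.mem_source_of_core hc
    have hpQ := (h.mem_iff_level hpn hc.2.1 hps.2).1 hp
    have hs := h.sweep.contDiff
    have hg := h.profile.contDiff
    let U₀ := (coneChart ψ).source ∩ {q : E4 | 1 - 2 * e < ‖q‖}
    have hU₀ : IsOpen U₀ := (coneChart ψ).open_source.inter
      (isOpen_lt continuous_const continuous_norm)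
    have hsmooth : ContDiff ℝ ∞ (fun w : E3 × ℝ => 1 - w.2) := contDiff_const.sub contDiff_snd
    have hr' : ∀ w v : E3 × ℝ, fderiv ℝ (fun w : E3 × ℝ => 1 - w.2) w v = -v.2 := by
      intro w v
      rw [((hasFDerivAt_snd (𝕜 := ℝ) (p := w)).const_sub 1).fderiv]; rfl
    have hzero : ∀ v : E3 × ℝ, v.1 0 = 0 → v.1 1 = 0 → v.1 2 = 0 → v.2 = 0 → v = 0 := by
      intro v h0 h1 h2 h3
      refine Prod.ext ?_ h3
      ext i; fin_cases i
      · exact h0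
      · exact h1
      · exact h2
    have hmem : ∀ q ∈ U₀, ‖q‖ ≤ 1 → (q ∈ swapSurface K ψ g s e F ↔
        levelFun s g (coneChart ψ q) = 0 ∧ (coneChart ψ q).1 2 = 0) := fun q hq hq1 =>
      h.mem_iff_level hq.2 hq1 hq.1.2
    have hfin : ∀ (f : E3 × ℝ → ℝ), ContDiff ℝ ∞ f →
        (∀ v : E3 × ℝ, v.2 = 0 → fderiv ℝ f (coneChart ψ p) v = 0 → v.1 2 = 0 →
          fderiv ℝ (levelFun s g) (coneChart ψ p) v = 0 → v = 0) →
        ∃ φ : OpenPartialHomeomorph E4 E4, p ∈ φ.source ∧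
          ContDiffOn ℝ ∞ φ φ.source ∧ ContDiffOn ℝ ∞ φ.symm φ.target ∧
          (∀ x ∈ φ.source, x ∈ D4 ↔ 0 ≤ φ x 0) ∧
          (∀ x ∈ φ.source, x ∈ swapSurface K ψ g s e F ↔ 0 ≤ φ x 0 ∧ φ x 2 = 0 ∧ φ x 3 = 0) := by
      intro f hf hinj
      obtain ⟨φ, h1, h2, h3, h4, h5⟩ := exists_chart_of_coneChart h.band.smooth hU₀
        Set.inter_subset_left (h := ![fun w => 1 - w.2, f, levelFun s g, fun w => w.1 2]) (by
          intro i; fin_cases i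
          · exact hsmooth
          · exact hf
          · exact contDiff_levelFun hs hg
          · exact contDiff_coord 2) (p := p) ⟨hps, hpn⟩ (by
          intro v hv
          refine hinj v ?_ (hv 1) ?_ (hv 2)
          · have := hv 0
            simp only [Matrix.cons_val_zero, hr'] at this
            linarith
          · have : fderiv ℝ (fun w : E3 × ℝ => w.1 2) _ v = 0 := hv 3
            rwa [fderiv_coord_apply] at this)
      have hD : ∀ x, x ∈ D4 ↔ 0 ≤ φ x 0 := by
        intro x
        rw [h3 x 0, mem_closedBall_zero_iff]
        change _ ↔ 0 ≤ 1 - ‖x‖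
        constructor <;> intro hh <;> linarith
      refine ⟨φ, h1, h4, h5, fun x _ => hD x, fun x hx => ?_⟩
      have e2 : φ x 2 = levelFun s g (coneChart ψ x) := h3 x 2
      have e3 : φ x 3 = (coneChart ψ x).1 2 := h3 x 3
      rw [e2, e3, ← hD x]
      constructor
      · intro hxF
        have hx1 := h.subset_ball hxF
        exact ⟨hx1, (hmem x (h2 hx) (mem_closedBall_zero_iff.1 hx1)).1 hxF⟩
      · rintro ⟨hx1, hx2⟩
        exact (hmem x (h2 hx) (mem_closedBall_zero_iff.1 hx1)).2 hx2
    set w₀ := coneChart ψ p with hw₀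
    have hdQ := fderiv_levelFun_apply hs hg w₀
    rcases h.regular (x := w₀.1 0) (y := w₀.1 1) (r := w₀.2) hpQ.1 with h1 | h1 | ⟨hlt, h1⟩
    · refine hfin (fun w => w.1 0) (contDiff_coord 0) fun v h2 h3 h4 h5 => ?_
      rw [fderiv_coord_apply] at h3
      rw [hdQ, h2, h3] at h5
      refine hzero v h3 ?_ h4 h2
      have : 4 * (2 * w₀.1 1 - 1) * v.1 1 = 0 := by linarith
      simpa [h1] using this
    · refine hfin (fun w => w.1 1) (contDiff_coord 1) fun v h2 h3 h4 h5 => ?_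
      rw [fderiv_coord_apply] at h3
      rw [hdQ, h2, h3] at h5
      refine hzero v ?_ h3 h4 h2
      have : s (1 - w₀.2) * deriv g (w₀.1 0) * v.1 0 = 0 := by linarith
      exact (mul_eq_zero.1 this).resolve_left h1
    · -- an interior point
      let U₁ := U₀ ∩ ({q : E4 | ‖q‖ < 1} ∩ (coneChart ψ).source ∩
        coneChart ψ ⁻¹' {w | 0 < 1 + w.1 0 - w₀.1 0})
      have hU₁ : IsOpen U₁ := by
        refine hU₀.inter ?_
        rw [Set.inter_assoc]
        refine (isOpen_lt continuous_norm continuous_const).inter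
          ((coneChart ψ).isOpen_inter_preimage ?_)
        exact isOpen_lt continuous_const
          ((continuous_const.add (contDiff_coord 0).continuous).sub continuous_const)
      -- The shift by `1 - x₀` makes the coordinate `x` positive near the point, as the half-space
      -- condition of an interior chart requires.
      have hf0 : ContDiff ℝ ∞ (fun w : E3 × ℝ => 1 + w.1 0 - w₀.1 0) :=
        (contDiff_const.add (contDiff_coord 0)).sub contDiff_const
      have hf0' : ∀ v, fderiv ℝ (fun w : E3 × ℝ => 1 + w.1 0 - w₀.1 0) w₀ v = v.1 0 := by
        intro v
        rw [(((hasFDerivAt_coord 0 w₀).const_add 1).sub_const (w₀.1 0)).fderiv]; rfl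
      obtain ⟨φ, h2, h3, h4, h5, h6⟩ := exists_chart_of_coneChart h.band.smooth hU₁
        (fun q hq => hq.1.1) (h := ![fun w => 1 + w.1 0 - w₀.1 0, fun w => w.1 1, levelFun s g,
          fun w => w.1 2]) (by
          intro i; fin_cases i
          · exact hf0
          · exact contDiff_coord 1
          · exact contDiff_levelFun hs hg
          · exact contDiff_coord 2) (p := p) ⟨⟨hps, hpn⟩, ⟨⟨hlt, hps⟩, by
            change 0 < 1 + w₀.1 0 - w₀.1 0; linarith⟩⟩ (by
          intro v hv
          have v0 : v.1 0 = 0 := by rw [← hf0' v]; exact hv 0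
          have v1 : v.1 1 = 0 := by rw [← fderiv_coord_apply 1 w₀ v]; exact hv 1
          have v2 : v.1 2 = 0 := by rw [← fderiv_coord_apply 2 w₀ v]; exact hv 3
          have v3 : fderiv ℝ (levelFun s g) w₀ v = 0 := hv 2
          refine hzero v v0 v1 v2 ?_
          rw [hdQ, v0, v1] at v3
          have : deriv s (1 - w₀.2) * (1 - g (w₀.1 0)) * v.2 = 0 := by linarith
          exact (mul_eq_zero.1 this).resolve_left h1)
      have hpos : ∀ x ∈ φ.source, 0 ≤ φ x 0 := fun x hx => by
        rw [h4 x 0]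
        exact le_of_lt (h3 hx).2.2
      have hD : ∀ x ∈ φ.source, ‖x‖ < 1 := fun x hx => (h3 hx).2.1.1
      refine ⟨φ, h2, h5, h6, fun x hx => ?_, fun x hx => ?_⟩
      · exact iff_of_true (mem_closedBall_zero_iff.2 (hD x hx).le) (hpos x hx)
      · have e2 : φ x 2 = levelFun s g (coneChart ψ x) := h4 x 2
        have e3 : φ x 3 = (coneChart ψ x).1 2 := h4 x 3
        rw [e2, e3, hmem x (h3 hx).1 (hD x hx).le]
        simp [hpos x hx]
  · obtain ⟨φ, h1, h2, h3, h4, h5⟩ := h.proper.chart p ((h.mem_iff_of_notMem_core hc).1 hp)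
    have hsrc : (φ.restrOpen _ h.isClosed_core.isOpen_compl).source = φ.source ∩ (swapCore ψ e)ᶜ :=
      rfl
    refine ⟨φ.restrOpen _ h.isClosed_core.isOpen_compl, ⟨h1, hc⟩, h2.mono fun x hx => hx.1,
      h3.mono fun x hx => hx.1, fun x hx => h4 x hx.1, fun x hx => ?_⟩
    rw [h.mem_iff_of_notMem_core hx.2]
    exact h5 x hx.1

end SwapSetting

end Swap
end FourGenus

namespace FourGenus

open scoped ContDiff Manifold unitInterval
open Topology

/-! ### The part of the surface away from the band -/

section Box

/-- A neighbourhood of the flat square. -/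
def bandBox (δ : ℝ) : Set E3 :=
  {u | (-δ < u 0 ∧ u 0 < 1 + δ) ∧ (-δ < u 1 ∧ u 1 < 1 + δ) ∧ (-δ < u 2 ∧ u 2 < δ)}

lemma isOpen_bandBox (δ : ℝ) : IsOpen (bandBox δ) := by
  have h : ∀ i : Fin 3, Continuous (fun u : E3 => u i) := fun i => by fun_prop
  exact ((isOpen_lt continuous_const (h 0)).inter (isOpen_lt (h 0) continuous_const)).inter
    (((isOpen_lt continuous_const (h 1)).inter (isOpen_lt (h 1) continuous_const)).inter
    ((isOpen_lt continuous_const (h 2)).inter (isOpen_lt (h 2) continuous_const)))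

lemma flatSquare_subset_bandBox {δ : ℝ} (hδ : 0 < δ) : flatSquare ⊆ bandBox δ := by
  rintro u ⟨⟨h1, h2⟩, ⟨h3, h4⟩, h5⟩
  refine ⟨⟨by linarith, by linarith⟩, ⟨by linarith, by linarith⟩, ⟨?_, ?_⟩⟩ <;> rw [h5] <;> linarith

lemma exists_clamp {δ x : ℝ} (h1 : -δ < x) (h2 : x < 1 + δ) :
    ∃ y ∈ Set.Icc (0 : ℝ) 1, (x - y) ^ 2 ≤ δ ^ 2 := by
  rcases le_total x 0 with h | h
  · exact ⟨0, by simp, by nlinarith⟩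
  · rcases le_total x 1 with h' | h'
    · exact ⟨x, ⟨h, h'⟩, by rw [sub_self]; nlinarith [sq_nonneg δ]⟩
    · exact ⟨1, by simp, by nlinarith⟩

lemma exists_bandBox_subset {T : Set E3} (hT : IsOpen T) (h : flatSquare ⊆ T) :
    ∃ δ > 0, bandBox δ ⊆ T := by
  obtain ⟨ρ, hρ, hsub⟩ := isCompact_flatSquare.exists_cthickening_subset_open hT h
  -- With `δ = ρ / 2` a point of the box has squared distance at most `3δ² < ρ²` from the square.
  refine ⟨ρ / 2, by positivity, fun u hu => hsub ?_⟩
  obtain ⟨⟨h1, h2⟩, ⟨h3, h4⟩, ⟨h5, h6⟩⟩ := hu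
  obtain ⟨x, hx, hx'⟩ := exists_clamp h1 h2
  obtain ⟨y, hy, hy'⟩ := exists_clamp h3 h4
  refine Metric.mem_cthickening_of_dist_le u !₂[x, y, 0] ρ _ ⟨hx, hy, rfl⟩ ?_
  rw [EuclideanSpace.dist_eq, Real.sqrt_le_left hρ.le, Fin.sum_univ_three]
  simp only [Real.dist_eq, sq_abs]
  change (u 0 - x) ^ 2 + (u 1 - y) ^ 2 + (u 2 - 0) ^ 2 ≤ ρ ^ 2
  nlinarith

end Box

namespace SwapSetting

variable {K : Knot} {ψ : OpenPartialHomeomorph S3 E3} {g : ℝ → ℝ} {a b : ℝ}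
  {s τ : ℝ → ℝ} {e z : ℝ} {F : Set E4}

/-- The radial motion of a collar. -/
noncomputable def push (e : ℝ) (x : ℝ × E4) : E4 :=
  x.2 - max 0 (‖x.2‖ - 1 + x.1 * (3 * e / 2)) • (dir x.2 : E4)

lemma push_eq (e l : ℝ) (p : E4) :
    push e (l, p) = min ‖p‖ (1 - l * (3 * e / 2)) • (dir p : E4) := by
  have : min ‖p‖ (1 - l * (3 * e / 2)) =
      ‖p‖ - max 0 (‖p‖ - 1 + l * (3 * e / 2)) := by
    rw [← min_sub_sub_left]
    congr 1 <;> ring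
  rw [this, sub_smul, norm_smul_dir]; rfl

variable (h : SwapSetting K ψ g a b s τ e z F)

include h

section Push

variable {l : ℝ} (hl : l ∈ Set.Icc (0 : ℝ) 1)

include hl

lemma mul_le : 0 ≤ l * (3 * e / 2) ∧ l * (3 * e / 2) ≤ 3 * e / 2 := by
  have he := h.sweep.pos
  have h3 := hl.1; have h4 := hl.2
  exact ⟨by positivity, by nlinarith⟩

lemma push_eq_self {p : E4} (hp : ‖p‖ ≤ 1 - 3 * e / 2) : push e (l, p) = p := by
  rw [push_eq, min_eq_left, norm_smul_dir]
  linarith [(h.mul_le hl).2]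

lemma dir_push {p : E4} (hp : p ≠ 0) : dir (push e (l, p)) = dir p ∧
    ‖push e (l, p)‖ = min ‖p‖ (1 - l * (3 * e / 2)) := by
  have he := h.sweep.pos; have he' := h.lt
  have hpos : 0 < min ‖p‖ (1 - l * (3 * e / 2)) :=
    lt_min (norm_pos_iff.2 hp) (by linarith [(h.mul_le hl).2])
  rw [push_eq]
  exact ⟨dir_smul hpos _, by rw [norm_smul, norm_coe_S3, mul_one, Real.norm_of_nonneg hpos.le]⟩

/-- The motion only affects norms above `1 - 3e/2`, and there it keeps the direction and stays in
the collar where `F` is conical. -/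
lemma push_mem {p : E4} (hp : p ∈ F) : push e (l, p) ∈ F := by
  have he := h.sweep.pos; have he' := h.lt
  by_cases hn : ‖p‖ ≤ 1 - 3 * e / 2
  · rwa [h.push_eq_self hl hn]
  · have hn1 : ‖p‖ ≤ 1 := mem_closedBall_zero_iff.1 (h.proper.subset_ball hp)
    have hp0 : p ≠ 0 := norm_pos_iff.1 (by linarith)
    obtain ⟨h1, h2⟩ := h.dir_push hl hp0
    have h3 := (h.mul_le hl)
    rw [h.collar _ (by rw [h2]; exact lt_min (by linarith) (by linarith))
      (by rw [h2]; exact (min_le_left _ _).trans hn1), h1]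
    exact (h.collar p (by linarith) hn1).1 hp

/-- Directions are preserved and norms do not increase, so the motion cannot enter the core. -/
lemma push_notMem_core {p : E4} (hp1 : ‖p‖ ≤ 1) (hp : p ∉ swapCore ψ e) :
    push e (l, p) ∉ swapCore ψ e := by
  have he := h.sweep.pos; have he' := h.lt
  by_cases hn : ‖p‖ ≤ 1 - 3 * e / 2
  · rwa [h.push_eq_self hl hn]
  · have hp0 : p ≠ 0 := norm_pos_iff.1 (by linarith)
    obtain ⟨h1, h2⟩ := h.dir_push hl hp0
    rintro ⟨h3, h4, h5⟩
    rw [h1] at h5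
    rw [h2] at h3
    exact hp ⟨h3.trans (min_le_left _ _), hp1, h5⟩

end Push

lemma push_one_notMem_core (p : E4) : push e (1, p) ∉ swapCore ψ e := by
  have he := h.sweep.pos; have he' := h.lt
  have hl : (1 : ℝ) ∈ Set.Icc (0 : ℝ) 1 := by simp
  by_cases hn : ‖p‖ ≤ 1 - 3 * e / 2
  · rw [h.push_eq_self hl hn]
    rintro ⟨h3, -⟩
    linarith
  · have hp0 : p ≠ 0 := norm_pos_iff.1 (by linarith)
    obtain ⟨h1, h2⟩ := h.dir_push hl hp0
    rintro ⟨h3, h4, h5⟩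
    rw [h1] at h5
    rw [h2] at h3
    have := h3.trans (min_le_right _ _)
    linarith

lemma continuousOn_push :
    ContinuousOn (push e) (Set.Icc 0 1 ×ˢ Set.univ) := by
  have he' := h.lt
  rintro ⟨l, p⟩ hlp
  by_cases hp : ‖p‖ < 1 - 3 * e / 2
  · have : push e =ᶠ[𝓝[Set.Icc 0 1 ×ˢ Set.univ] (l, p)] Prod.snd := by
      filter_upwards [self_mem_nhdsWithin, mem_nhdsWithin_of_mem_nhds
        ((isOpen_lt (continuous_norm.comp continuous_snd) continuous_const).mem_nhds
        (show (l, p) ∈ {x : ℝ × E4 | ‖x.2‖ < 1 - 3 * e / 2} from hp))] with x hx hx'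
      exact h.push_eq_self hx.1 (le_of_lt hx')
    exact continuous_snd.continuousWithinAt.congr_of_eventuallyEq this
      (h.push_eq_self hlp.1 hp.le)
  · have hp0 : p ≠ 0 := norm_pos_iff.1 (by linarith)
    have hd : ContinuousAt (fun x : ℝ × E4 => dir x.2) (l, p) :=
      (continuousAt_dir hp0).comp_of_eq continuousAt_snd rfl
    have hd' : ContinuousAt (fun x : ℝ × E4 => (dir x.2 : E4)) (l, p) :=
      continuous_subtype_val.continuousAt.comp hd
    have : Continuous (fun x : ℝ × E4 => max 0 (‖x.2‖ - 1 + x.1 * (3 * e / 2))) := by fun_prop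
    exact (continuousAt_snd.sub (this.continuousAt.smul hd')).continuousWithinAt

/-- The unchanged part of the surface. -/
def unchanged (_ : SwapSetting K ψ g a b s τ e z F) : Set (swapSurface K ψ g s e F) :=
  {p | p.1 ∉ swapCore ψ e}

lemma isOpen_unchanged : IsOpen h.unchanged :=
  h.isClosed_core.isOpen_compl.preimage continuous_subtype_val

/-- The unchanged part of the surface is a deformation retract of the old surface. -/
lemma exists_push_homotopy : ∃ (i : C(F, swapSurface K ψ g s e F)) (r : C(h.unchanged, F))
    (H : C(I × h.unchanged, swapSurface K ψ g s e F)), (∀ p, H (0, p) = p) ∧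
      (∀ p, H (1, p) = i (r p)) ∧ ∀ p, i p ∈ h.unchanged := by
  have hkc := h.continuousOn_push
  have h1 : (1 : ℝ) ∈ Set.Icc (0 : ℝ) 1 := by simp
  have hUF : ∀ p : h.unchanged, p.1.1 ∈ F := fun p => (h.mem_iff_of_notMem_core p.2).1 p.1.2
  have hUn : ∀ p : h.unchanged, ‖p.1.1‖ ≤ 1 := fun p =>
    mem_closedBall_zero_iff.1 (h.subset_ball p.1.2)
  refine ⟨⟨fun p => ⟨push e (1, p.1), (h.mem_iff_of_notMem_core
      (h.push_one_notMem_core p)).2 (h.push_mem h1 p.2)⟩, ?_⟩,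
    ⟨fun p => ⟨p.1.1, hUF p⟩, by fun_prop⟩,
    ⟨fun x => ⟨push e (x.1, x.2.1.1), (h.mem_iff_of_notMem_core
      (h.push_notMem_core x.1.2 (hUn x.2) x.2.2)).2 (h.push_mem x.1.2 (hUF x.2))⟩, ?_⟩,
    fun p => ?_, fun p => ?_, fun p => ?_⟩
  · exact Continuous.subtype_mk (hkc.comp_continuous (by fun_prop) fun p => ⟨h1, trivial⟩) _
  · exact Continuous.subtype_mk (hkc.comp_continuous (by fun_prop) fun x => ⟨x.1.2, trivial⟩) _
  · refine Subtype.ext ?_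
    have hn : ‖p.1.1‖ ≤ 1 - 0 * (3 * e / 2) := by simpa using hUn p
    change push e (0, p.1.1) = p.1.1
    rw [push_eq, min_eq_left hn, norm_smul_dir]
  · rfl
  · exact h.push_one_notMem_core p

end SwapSetting
end FourGenus

namespace FourGenus

open scoped ContDiff Manifold unitInterval
open Topology

/-! ### Connectedness, Betti number and boundary of the changed surface -/

namespace SwapSetting

variable {K : Knot} {ψ : OpenPartialHomeomorph S3 E3} {g : ℝ → ℝ} {a b : ℝ}
  {s τ : ℝ → ℝ} {e z δ : ℝ} {F : Set E4} (h : SwapSetting K ψ g a b s τ e z F)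

/-- The part of the surface near the band. -/
def nearBand (_ : SwapSetting K ψ g a b s τ e z F) (δ : ℝ) : Set (swapSurface K ψ g s e F) :=
  {p | p.1 ∈ (coneChart ψ).source ∧ (coneChart ψ p.1).1 ∈ bandBox δ ∧ 1 - 3 * e / 2 < ‖p.1‖}

include h

lemma isOpen_nearBand : IsOpen (h.nearBand δ) := by
  have h1 : IsOpen ((coneChart ψ).source ∩ coneChart ψ ⁻¹' (bandBox δ ×ˢ Set.univ)) :=
    (coneChart ψ).isOpen_inter_preimage ((isOpen_bandBox δ).prod isOpen_univ)
  have h2 : IsOpen {p : E4 | 1 - 3 * e / 2 < ‖p‖} := isOpen_lt continuous_const continuous_norm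
  convert (h1.inter h2).preimage (continuous_subtype_val (p := (· ∈ swapSurface K ψ g s e F)))
    using 1
  ext p
  simp [nearBand, and_assoc]

lemma unchanged_union_nearBand (hδ : 0 < δ) : h.unchanged ∪ h.nearBand δ = Set.univ := by
  refine Set.eq_univ_of_forall fun p => ?_
  by_cases hp : p.1 ∈ swapCore ψ e
  · have := h.sweep.pos; have := hp.1
    exact .inr ⟨(h.mem_source_of_core hp).1, flatSquare_subset_bandBox hδ hp.2.2.2, by linarith⟩
  · exact .inl hp

/-- The position of a point of the model in three-space. -/
noncomputable def modelPoint (m : ℝ × ℝ × ℝ) : E3 := !₂[m.1, (m.2.1 + 1) / 2, 0]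

lemma abs_le_of_mem_model {m : ℝ × ℝ × ℝ} (hm : m ∈ model s g e δ) :
    -1 ≤ m.2.1 ∧ m.2.1 ≤ 1 := by
  have h5 := hm.2.2.2.2
  have := mul_nonneg (h.sweep.nonneg m.2.2) (model.one_sub_nonneg h.profile m.1)
  constructor <;> nlinarith

lemma modelPoint_mem (hδ : 0 < δ) {m : ℝ × ℝ × ℝ} (hm : m ∈ model s g e δ) :
    modelPoint m ∈ bandBox δ := by
  have h1 := h.abs_le_of_mem_model hm
  refine ⟨⟨hm.1, hm.2.1⟩, ⟨?_, ?_⟩, ⟨?_, ?_⟩⟩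
  · change -δ < (m.2.1 + 1) / 2; linarith
  · change (m.2.1 + 1) / 2 < 1 + δ; linarith
  · change -δ < 0; linarith
  · change 0 < δ; linarith

/-- The parametrization of the part near the band by the model. -/
noncomputable def modelMap (ψ : OpenPartialHomeomorph S3 E3) (m : ℝ × ℝ × ℝ) : E4 :=
  (coneChart ψ).symm (modelPoint m, 1 - m.2.2)

lemma mem_target (hδ : 0 < δ) (hT : bandBox δ ⊆ ψ.target) {m : ℝ × ℝ × ℝ}
    (hm : m ∈ model s g e δ) : (modelPoint m, 1 - m.2.2) ∈ (coneChart ψ).target := by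
  refine ⟨hT (h.modelPoint_mem hδ hm), ?_⟩
  have := hm.2.2.2.1; have := h.lt
  change 0 < 1 - m.2.2
  linarith

lemma coneChart_modelMap (hδ : 0 < δ) (hT : bandBox δ ⊆ ψ.target) {m : ℝ × ℝ × ℝ}
    (hm : m ∈ model s g e δ) : coneChart ψ (modelMap ψ m) = (modelPoint m, 1 - m.2.2) :=
  (coneChart ψ).right_inv (h.mem_target hδ hT hm)

lemma norm_modelMap (hδ : 0 < δ) (hT : bandBox δ ⊆ ψ.target) {m : ℝ × ℝ × ℝ}
    (hm : m ∈ model s g e δ) : ‖modelMap ψ m‖ = 1 - m.2.2 :=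
  congrArg Prod.snd (h.coneChart_modelMap hδ hT hm)

lemma modelMap_mem (hδ : 0 < δ) (hT : bandBox δ ⊆ ψ.target) {m : ℝ × ℝ × ℝ}
    (hm : m ∈ model s g e δ) : modelMap ψ m ∈ swapSurface K ψ g s e F := by
  have hn := h.norm_modelMap hδ hT hm
  have he := h.sweep.pos
  have hs : modelMap ψ m ∈ (coneChart ψ).source := (coneChart ψ).map_target (h.mem_target hδ hT hm)
  rw [h.mem_iff_level (by rw [hn]; linarith [hm.2.2.2.1]) (by rw [hn]; linarith [hm.2.2.1]) hs.2,
    h.coneChart_modelMap hδ hT hm]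
  refine ⟨?_, rfl⟩
  have h5 := hm.2.2.2.2
  change (2 * ((m.2.1 + 1) / 2) - 1) ^ 2 - 1 + s (1 - (1 - m.2.2)) * (1 - g m.1) = 0
  rw [sub_sub_cancel]
  linear_combination h5

/-- The part near the band is parametrized by the model. -/
lemma exists_model_maps (hδ : 0 < δ) (hT : bandBox δ ⊆ ψ.target) :
    ∃ (j : C(model s g e δ, swapSurface K ψ g s e F)) (r : C(h.nearBand δ, model s g e δ)),
      (∀ p, j (r p) = p) ∧ (∀ m, j m ∈ h.nearBand δ) ∧ (∀ m, (j m).1 = modelMap ψ m.1) ∧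
      (∀ m, j m ∈ h.unchanged ↔ m ∈ modelRim s g e δ) := by
  have hsrc : ∀ m : model s g e δ, modelMap ψ m.1 ∈ (coneChart ψ).source := fun m =>
    (coneChart ψ).map_target (h.mem_target hδ hT m.2)
  have hmp : Continuous (fun m : ℝ × ℝ × ℝ => modelPoint m) := by
    unfold modelPoint; fun_prop
  have hr : ∀ p : h.nearBand δ, ((coneChart ψ p.1.1).1 0, 2 * (coneChart ψ p.1.1).1 1 - 1,
      1 - ‖p.1.1‖) ∈ model s g e δ := by
    intro p
    have hn : ‖p.1.1‖ ≤ 1 := mem_closedBall_zero_iff.1 (h.subset_ball p.1.2)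
    have he := h.sweep.pos
    have hl := (h.mem_iff_level (by linarith [p.2.2.2]) hn p.2.1.2).1 p.1.2
    refine ⟨p.2.2.1.1.1, p.2.2.1.1.2, by linarith, ?_, ?_⟩
    · change 1 - ‖p.1.1‖ < 3 * e / 2
      linarith [p.2.2.2]
    · have := hl.1
      rw [levelFun] at this
      change _ = 1 - s (1 - (coneChart ψ p.1.1).2) * _
      linear_combination this
  have hz : ∀ p : h.nearBand δ, (coneChart ψ p.1.1).1 2 = 0 := by
    intro p
    have hn : ‖p.1.1‖ ≤ 1 := mem_closedBall_zero_iff.1 (h.subset_ball p.1.2)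
    have he := h.sweep.pos
    exact ((h.mem_iff_level (by linarith [p.2.2.2]) hn p.2.1.2).1 p.1.2).2
  have hcc : Continuous (fun p : h.nearBand δ => coneChart ψ p.1.1) :=
    (coneChart ψ).continuousOn.comp_continuous (by fun_prop) fun p => p.2.1
  have hc1 : Continuous (fun m : model s g e δ => (modelPoint m.1, 1 - m.1.2.2)) :=
    (hmp.comp continuous_subtype_val).prodMk (by fun_prop)
  have hc2 : Continuous (fun m : model s g e δ => modelMap ψ m.1) :=
    (coneChart ψ).symm.continuousOn.comp_continuous hc1 fun m => h.mem_target hδ hT m.2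
  have hc3 : ∀ i : Fin 3, Continuous (fun p : h.nearBand δ => (coneChart ψ p.1.1).1 i) := fun i =>
    (contDiff_coord i).continuous.comp hcc
  have hc4 : Continuous (fun p : h.nearBand δ => ((coneChart ψ p.1.1).1 0,
      2 * (coneChart ψ p.1.1).1 1 - 1, 1 - ‖p.1.1‖)) :=
    (hc3 0).prodMk (((continuous_const.mul (hc3 1)).sub continuous_const).prodMk
      (continuous_const.sub (continuous_subtype_val.comp continuous_subtype_val).norm))
  refine ⟨⟨fun m => ⟨modelMap ψ m.1, h.modelMap_mem hδ hT m.2⟩, hc2.subtype_mk _⟩,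
    ⟨fun p => ⟨_, hr p⟩, hc4.subtype_mk hr⟩,
    fun p => ?_, fun m => ?_, fun m => rfl, fun m => ?_⟩
  · refine Subtype.ext ?_
    change (coneChart ψ).symm _ = _
    refine Eq.trans ?_ ((coneChart ψ).left_inv p.2.1)
    congr 1
    refine Prod.ext ?_ ?_
    · ext i
      fin_cases i
      · rfl
      · change (2 * (coneChart ψ p.1.1).1 1 - 1 + 1) / 2 = (coneChart ψ p.1.1).1 1
        ring
      · exact (hz p).symm
    · change 1 - (1 - ‖p.1.1‖) = ‖p.1.1‖
      ring
  · refine ⟨hsrc m, ?_, ?_⟩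
    · change (coneChart ψ (modelMap ψ m.1)).1 ∈ _
      rw [h.coneChart_modelMap hδ hT m.2]
      exact h.modelPoint_mem hδ m.2
    · change _ < ‖modelMap ψ m.1‖
      rw [h.norm_modelMap hδ hT m.2]
      linarith [m.2.2.2.2.1]
  · refine not_congr ?_
    change (1 - e ≤ ‖modelMap ψ m.1‖ ∧ ‖modelMap ψ m.1‖ ≤ 1 ∧ dir (modelMap ψ m.1) ∈ ψ.source ∧
      ψ (dir (modelMap ψ m.1)) ∈ flatSquare) ↔ _
    rw [h.norm_modelMap hδ hT m.2]
    have hd : ψ (dir (modelMap ψ m.1)) = modelPoint m.1 :=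
      congrArg Prod.fst (h.coneChart_modelMap hδ hT m.2)
    have hy := h.abs_le_of_mem_model m.2
    constructor
    · rintro ⟨h1, -, h3, h4⟩
      rw [hd] at h4
      exact ⟨h4.1, by linarith⟩
    · rintro ⟨h1, h2⟩
      refine ⟨by linarith, by linarith [m.2.2.2.1], (hsrc m).2, ?_⟩
      rw [hd]
      refine ⟨h1, ⟨?_, ?_⟩, rfl⟩
      · change 0 ≤ (m.1.2.1 + 1) / 2; linarith
      · change (m.1.2.1 + 1) / 2 ≤ 1; linarith

lemma exists_rim_point (hδ : 0 < δ) : ∃ m : model s g e δ, m ∈ modelRim s g e δ := by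
  have he := h.sweep.pos
  refine ⟨⟨(-(δ / 2), 1, 0), ?_, ?_, le_rfl, ?_, ?_⟩, fun hm => ?_⟩
  · change -δ < -(δ / 2); linarith
  · change -(δ / 2) < 1 + δ; linarith
  · change 0 < 3 * e / 2; linarith
  · simp [h.profile.eq_one (-(δ / 2)) (.inl (by linarith))]
  · have : 0 ≤ -(δ / 2) := hm.1.1
    linarith

/-- The unchanged part moves into the image of the connected surface `F`, and the part near the band
is joined to a rim point inside the path connected model. -/
lemma isConnected : IsConnected (swapSurface K ψ g s e F) := by
  obtain ⟨δ, hδ, hT⟩ := exists_bandBox_subset ψ.open_target h.band.square_subset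
  obtain ⟨i, r, H, H0, H1, hi⟩ := h.exists_push_homotopy
  obtain ⟨j, r', hj, hj', -, hj2⟩ := h.exists_model_maps hδ hT
  obtain ⟨m₀, hm₀⟩ := h.exists_rim_point hδ
  obtain ⟨x₀, hx₀⟩ := h.proper.isConnected.nonempty
  have : ConnectedSpace F := isConnected_iff_connectedSpace.1 h.proper.isConnected
  have hS : ∀ y, i y ∈ connectedComponent (i ⟨x₀, hx₀⟩) := fun y =>
    (isPreconnected_range i.continuous).subset_connectedComponent ⟨_, rfl⟩ ⟨y, rfl⟩
  have hjoin : ∀ p q : swapSurface K ψ g s e F, Joined p q →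
      q ∈ connectedComponent (i ⟨x₀, hx₀⟩) → p ∈ connectedComponent (i ⟨x₀, hx₀⟩) := by
    intro p q hpq hq
    rw [connectedComponent_eq hq]
    exact pathComponent_subset_component _ hpq.symm
  have hU : ∀ p ∈ h.unchanged, p ∈ connectedComponent (i ⟨x₀, hx₀⟩) := by
    intro p hp
    refine hjoin p (i (r ⟨p, hp⟩)) ?_ (hS _)
    rw [← H1 ⟨p, hp⟩, ← joinedIn_univ]
    exact joinedIn_of_homotopy (B := Set.univ) H H0 (fun _ _ _ => trivial) hp trivial
  rw [isConnected_iff_connectedSpace, connectedSpace_iff_connectedComponent]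
  refine ⟨i ⟨x₀, hx₀⟩, Set.eq_univ_of_forall fun p => ?_⟩
  have hp : p ∈ h.unchanged ∪ h.nearBand δ := by
    rw [h.unchanged_union_nearBand hδ]; trivial
  rcases hp with hp | hp
  · exact hU p hp
  · refine hjoin p (j m₀) ?_ (hU _ ((hj2 m₀).2 hm₀))
    have := (model_joined h.sweep h.profile hδ (r' ⟨p, hp⟩) m₀).map j.continuous
    rwa [hj] at this

/-- The changed surface is a proper surface. -/
theorem isProperSurface : IsProperSurface (swapSurface K ψ g s e F) :=
  ⟨h.subset_ball, h.isCompact, h.isConnected, fun _ hp => h.chart hp⟩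

/-- The change increases the first Betti number at most by one. -/
theorem firstBetti_le : firstBetti (swapSurface K ψ g s e F) ≤ firstBetti F + 1 := by
  obtain ⟨δ, hδ, hT⟩ := exists_bandBox_subset ψ.open_target h.band.square_subset
  obtain ⟨i, r, H, H0, H1, hi⟩ := h.exists_push_homotopy
  obtain ⟨j, r', hj, hj', -, hj2⟩ := h.exists_model_maps hδ hT
  obtain ⟨P, Q, hPQ, hP, hQ⟩ := exists_modelRim_components h.sweep h.profile hδ h.end_eq
  have hU : ∀ c : PathCocycle (swapSurface K ψ g s e F), (c.comap i).IsCoboundary →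
      ∃ f, c.TrivializedOn h.unchanged f := fun c hc =>
    c.exists_trivializedOn_of_homotopy i r hc H H0 H1
  have hV : ∀ c : PathCocycle (swapSurface K ψ g s e F), ∃ f, c.TrivializedOn (h.nearBand δ) f :=
    fun c => c.exists_trivializedOn_of_homotopy j r' (model_isCoboundary h.sweep h.profile hδ _)
      ⟨fun x => x.2.1, by fun_prop⟩ (fun _ => rfl) fun p => (hj p).symm
  have hmap : ∀ m ∈ modelRim s g e δ, j m ∈ h.unchanged ∩ h.nearBand δ := fun m hm =>
    ⟨(hj2 m).2 hm, hj' m⟩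
  have hjoin : ∀ R : Set (model s g e δ),
      (∀ p ∈ R, ∀ q ∈ R, JoinedIn (modelRim s g e δ) p q) →
      ∀ p ∈ j '' R, ∀ q ∈ j '' R, JoinedIn (h.unchanged ∩ h.nearBand δ) p q := by
    rintro R hR _ ⟨p, hp, rfl⟩ _ ⟨q, hq, rfl⟩
    exact ((hR p hp q hq).map j.continuous).mono (Set.image_subset_iff.2 hmap)
  refine firstBetti_le_add_one i fun c c' hc hc' => ?_
  -- Cocycles that die on `F` are trivial on the unchanged part, and all cocycles are trivial near
  -- the band. The overlap is the image of the rim of the model, which has at most two path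
  -- components.
  refine PathCocycle.isCoboundary_or_of_two_components h.isOpen_unchanged h.isOpen_nearBand
    (h.unchanged_union_nearBand hδ) (hU c hc) (hV c) (hU c' hc') (hV c') (P := j '' P) (Q := j '' Q)
    ?_ (hjoin P hP) (hjoin Q hQ)
  rintro p ⟨hpU, hpV⟩
  have hpU' : j (r' ⟨p, hpV⟩) ∈ h.unchanged := by rw [hj]; exact hpU
  have := hPQ ((hj2 _).1 hpU')
  rw [← Set.image_union]
  exact ⟨r' ⟨p, hpV⟩, this, hj _⟩

/-- The boundary of the changed surface is the other side of the band move. -/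
theorem inter_sphere : swapSurface K ψ g s e F ∩ Metric.sphere 0 1 =
    Subtype.val '' bandLevel K ψ g (1 - s e) := by
  have he := h.sweep.pos
  ext p
  rw [Set.mem_inter_iff, mem_sphere_zero_iff_norm]
  constructor
  · rintro ⟨h1, h2⟩
    rw [h.mem_collar (by rw [h2]; linarith) h2.le, h2, sub_self, h.sweep.start_eq] at h1
    refine ⟨dir p, h1, ?_⟩
    rw [← norm_smul_dir p, h2, one_smul, dir_coe]
  · rintro ⟨θ, hθ, rfl⟩
    refine ⟨?_, norm_coe_S3 θ⟩
    rw [h.mem_collar (by rw [norm_coe_S3]; linarith) (norm_coe_S3 θ).le, norm_coe_S3, sub_self,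
      h.sweep.start_eq, dir_coe]
    exact hθ

end SwapSetting
end FourGenus

namespace FourGenus

open scoped ContDiff Manifold
open Topology

/-! ### Two-forms and tangent planes -/

section TwoForms

variable (η : E4 [⋀^Fin 2]→L[ℝ] ℝ)

lemma twoForm_add_left (a b c : E4) : η ![a + b, c] = η ![a, c] + η ![b, c] := by
  simpa using η.toContinuousMultilinearMap.cons_add ![c] a b

lemma twoForm_smul_left (k : ℝ) (a c : E4) : η ![k • a, c] = k * η ![a, c] := by
  simpa using η.toContinuousMultilinearMap.cons_smul ![c] k a

lemma twoForm_swap (a b : E4) : η ![a, b] = - η ![b, a] := by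
  have := η.toAlternatingMap.map_swap ![b, a] (i := 0) (j := 1) (by decide)
  have h2 : (![b, a] ∘ Equiv.swap (0 : Fin 2) 1) = ![a, b] := by
    ext i; fin_cases i <;> simp
  rw [h2] at this
  exact this

lemma twoForm_self (a : E4) : η ![a, a] = 0 := by
  have := twoForm_swap η a a
  linarith

lemma twoForm_add_right (a b c : E4) : η ![c, a + b] = η ![c, a] + η ![c, b] := by
  rw [twoForm_swap, twoForm_add_left, twoForm_swap η a, twoForm_swap η b]; ring

lemma twoForm_smul_right (k : ℝ) (a c : E4) : η ![c, k • a] = k * η ![c, a] := by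
  rw [twoForm_swap, twoForm_smul_left, twoForm_swap η a]; ring

lemma twoForm_pair (x y : E4) (a b a' b' : ℝ) :
    η ![a • x + b • y, a' • x + b' • y] = (a * b' - b * a') * η ![x, y] := by
  simp only [twoForm_add_left, twoForm_add_right, twoForm_smul_left, twoForm_smul_right,
    twoForm_self, twoForm_swap η y x]
  ring

lemma twoForm_triple (x y r : E4) (a b c a' b' c' : ℝ) :
    η ![a • x + b • y + c • r, a' • x + b' • y + c' • r] =
      (b * c' - c * b') * η ![y, r] + (c * a' - a * c') * η ![r, x] +
      (a * b' - b * a') * η ![x, y] := by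
  simp only [twoForm_add_left, twoForm_add_right, twoForm_smul_left, twoForm_smul_right,
    twoForm_self, twoForm_swap η y x, twoForm_swap η x r, twoForm_swap η r y]
  ring

lemma continuousOn_twoForm {X : Type} [TopologicalSpace X] {S : Set X}
    {η : X → E4 [⋀^Fin 2]→L[ℝ] ℝ} {v w : X → E4} (hη : ContinuousOn η S) (hv : ContinuousOn v S)
    (hw : ContinuousOn w S) : ContinuousOn (fun x => η x ![v x, w x]) S := by
  have : ContinuousOn (fun x => ![v x, w x]) S := by
    refine continuousOn_pi.2 fun i => ?_
    fin_cases i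
    · exact hv
    · exact hw
  exact hη.eval this

end TwoForms

section Tangent

variable {F : Set E4} {p : E4}

/-- The derivative maps the tangent cone of `F` to the tangent cone of the single point `c`, which
is zero. -/
lemma tangentPlane_le_ker {f : E4 → ℝ} {f' : E4 →L[ℝ] ℝ} (hf : HasFDerivAt f f' p) {c : ℝ}
    (hc : ∀ᶠ q in 𝓝 p, q ∈ F → f q = c) {v : E4} (hv : v ∈ tangentPlane F p) : f' v = 0 := by
  suffices h : tangentConeAt ℝ F p ⊆ LinearMap.ker (f' : E4 →ₗ[ℝ] ℝ) from
    LinearMap.mem_ker.1 (Submodule.span_le.2 h hv)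
  intro v hv
  rw [← tangentConeAt_inter_nhds hc] at hv
  have h1 := (hf.hasFDerivWithinAt (s := F ∩ {q | q ∈ F → f q = c})).mapsTo_tangent_cone hv
  have h2 : f '' (F ∩ {q | q ∈ F → f q = c}) ⊆ {c} := by
    rintro _ ⟨q, ⟨h1, h2⟩, rfl⟩; exact h2 h1
  have h3 := tangentConeAt_mono (𝕜 := ℝ) (x := f p) h2 h1
  have h4 : ¬ AccPt (f p) (Filter.principal ({c} : Set ℝ)) := fun hacc =>
    Set.Infinite.of_accPt hacc (Set.finite_singleton c)
  exact tangentConeAt_subset_zero h4 h3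

lemma fderiv_apply_eq_zero_of_curve {f : E4 → ℝ} {f' : E4 →L[ℝ] ℝ} {c : ℝ → E4} {t : ℝ} {v : E4}
    (hf : HasFDerivAt f f' (c t)) (hc : HasDerivAt c v t) {k : ℝ}
    (hk : ∀ᶠ u in 𝓝 t, f (c u) = k) : f' v = 0 :=
  (hf.comp_hasDerivAt t hc).unique
    ((hasDerivAt_const t k).congr_of_eventuallyEq (by simpa [Filter.EventuallyEq] using hk))

/-- The tangent vectors of a surface, and the velocities of curves in it, lie in a plane. -/
lemma exists_tangent_bound (hF : IsProperSurface F) (hp' : p ∈ F) : ∃ W : Submodule ℝ E4,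
    Module.finrank ℝ W ≤ 2 ∧ (∀ x ∈ tangentPlane F p, x ∈ W) ∧
    ∀ {c : ℝ → E4} {t : ℝ} {v : E4}, HasDerivAt c v t → (∀ᶠ x in 𝓝 t, c x ∈ F) →
      c t = p → v ∈ W := by
  obtain ⟨φ, hp, h1, h2, h3, h4⟩ := hF.chart p hp'
  have hA := chart_hasFDerivAt h1 hp
  set A := fderiv ℝ φ p with hAdef
  have hsrc := φ.open_source.mem_nhds hp
  have hzero : ∀ i : Fin 4, i = 2 ∨ i = 3 → ∀ q ∈ φ.source, q ∈ F → φ q i = 0 := by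
    rintro i (rfl | rfl) q hq hqF
    · exact ((h4 q hq).1 hqF).2.1
    · exact ((h4 q hq).1 hqF).2.2
  -- The common kernel of the differentials of the two normal coordinates; the two remaining
  -- coordinates embed it in the plane.
  let W : Submodule ℝ E4 := LinearMap.ker ((EuclideanSpace.proj (𝕜 := ℝ) (2 : Fin 4)).comp A : E4 →ₗ[ℝ] ℝ) ⊓
    LinearMap.ker ((EuclideanSpace.proj (𝕜 := ℝ) (3 : Fin 4)).comp A : E4 →ₗ[ℝ] ℝ)
  have hW : ∀ x, x ∈ W ↔ A x 2 = 0 ∧ A x 3 = 0 := fun x => Iff.rfl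
  have hWT : ∀ x ∈ tangentPlane F p, x ∈ W := by
    intro x hx
    have key : ∀ i : Fin 4, i = 2 ∨ i = 3 → A x i = 0 := fun i hi =>
      tangentPlane_le_ker (HasFDerivAt.coord hA i)
        (Filter.mem_of_superset hsrc fun q hq hqF => hzero i hi q hq hqF) hx
    exact ⟨key 2 (.inl rfl), key 3 (.inr rfl)⟩
  have hWc : ∀ {c : ℝ → E4} {t : ℝ} {v : E4}, HasDerivAt c v t → (∀ᶠ x in 𝓝 t, c x ∈ F) →
      c t = p → v ∈ W := by
    intro c t v hc hcF hcp
    have key : ∀ i : Fin 4, i = 2 ∨ i = 3 → A v i = 0 := by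
      intro i hi
      have hA' : HasFDerivAt (fun y => φ y i) ((EuclideanSpace.proj i).comp A) (c t) := by
        rw [hcp]; exact HasFDerivAt.coord hA i
      refine fderiv_apply_eq_zero_of_curve hA' hc (k := 0) ?_
      have : ∀ᶠ x in 𝓝 t, c x ∈ φ.source :=
        hc.continuousAt.eventually (φ.open_source.mem_nhds (by rw [hcp]; exact hp))
      filter_upwards [this, hcF] with x h5 h6
      exact hzero i hi _ h5 h6
    exact ⟨key 2 (.inl rfl), key 3 (.inr rfl)⟩
  have hfin : Module.finrank ℝ W ≤ 2 := by
    let L : W →ₗ[ℝ] (Fin 2 → ℝ) := LinearMap.pi ![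
      ((EuclideanSpace.proj (𝕜 := ℝ) (0 : Fin 4)).comp A : E4 →ₗ[ℝ] ℝ).comp W.subtype,
      ((EuclideanSpace.proj (𝕜 := ℝ) (1 : Fin 4)).comp A : E4 →ₗ[ℝ] ℝ).comp W.subtype]
    have hL : Function.Injective L := by
      rw [← LinearMap.ker_eq_bot, LinearMap.ker_eq_bot']
      intro x hx
      have e0 : A x.1 0 = 0 := congrFun hx 0
      have e1 : A x.1 1 = 0 := congrFun hx 1
      have : A x.1 = 0 := by
        ext i; fin_cases i
        · exact e0
        · exact e1
        · exact x.2.1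
        · exact x.2.2
      refine Subtype.ext ?_
      rw [← chart_fderiv_symm_apply h1 h2 hp x.1, ← hAdef, this, map_zero]
      rfl
    simpa using LinearMap.finrank_le_finrank_of_injective hL
  exact ⟨W, hfin, hWT, hWc⟩

lemma exists_pair_of_finrank_le {W : Submodule ℝ E4} (hfin : Module.finrank ℝ W ≤ 2) {v w : E4}
    (hv : v ∈ W) (hw : w ∈ W) (hvw : LinearIndependent ℝ ![v, w]) {x : E4} (hx : x ∈ W) :
    ∃ a b : ℝ, a • v + b • w = x := by
  have hspan : Submodule.span ℝ (Set.range ![v, w]) = W := by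
    refine Submodule.eq_of_le_of_finrank_le ?_ ?_
    · rw [Submodule.span_le]
      rintro _ ⟨i, rfl⟩
      fin_cases i
      · exact hv
      · exact hw
    · rw [finrank_span_eq_card hvw]
      simpa using hfin
  rw [← hspan, Matrix.range_cons, Matrix.range_cons, Matrix.range_empty, Set.union_empty] at hx
  exact Submodule.mem_span_pair.1 hx

/-- A two-form on a surface does not vanish on independent velocities of curves in the surface. -/
lemma twoForm_ne_zero_of_curves (hF : IsProperSurface F) {c d : ℝ → E4} {t u : ℝ} {v w : E4}
    (hc : HasDerivAt c v t) (hd : HasDerivAt d w u) (hcF : ∀ᶠ x in 𝓝 t, c x ∈ F)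
    (hdF : ∀ᶠ x in 𝓝 u, d x ∈ F) (hcp : c t = p) (hdp : d u = p)
    (hvw : LinearIndependent ℝ ![v, w]) {η : E4 [⋀^Fin 2]→L[ℝ] ℝ}
    (hη : ∃ v' ∈ tangentPlane F p, ∃ w' ∈ tangentPlane F p, η ![v', w'] ≠ 0) :
    η ![v, w] ≠ 0 := by
  obtain ⟨W, hfin, hWT, hWc⟩ := exists_tangent_bound hF (p := p) (hcp ▸ hcF.self_of_nhds)
  have hv := hWc hc hcF hcp
  have hw := hWc hd hdF hdp
  obtain ⟨v', hv', w', hw', hne⟩ := hη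
  obtain ⟨a, b, rfl⟩ := exists_pair_of_finrank_le hfin hv hw hvw (hWT v' hv')
  obtain ⟨a', b', rfl⟩ := exists_pair_of_finrank_le hfin hv hw hvw (hWT w' hw')
  rw [twoForm_pair] at hne
  exact right_ne_zero_of_mul hne

end Tangent
end FourGenus

namespace FourGenus

open scoped ContDiff Manifold
open Topology

/-! ### The sign of a two-form near the band -/

section Frame

/-- The first coordinate direction of the band. -/
noncomputable def frameX : E3 × ℝ := (EuclideanSpace.single 0 1, 0)
/-- The second coordinate direction of the band. -/
noncomputable def frameY : E3 × ℝ := (EuclideanSpace.single 1 1, 0)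
/-- The radial direction. -/
noncomputable def frameR : E3 × ℝ := (0, 1)

lemma eq_frame_sum {u : E3 × ℝ} (hu : u.1 2 = 0) :
    u = u.1 0 • frameX + u.1 1 • frameY + u.2 • frameR := by
  refine Prod.ext ?_ ?_
  · ext i
    fin_cases i <;> simp [frameX, frameY, frameR, hu]
  · simp [frameX, frameY, frameR]

/-- The contraction of a two-form with the gradient of the equation, in cone coordinates. -/
noncomputable def bandForm (ψ : OpenPartialHomeomorph S3 E3) (s g : ℝ → ℝ)
    (η : E4 → E4 [⋀^Fin 2]→L[ℝ] ℝ) (w : E3 × ℝ) : ℝ :=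
  fderiv ℝ (levelFun s g) w frameX * η ((coneChart ψ).symm w)
    ![fderiv ℝ (coneChart ψ).symm w frameY, fderiv ℝ (coneChart ψ).symm w frameR] +
  fderiv ℝ (levelFun s g) w frameY * η ((coneChart ψ).symm w)
    ![fderiv ℝ (coneChart ψ).symm w frameR, fderiv ℝ (coneChart ψ).symm w frameX] +
  fderiv ℝ (levelFun s g) w frameR * η ((coneChart ψ).symm w)
    ![fderiv ℝ (coneChart ψ).symm w frameX, fderiv ℝ (coneChart ψ).symm w frameY]

/-- The cross product of two vectors orthogonal to `q ≠ 0` is a multiple of `q`, so a vector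
orthogonal to `q` is orthogonal to it. -/
lemma cross_mul_eq {q0 q1 q2 a b c a' b' c' N0 N1 N2 : ℝ} (h : q0 * a + q1 * b + q2 * c = 0)
    (h' : q0 * a' + q1 * b' + q2 * c' = 0) (hq : q0 * N0 + q1 * N1 + q2 * N2 = 0)
    (hne : q1 ≠ 0 ∨ q0 ≠ 0 ∨ q2 ≠ 0) :
    (b * c' - c * b') * N0 + (c * a' - a * c') * N1 + (a * b' - b * a') * N2 = 0 := by
  rcases hne with hne | hne | hne
  · refine mul_left_cancel₀ hne ?_
    rw [mul_zero]
    linear_combination (c * a' - a * c') * hq + (c' * N0 - a' * N2) * h - (c * N0 - a * N2) * h'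
  · refine mul_left_cancel₀ hne ?_
    rw [mul_zero]
    linear_combination (b * c' - c * b') * hq + (b' * N2 - c' * N1) * h - (b * N2 - c * N1) * h'
  · refine mul_left_cancel₀ hne ?_
    rw [mul_zero]
    linear_combination (a * b' - b * a') * hq + (a' * N1 - b' * N0) * h - (a * N1 - b * N0) * h'

end Frame

namespace SwapSetting

variable {K : Knot} {ψ : OpenPartialHomeomorph S3 E3} {g : ℝ → ℝ} {a b : ℝ}
  {s τ : ℝ → ℝ} {e z δ : ℝ} {F : Set E4} (h : SwapSetting K ψ g a b s τ e z F)

include h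

/-- With `Q` the level function, `bandForm` is the value of `dQ ∧ η` on the frame. If it vanished,
`η` would vanish on the vectors in `ker dQ` without third band component, hence on the tangent
plane. -/
lemma bandForm_ne_zero {η : E4 → E4 [⋀^Fin 2]→L[ℝ] ℝ} {p : E4}
    (hp : p ∈ swapSurface K ψ g s e F) (hps : p ∈ (coneChart ψ).source) (hpn : 1 - 2 * e < ‖p‖)
    (hη : ∃ v ∈ tangentPlane (swapSurface K ψ g s e F) p,
      ∃ w ∈ tangentPlane (swapSurface K ψ g s e F) p, η p ![v, w] ≠ 0) :
    bandForm ψ s g η (coneChart ψ p) ≠ 0 := by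
  have hs := contDiffOn_coneChart h.band.smooth
  have hs' := contDiffOn_coneChart_symm h.band.smooth
  have hd := chart_hasFDerivAt hs hps
  have hpn1 : ‖p‖ ≤ 1 := mem_closedBall_zero_iff.1 (h.subset_ball hp)
  have hQ := contDiff_levelFun h.sweep.contDiff h.profile.contDiff
  have hev : ∀ᶠ q in 𝓝 p, q ∈ swapSurface K ψ g s e F →
      levelFun s g (coneChart ψ q) = 0 ∧ (coneChart ψ q).1 2 = 0 := by
    filter_upwards [(coneChart ψ).open_source.mem_nhds hps,
      (isOpen_lt continuous_const continuous_norm).mem_nhds hpn] with q h2 h3 hq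
    exact (h.mem_iff_level h3 (mem_closedBall_zero_iff.1 (h.subset_ball hq)) h2.2).1 hq
  have htan : ∀ v ∈ tangentPlane (swapSurface K ψ g s e F) p,
      fderiv ℝ (levelFun s g) (coneChart ψ p) (fderiv ℝ (coneChart ψ) p v) = 0 ∧
      (fderiv ℝ (coneChart ψ) p v).1 2 = 0 := by
    intro v hv
    refine ⟨tangentPlane_le_ker ((hQ.differentiable (by simp) _).hasFDerivAt.comp p hd) (c := 0)
      (hev.mono fun q hq hqF => (hq hqF).1) hv, ?_⟩
    exact tangentPlane_le_ker ((hasFDerivAt_coord 2 (coneChart ψ p)).comp p hd) (c := 0)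
      (hev.mono fun q hq hqF => (hq hqF).2) hv
  obtain ⟨v, hv, w, hw, hne⟩ := hη
  have hexp : ∀ v ∈ tangentPlane (swapSurface K ψ g s e F) p, ∃ x y r : ℝ,
      fderiv ℝ (levelFun s g) (coneChart ψ p) frameX * x +
        fderiv ℝ (levelFun s g) (coneChart ψ p) frameY * y +
        fderiv ℝ (levelFun s g) (coneChart ψ p) frameR * r = 0 ∧
      v = x • fderiv ℝ (coneChart ψ).symm (coneChart ψ p) frameX +
        y • fderiv ℝ (coneChart ψ).symm (coneChart ψ p) frameY +
        r • fderiv ℝ (coneChart ψ).symm (coneChart ψ p) frameR := by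
    intro v hv
    obtain ⟨h1, h2⟩ := htan v hv
    obtain ⟨x, y, r, h3⟩ : ∃ x y r : ℝ, fderiv ℝ (coneChart ψ) p v =
      x • frameX + y • frameY + r • frameR := ⟨_, _, _, eq_frame_sum h2⟩
    refine ⟨x, y, r, ?_, ?_⟩
    · rw [h3, map_add, map_add, map_smul, map_smul, map_smul] at h1
      simp only [smul_eq_mul] at h1
      linarith
    · rw [← map_smul, ← map_smul, ← map_smul, ← map_add, ← map_add, ← h3]
      exact (chart_fderiv_symm_apply hs hs' hps v).symm
  obtain ⟨x, y, r, hv1, rfl⟩ := hexp v hv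
  obtain ⟨x', y', r', hw1, rfl⟩ := hexp w hw
  intro h0
  refine hne ?_
  rw [twoForm_triple]
  rw [bandForm, (coneChart ψ).left_inv hps] at h0
  refine cross_mul_eq hv1 hw1 h0 ?_
  have hpQ := (h.mem_iff_level hpn hpn1 hps.2).1 hp
  simp only [fderiv_levelFun_apply h.sweep.contDiff h.profile.contDiff]
  rcases h.regular (x := (coneChart ψ p).1 0) (y := (coneChart ψ p).1 1) (r := (coneChart ψ p).2)
    hpQ.1 with h1 | h1 | ⟨-, h1⟩
  · left; simpa [frameY] using h1
  · right; left; simpa [frameX] using h1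
  · right; right; simpa [frameR] using h1

lemma continuousOn_bandForm (hδ : 0 < δ) (hT : bandBox δ ⊆ ψ.target)
    {η : E4 → E4 [⋀^Fin 2]→L[ℝ] ℝ} (hη : ContinuousOn η (swapSurface K ψ g s e F)) :
    Continuous (fun m : model s g e δ => bandForm ψ s g η (modelPoint m.1, 1 - m.1.2.2)) := by
  have hs' := contDiffOn_coneChart_symm h.band.smooth
  have hQ := contDiff_levelFun h.sweep.contDiff h.profile.contDiff
  have hmp : Continuous (fun m : ℝ × ℝ × ℝ => modelPoint m) := by
    unfold modelPoint; fun_prop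
  have hc1 : Continuous (fun m : model s g e δ => (modelPoint m.1, 1 - m.1.2.2)) :=
    (hmp.comp continuous_subtype_val).prodMk (by fun_prop)
  have hD : Continuous (fun m : model s g e δ =>
      fderiv ℝ (coneChart ψ).symm (modelPoint m.1, 1 - m.1.2.2)) :=
    (hs'.continuousOn_fderiv_of_isOpen (coneChart ψ).open_target (by simp)).comp_continuous hc1
      fun m => h.mem_target hδ hT m.2
  have hQc : Continuous (fun m : model s g e δ =>
      fderiv ℝ (levelFun s g) (modelPoint m.1, 1 - m.1.2.2)) :=
    (hQ.continuous_fderiv (by simp)).comp hc1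
  have hηc : Continuous (fun m : model s g e δ =>
      η ((coneChart ψ).symm (modelPoint m.1, 1 - m.1.2.2))) :=
    hη.comp_continuous ((coneChart ψ).symm.continuousOn.comp_continuous hc1 fun m =>
      h.mem_target hδ hT m.2) fun m => h.modelMap_mem hδ hT m.2
  have hfr : ∀ u v : E3 × ℝ, Continuous (fun m : model s g e δ =>
      η ((coneChart ψ).symm (modelPoint m.1, 1 - m.1.2.2))
        ![fderiv ℝ (coneChart ψ).symm (modelPoint m.1, 1 - m.1.2.2) u,
          fderiv ℝ (coneChart ψ).symm (modelPoint m.1, 1 - m.1.2.2) v]) := fun u v =>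
    continuousOn_univ.1 (continuousOn_twoForm hηc.continuousOn
      (hD.clm_apply continuous_const).continuousOn (hD.clm_apply continuous_const).continuousOn)
  have hq : ∀ u : E3 × ℝ, Continuous (fun m : model s g e δ =>
      fderiv ℝ (levelFun s g) (modelPoint m.1, 1 - m.1.2.2) u) := fun u =>
    hQc.clm_apply continuous_const
  exact (((hq _).mul (hfr _ _)).add ((hq _).mul (hfr _ _))).add ((hq _).mul (hfr _ _))

/-- The sign of the contraction is constant near the band. -/
lemma bandForm_mul_pos (hδ : 0 < δ) (hT : bandBox δ ⊆ ψ.target)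
    {η : E4 → E4 [⋀^Fin 2]→L[ℝ] ℝ} (hη : ContinuousOn η (swapSurface K ψ g s e F))
    (hη' : ∀ p ∈ swapSurface K ψ g s e F, ∃ v ∈ tangentPlane (swapSurface K ψ g s e F) p,
      ∃ w ∈ tangentPlane (swapSurface K ψ g s e F) p, η p ![v, w] ≠ 0) (m m' : model s g e δ) :
    0 < bandForm ψ s g η (modelPoint m.1, 1 - m.1.2.2) *
      bandForm ψ s g η (modelPoint m'.1, 1 - m'.1.2.2) := by
  have hne : ∀ m : model s g e δ, bandForm ψ s g η (modelPoint m.1, 1 - m.1.2.2) ≠ 0 := by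
    intro m
    have he := h.sweep.pos
    rw [← h.coneChart_modelMap hδ hT m.2]
    have hmem := h.modelMap_mem hδ hT m.2
    refine h.bandForm_ne_zero hmem ((coneChart ψ).map_target (h.mem_target hδ hT m.2)) ?_
      (hη' _ hmem)
    rw [h.norm_modelMap hδ hT m.2]
    linarith [m.2.2.2.2.1]
  have hc := h.continuousOn_bandForm hδ hT hη
  have : PathConnectedSpace (model s g e δ) :=
    { nonempty := ⟨m⟩, joined := model_joined h.sweep h.profile hδ }
  by_contra hcon
  have h0 : (0 : ℝ) ∈ Set.range
      (fun m : model s g e δ => bandForm ψ s g η (modelPoint m.1, 1 - m.1.2.2)) := by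
    have hcon' := lt_of_le_of_ne (not_lt.1 hcon) (mul_ne_zero (hne m) (hne m'))
    rcases mul_neg_iff.1 hcon' with ⟨h1, h2⟩ | ⟨h1, h2⟩
    · exact mem_range_of_exists_le_of_exists_ge hc ⟨m', h2.le⟩ ⟨m, h1.le⟩
    · exact mem_range_of_exists_le_of_exists_ge hc ⟨m, h1.le⟩ ⟨m', h2.le⟩
  obtain ⟨m₁, hm₁⟩ := h0
  exact hne m₁ hm₁

end SwapSetting
end FourGenus

namespace FourGenus

open scoped ContDiff Manifold
open Topology

/-! ### The knot in the band chart, and non-orientability -/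

section BandCurve

variable {K : Knot} {ψ : OpenPartialHomeomorph S3 E3}

lemma Knot.continuous_toFun (K : Knot) : Continuous K.toFun :=
  continuous_induced_rng.2 K.contDiff.continuous

lemma isOpen_band_times (K : Knot) (ψ : OpenPartialHomeomorph S3 E3) :
    IsOpen {t | K.toFun t ∈ ψ.source} :=
  ψ.open_source.preimage K.continuous_toFun

lemma contDiffOn_band_curve (hb : IsAttachedBand K ψ) :
    ContDiffOn ℝ ∞ (fun t => ψ (K.toFun t)) {t | K.toFun t ∈ ψ.source} := by
  have h1 : ContDiffOn ℝ ∞ (fun t => (coneChart ψ (K.curve t)).1) {t | K.toFun t ∈ ψ.source} := by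
    refine contDiff_fst.comp_contDiffOn ((contDiffOn_coneChart hb.smooth).comp
      K.contDiff_curve.contDiffOn fun t ht => ?_)
    refine ⟨K.curve_ne_zero t, ?_⟩
    change dir (K.toFun t : E4) ∈ ψ.source
    rw [dir_coe]; exact ht
  refine h1.congr fun t _ => ?_
  change _ = ψ (dir (K.toFun t : E4))
  rw [dir_coe]

/-- In the chart the knot satisfies `y (y - 1) = 0` and has vanishing third coordinate.
Differentiating leaves only the `x` component of the velocity. -/
lemma hasDerivAt_band_curve (hb : IsAttachedBand K ψ) {t : ℝ} (ht : K.toFun t ∈ ψ.source) :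
    HasDerivAt (fun u => ψ (K.toFun u)) (bandVelocity K ψ t • EuclideanSpace.single 0 1) t := by
  have hnhds := (isOpen_band_times K ψ).mem_nhds ht
  have h1 := ((contDiffOn_band_curve hb).contDiffAt hnhds).differentiableAt (by simp)
    |>.hasDerivAt
  have hco : ∀ i : Fin 3, HasDerivAt (fun u => ψ (K.toFun u) i)
      (deriv (fun u => ψ (K.toFun u)) t i) t := fun i =>
    (EuclideanSpace.proj (𝕜 := ℝ) i).hasFDerivAt.comp_hasDerivAt t h1
  have hmem := fun u (hu : K.toFun u ∈ ψ.source) => (hb.mem_knot_iff _ hu).1 ⟨u, rfl⟩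
  suffices heq : bandVelocity K ψ t • EuclideanSpace.single 0 1 =
      deriv (fun u => ψ (K.toFun u)) t by rw [heq]; exact h1
  ext i
  fin_cases i
  · simpa [bandVelocity] using (hco 0).deriv
  · have h2 := ((hco 1).mul ((hco 1).sub_const 1))
    have h3 : (fun u => ψ (K.toFun u) 1 * (ψ (K.toFun u) 1 - 1)) =ᶠ[𝓝 t] fun _ => 0 := by
      filter_upwards [hnhds] with u hu
      rcases (hmem u hu).1 with h | h <;> simp [h]
    have h4 := h2.unique ((hasDerivAt_const t (0 : ℝ)).congr_of_eventuallyEq h3)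
    have h5 : deriv (fun u => ψ (K.toFun u)) t 1 = 0 := by
      rcases (hmem t ht).1 with h | h <;> rw [h] at h4 <;> linarith
    simpa using h5.symm
  · have h3 : (fun u => ψ (K.toFun u) 2) =ᶠ[𝓝 t] fun _ => 0 := by
      filter_upwards [hnhds] with u hu using (hmem u hu).2
    have h4 := (hco 2).unique ((hasDerivAt_const t (0 : ℝ)).congr_of_eventuallyEq h3)
    simpa using h4.symm

lemma continuousOn_bandVelocity (hb : IsAttachedBand K ψ) :
    ContinuousOn (bandVelocity K ψ) {t | K.toFun t ∈ ψ.source} :=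
  ((EuclideanSpace.proj (𝕜 := ℝ) (0 : Fin 3)).contDiff.comp_contDiffOn
    (contDiffOn_band_curve hb)).continuousOn_deriv_of_isOpen (isOpen_band_times K ψ) (by simp)

/-- The point `r K(t)` has cone coordinates `(ψ (K t), r)`. Differentiating in `t` relates `frameX`
to the velocity of the knot; differentiating in `r` gives the analogous statement for `frameR`. -/
lemma fderiv_coneChart_symm_frameX (hb : IsAttachedBand K ψ) {t r : ℝ}
    (ht : K.toFun t ∈ ψ.source) (hr : 0 < r) :
    bandVelocity K ψ t • fderiv ℝ (coneChart ψ).symm (ψ (K.toFun t), r) frameX =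
      r • deriv K.curve t := by
  have hw : (ψ (K.toFun t), r) ∈ (coneChart ψ).target := ⟨ψ.map_source ht, hr⟩
  have h1 := chart_hasFDerivAt (φ := (coneChart ψ).symm) (contDiffOn_coneChart_symm hb.smooth) hw
  have h2 := h1.comp_hasDerivAt t ((hasDerivAt_band_curve hb ht).prodMk (hasDerivAt_const t r))
  have h3 : HasDerivAt (fun u => r • K.curve u) (r • deriv K.curve t) t :=
    ((K.contDiff_curve.differentiable (by simp) t).hasDerivAt).const_smul r
  have h4 : (coneChart ψ).symm ∘ (fun u => (ψ (K.toFun u), r)) =ᶠ[𝓝 t] fun u => r • K.curve u := by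
    filter_upwards [(isOpen_band_times K ψ).mem_nhds ht] with u hu
    change r • ((ψ.symm (ψ (K.toFun u)) : S3) : E4) = _
    rw [ψ.left_inv hu]; rfl
  have h5 := h2.unique (h3.congr_of_eventuallyEq h4)
  rw [← h5, ← map_smul]
  congr 1
  refine Prod.ext ?_ ?_ <;> simp [frameX]

lemma fderiv_coneChart_symm_frameR (hb : IsAttachedBand K ψ) {t r : ℝ}
    (ht : K.toFun t ∈ ψ.source) (hr : 0 < r) :
    fderiv ℝ (coneChart ψ).symm (ψ (K.toFun t), r) frameR = K.curve t := by
  have hw : (ψ (K.toFun t), r) ∈ (coneChart ψ).target := ⟨ψ.map_source ht, hr⟩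
  have h1 := chart_hasFDerivAt (φ := (coneChart ψ).symm) (contDiffOn_coneChart_symm hb.smooth) hw
  have h2 := h1.comp_hasDerivAt r ((hasDerivAt_const r (ψ (K.toFun t))).prodMk (hasDerivAt_id r))
  have h3 : HasDerivAt (fun u : ℝ => u • K.curve t) (K.curve t) r := by
    simpa using (hasDerivAt_id r).smul_const (K.curve t)
  refine h2.unique (h3.congr_of_eventuallyEq (Filter.Eventually.of_forall fun u => ?_))
  change u • ((ψ.symm (ψ (K.toFun t)) : S3) : E4) = _
  rw [ψ.left_inv ht]; rfl

lemma bandVelocity_ne_zero (hb : IsAttachedBand K ψ) {t : ℝ} (ht : K.toFun t ∈ ψ.source) :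
    bandVelocity K ψ t ≠ 0 := by
  intro h0
  have := fderiv_coneChart_symm_frameX hb ht one_pos
  rw [h0, zero_smul, one_smul] at this
  exact K.deriv_ne_zero t this.symm

/-- The velocity of a curve on the sphere is orthogonal to the radius. -/
lemma Knot.linearIndependent_curve (K : Knot) (t : ℝ) {r : ℝ} (hr : r ≠ 0) :
    LinearIndependent ℝ ![r • deriv K.curve t, K.curve t] := by
  have hd := (K.contDiff_curve.differentiable (by simp) t).hasDerivAt
  have h1 := hd.inner ℝ hd
  have h2 : (fun u => inner ℝ (K.curve u) (K.curve u)) = fun _ => (1 : ℝ) := by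
    funext u
    rw [real_inner_self_eq_norm_sq, K.norm_curve, one_pow]
  rw [h2] at h1
  have h3 := h1.unique (hasDerivAt_const t (1 : ℝ))
  rw [real_inner_comm (K.curve t)] at h3
  have h4 : inner ℝ (K.curve t) (deriv K.curve t) = 0 := by linarith
  rw [LinearIndependent.pair_iff]
  intro x y hxy
  have hy : y = 0 := by
    have := congrArg (fun v => inner ℝ (K.curve t) v) hxy
    simpa [inner_add_right, inner_smul_right, h4, real_inner_self_eq_norm_sq, K.norm_curve]
      using this
  subst hy
  rw [zero_smul, add_zero, smul_smul] at hxy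
  have := (smul_eq_zero.1 hxy).resolve_right (K.deriv_ne_zero t)
  exact ⟨(mul_eq_zero.1 this).resolve_right hr, rfl⟩

end BandCurve

namespace SwapSetting

variable {K : Knot} {ψ : OpenPartialHomeomorph S3 E3} {g : ℝ → ℝ} {a b : ℝ}
  {s τ : ℝ → ℝ} {e z δ : ℝ} {F : Set E4} (h : SwapSetting K ψ g a b s τ e z F)

include h

lemma smul_curve_mem {t r : ℝ} (ht : K.toFun t ∉ bandSquare ψ) (h1 : 1 - 2 * e < r) (h2 : r ≤ 1) :
    r • K.curve t ∈ swapSurface K ψ g s e F := by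
  have he := h.lt
  have hr : 0 < r := by linarith
  have hn : ‖r • K.curve t‖ = r := by
    rw [norm_smul, K.norm_curve, mul_one, Real.norm_of_nonneg hr.le]
  rw [h.mem_collar (by rw [hn]; exact h1) (by rw [hn]; exact h2)]
  change dir (r • (K.toFun t : E4)) ∈ _
  rw [dir_smul hr, mem_bandLevel_of_notMem ht]
  exact ⟨t, rfl⟩

lemma isOpen_off_band : IsOpen {t | K.toFun t ∉ bandSquare ψ} :=
  (isCompact_bandSquare h.band).isClosed.isOpen_compl.preimage K.continuous_toFun

/-- Near the ends of the band, the two ways to measure the sign of a two-form are related. -/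
lemma bandForm_of_off_band (η : E4 → E4 [⋀^Fin 2]→L[ℝ] ℝ) {t r : ℝ}
    (ht : K.toFun t ∈ ψ.source) (hx : ψ (K.toFun t) 0 < 0 ∨ 1 < ψ (K.toFun t) 0) (hr : 0 < r) :
    bandVelocity K ψ t * bandForm ψ s g η (ψ (K.toFun t), r) =
      - (4 * (2 * ψ (K.toFun t) 1 - 1)) *
        η (r • K.curve t) ![r • deriv K.curve t, K.curve t] := by
  -- Beyond the ends of the band the profile is constantly one, so only the `y` derivative `4 (2y -
  -- 1)` of the equation survives.
  have hg1 : g (ψ (K.toFun t) 0) = 1 := h.profile.eq_one _ (hx.imp le_of_lt le_of_lt)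
  have hg2 : deriv g (ψ (K.toFun t) 0) = 0 := by
    have : g =ᶠ[𝓝 (ψ (K.toFun t) 0)] fun _ => 1 := by
      rcases hx with hx | hx
      · filter_upwards [Iio_mem_nhds hx] with x hx using h.profile.eq_one x (.inl (le_of_lt hx))
      · filter_upwards [Ioi_mem_nhds hx] with x hx using h.profile.eq_one x (.inr (le_of_lt hx))
    rw [this.deriv_eq, deriv_const]
  have hp : (coneChart ψ).symm (ψ (K.toFun t), r) = r • K.curve t := by
    change r • ((ψ.symm (ψ (K.toFun t)) : S3) : E4) = _
    rw [ψ.left_inv ht]; rfl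
  rw [bandForm, hp, fderiv_coneChart_symm_frameR h.band ht hr,
    ← fderiv_coneChart_symm_frameX h.band ht hr, twoForm_smul_left, twoForm_swap _ (K.curve t)]
  simp only [fderiv_levelFun_apply h.sweep.contDiff h.profile.contDiff, hg1, hg2]
  simp [frameX, frameY, frameR]
  ring

/-- The changed surface is not orientable if the band is non-oriented. -/
theorem not_isOrientable (hno : IsNonOriented K ψ) : ¬ IsOrientable (swapSurface K ψ g s e F) := by
  rintro ⟨η, hη, hη'⟩
  have he := h.sweep.pos
  have he' := h.lt
  obtain ⟨δ, hδ, hT⟩ := exists_bandBox_subset ψ.open_target h.band.square_subset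
  obtain ⟨m₀, -⟩ := h.exists_rim_point (s := s) (g := g) (e := e) hδ
  set ω₀ := bandForm ψ s g η (modelPoint m₀.1, 1 - m₀.1.2.2) with hω₀
  set r := 1 - e / 2 with hr
  have hr0 : 0 < r := by linarith
  let S₁ : Set ℝ := {t | K.toFun t ∉ bandSquare ψ}
  let S₂ : Set ℝ := {t | K.toFun t ∈ ψ.source} ∩ (fun t => ψ (K.toFun t)) ⁻¹' bandBox δ
  -- `O` records the orientation of the pair (velocity, radius) along the parallel copy of the knot
  -- at depth `e / 2`, relative to the constant sign near the band. `B` records the same sign,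
  -- reversed, while the knot passes the band, where the copy need not lie in the surface.
  let O : ℝ → ℝ := fun t => η (r • K.curve t) ![r • deriv K.curve t, K.curve t] * ω₀
  let B : ℝ → ℝ := fun t => bandVelocity K ψ t * (2 * ψ (K.toFun t) 1 - 1)
  have hS₁ : IsOpen S₁ := h.isOpen_off_band
  have hψc : ContinuousOn (fun t => ψ (K.toFun t)) {t | K.toFun t ∈ ψ.source} :=
    (contDiffOn_band_curve h.band).continuousOn
  have hS₂ : IsOpen S₂ := hψc.isOpen_inter_preimage (isOpen_band_times K ψ) (isOpen_bandBox δ)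
  have hS : ∀ t, t ∈ S₁ ∨ t ∈ S₂ := fun t => by
    by_cases ht : K.toFun t ∈ bandSquare ψ
    · exact .inr ⟨ht.1, flatSquare_subset_bandBox hδ ht.2⟩
    · exact .inl ht
  have hω₀ne : ω₀ ≠ 0 := by
    have := h.bandForm_mul_pos hδ hT hη hη' m₀ m₀
    exact left_ne_zero_of_mul this.ne'
  have hcγ := K.contDiff_curve.continuous
  have hO : ContinuousOn O S₁ := by
    refine ContinuousOn.mul ?_ continuousOn_const
    refine continuousOn_twoForm (hη.comp (hcγ.const_smul r).continuousOn fun t ht =>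
      h.smul_curve_mem ht (by linarith) (by linarith)) ?_ hcγ.continuousOn
    exact ((K.contDiff_curve.continuous_deriv (by simp)).const_smul r).continuousOn
  have hB : ContinuousOn B S₂ :=
    ((continuousOn_bandVelocity h.band).mono fun t ht => ht.1).mul
      ((continuousOn_const.mul (((EuclideanSpace.proj (𝕜 := ℝ) (1 : Fin 3)).continuous.comp_continuousOn
        hψc).mono fun t ht => ht.1)).sub continuousOn_const)
  have hOne : ∀ t ∈ S₁, O t ≠ 0 := by
    intro t ht
    refine mul_ne_zero ?_ hω₀ne
    refine twoForm_ne_zero_of_curves h.isProperSurface (p := r • K.curve t)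
      (c := fun u => r • K.curve u) (d := fun u => u • K.curve t) (t := t) (u := r)
      (((K.contDiff_curve.differentiable (by simp) t).hasDerivAt).const_smul r)
      (by simpa using (hasDerivAt_id r).smul_const (K.curve t)) ?_ ?_ rfl rfl
      (K.linearIndependent_curve t hr0.ne') (hη' _ (h.smul_curve_mem ht (by linarith)
        (by linarith)))
    · filter_upwards [hS₁.mem_nhds ht] with u hu
      exact h.smul_curve_mem hu (by linarith) (by linarith)
    · filter_upwards [Ioo_mem_nhds (show 1 - 2 * e < r by linarith) (show r < 1 by linarith)]
        with u hu
      exact h.smul_curve_mem ht hu.1 hu.2.le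
  have hY : ∀ t ∈ S₂, (2 * ψ (K.toFun t) 1 - 1) ^ 2 = 1 := by
    intro t ht
    rcases ((h.band.mem_knot_iff _ ht.1).1 ⟨t, rfl⟩).1 with h1 | h1 <;> rw [h1] <;> norm_num
  have hBne : ∀ t ∈ S₂, B t ≠ 0 := fun t ht => by
    refine mul_ne_zero (bandVelocity_ne_zero h.band ht.1) fun h0 => ?_
    have := hY t ht
    rw [h0] at this
    norm_num at this
  have hOB : ∀ t ∈ S₁, t ∈ S₂ → O t * B t < 0 := by
    intro t ht ht2
    have hK := (h.band.mem_knot_iff _ ht2.1).1 ⟨t, rfl⟩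
    have hx : ψ (K.toFun t) 0 < 0 ∨ 1 < ψ (K.toFun t) 0 := by
      by_contra hcon
      push Not at hcon
      refine ht ⟨ht2.1, hcon, ?_, hK.2⟩
      rcases hK.1 with h1 | h1 <;> rw [h1] <;> simp
    have hm : (ψ (K.toFun t) 0, 2 * ψ (K.toFun t) 1 - 1, e / 2) ∈ model s g e δ := by
      refine ⟨ht2.2.1.1, ht2.2.1.2, by change 0 ≤ e / 2; linarith,
        by change e / 2 < 3 * e / 2; linarith, ?_⟩
      simp [hY t ht2, h.profile.eq_one _ (hx.imp le_of_lt le_of_lt)]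
    have hpos := h.bandForm_mul_pos hδ hT hη hη' ⟨_, hm⟩ m₀
    have hmp : modelPoint (ψ (K.toFun t) 0, 2 * ψ (K.toFun t) 1 - 1, e / 2) = ψ (K.toFun t) := by
      ext i
      fin_cases i
      · rfl
      · change (2 * ψ (K.toFun t) 1 - 1 + 1) / 2 = ψ (K.toFun t) 1
        ring
      · exact hK.2.symm
    simp only [hmp, ← hω₀] at hpos
    have hrel := h.bandForm_of_off_band η ht2.1 hx hr0
    change (η (r • K.curve t) ![r • deriv K.curve t, K.curve t] * ω₀) *
      (bandVelocity K ψ t * (2 * ψ (K.toFun t) 1 - 1)) < 0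
    have hv := bandVelocity_ne_zero h.band ht2.1
    have hv2 : 0 < bandVelocity K ψ t ^ 2 := by positivity
    have : (η (r • K.curve t) ![r • deriv K.curve t, K.curve t] * ω₀) *
      (bandVelocity K ψ t * (2 * ψ (K.toFun t) 1 - 1)) =
      - (bandVelocity K ψ t ^ 2 * (bandForm ψ s g η (ψ (K.toFun t), r) * ω₀)) / 4 := by
      linear_combination (ω₀ * bandVelocity K ψ t / 4) * hrel
    rw [this]
    have := mul_pos hv2 hpos
    linarith
  -- Opposite signs of `O` and `B` on the overlap make `D` and `D'` two disjoint open sets that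
  -- cover the line.
  let D : Set ℝ := (S₁ ∩ O ⁻¹' Set.Ioi 0) ∪ (S₂ ∩ B ⁻¹' Set.Iio 0)
  let D' : Set ℝ := (S₁ ∩ O ⁻¹' Set.Iio 0) ∪ (S₂ ∩ B ⁻¹' Set.Ioi 0)
  have hD : IsOpen D := (hO.isOpen_inter_preimage hS₁ isOpen_Ioi).union
    (hB.isOpen_inter_preimage hS₂ isOpen_Iio)
  have hD' : IsOpen D' := (hO.isOpen_inter_preimage hS₁ isOpen_Iio).union
    (hB.isOpen_inter_preimage hS₂ isOpen_Ioi)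
  have hcov : ∀ t, t ∈ D ∪ D' := by
    intro t
    rcases hS t with ht | ht
    · rcases (hOne t ht).lt_or_gt with h1 | h1
      · exact .inr (.inl ⟨ht, h1⟩)
      · exact .inl (.inl ⟨ht, h1⟩)
    · rcases (hBne t ht).lt_or_gt with h1 | h1
      · exact .inl (.inr ⟨ht, h1⟩)
      · exact .inr (.inr ⟨ht, h1⟩)
  have hdisj : ∀ t, ¬ (t ∈ D ∧ t ∈ D') := by
    rintro t ⟨⟨h1, h2⟩ | ⟨h1, h2⟩, ⟨h3, h4⟩ | ⟨h3, h4⟩⟩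
    · exact lt_asymm (a := O t) (b := 0) h4 h2
    · exact lt_asymm (hOB t h1 h3) (mul_pos h2 h4)
    · exact lt_asymm (hOB t h3 h1) (mul_pos_of_neg_of_neg h4 h2)
    · exact lt_asymm (a := B t) (b := 0) h2 h4
  have hedge : ∀ c : ℝ, c = 0 ∨ c = 1 → ∃ t, OnEdge K ψ c t := by
    intro c hc
    have hflat : (!₂[1 / 2, c, 0] : E3) ∈ flatSquare := by
      refine ⟨⟨?_, ?_⟩, ?_, rfl⟩
      · change (0 : ℝ) ≤ 1 / 2; norm_num
      · change (1 / 2 : ℝ) ≤ 1; norm_num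
      · change c ∈ Set.Icc (0 : ℝ) 1
        rcases hc with rfl | rfl <;> simp
    have htar := h.band.square_subset hflat
    have hsrc := ψ.map_target htar
    have hinv := ψ.right_inv htar
    obtain ⟨t, ht⟩ : ψ.symm !₂[1 / 2, c, 0] ∈ K.carrier := by
      rw [h.band.mem_knot_iff _ hsrc, hinv]
      exact ⟨hc, rfl⟩
    refine ⟨t, ?_, ?_, ?_⟩ <;> rw [ht]
    · exact hsrc
    · rwa [hinv]
    · rw [hinv]; rfl
  obtain ⟨t₀, ht₀⟩ := hedge 0 (.inl rfl)
  obtain ⟨t₁, ht₁⟩ := hedge 1 (.inr rfl)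
  have h₀ : t₀ ∈ S₂ := ⟨ht₀.1, flatSquare_subset_bandBox hδ ht₀.2.1⟩
  have h₁ : t₁ ∈ S₂ := ⟨ht₁.1, flatSquare_subset_bandBox hδ ht₁.2.1⟩
  have hB₀ : B t₀ = - bandVelocity K ψ t₀ := by
    change _ * (2 * ψ (K.toFun t₀) 1 - 1) = _
    rw [ht₀.2.2]; ring
  have hB₁ : B t₁ = bandVelocity K ψ t₁ := by
    change _ * (2 * ψ (K.toFun t₁) 1 - 1) = _
    rw [ht₁.2.2]; ring
  -- The factor `2y - 1` has opposite signs on the two edges, while a non-oriented band has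
  -- velocities of equal sign there. So `B` takes both signs, contradicting connectedness.
  have hne : D.Nonempty ∧ D'.Nonempty := by
    rcases hno with ⟨hp, hq⟩ | ⟨hp, hq⟩
    · refine ⟨⟨t₀, .inr ⟨h₀, ?_⟩⟩, ⟨t₁, .inr ⟨h₁, ?_⟩⟩⟩
      · change B t₀ < 0
        rw [hB₀]; linarith [hp t₀ ht₀]
      · change 0 < B t₁
        rw [hB₁]; exact hq t₁ ht₁
    · refine ⟨⟨t₁, .inr ⟨h₁, ?_⟩⟩, ⟨t₀, .inr ⟨h₀, ?_⟩⟩⟩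
      · change B t₁ < 0
        rw [hB₁]; exact hq t₁ ht₁
      · change 0 < B t₀
        rw [hB₀]; linarith [hp t₀ ht₀]
  obtain ⟨t, -, ht⟩ := isPreconnected_univ D D' hD hD' (fun t _ => hcov t)
    (by simpa using hne.1) (by simpa using hne.2)
  exact hdisj t ht

end SwapSetting
end FourGenus

namespace FourGenus

open scoped ContDiff Manifold unitInterval
open Topology

/-! ### Lifting to double covers -/

section Lift

variable {X E Q : Type} [TopologicalSpace X] [TopologicalSpace E] [TopologicalSpace Q]
  [MulAction ℤˣ E] {p : E → Q}

/-- A map to the base of a double covering lifts if there are no non-trivial path cocycles. -/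
theorem exists_lift_of_isCoboundary (hp : IsQuotientCoveringMap p ℤˣ) [PathConnectedSpace X]
    [LocallyPathConnectedSpace X] (hX : ∀ c : PathCocycle X, c.IsCoboundary) (h : C(X, Q)) :
    ∃ w : C(X, E), ∀ x, p (w x) = h x := by
  have cov := hp.isCoveringMap
  choose w₀ hw₀ using fun x => hp.surjective (h x)
  let ε : ∀ x, p ⁻¹' {h x} := fun x => ⟨w₀ x, hw₀ x⟩
  let M : ∀ {x y : X}, Path x y → p ⁻¹' {h x} → p ⁻¹' {h y} := fun γ =>
    cov.monodromy (Path.Homotopic.Quotient.mk (γ.map h.continuous))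
  have hex : ∀ (x y : X) (γ : Path x y), ∃ k : ℤˣ, hp.toPermFiber (h y) k (ε y) = M γ (ε x) :=
    fun x y γ => hp.exists_toPermFiber_eq _ _
  -- `d` is the sign by which transport along a path differs from the arbitrary choice of fibre
  -- points. It is multiplicative and homotopy invariant, hence a cocycle.
  choose d hd using hex
  have hinj : ∀ x (k l : ℤˣ), hp.toPermFiber (h x) k (ε x) = hp.toPermFiber (h x) l (ε x) → k = l :=
    fun x k l hkl => hp.toPermFiber_ext _ _ hkl
  have hdt : ∀ {x y z : X} (γ : Path x y) (γ' : Path y z),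
      d x z (γ.trans γ') = d x y γ * d y z γ' := by
    intro x y z γ γ'
    refine hinj z _ _ ?_
    rw [hd]
    change cov.monodromy _ _ = _
    rw [Path.map_trans, Path.Homotopic.Quotient.mk_trans, cov.monodromy_trans_apply]
    change cov.monodromy _ (M γ (ε x)) = _
    rw [← hd, hp.monodromy_toPermFiber]
    change hp.toPermFiber (h z) _ (M γ' (ε y)) = _
    rw [← hd, map_mul]
    rfl
  have hdh : ∀ {x y : X} (γ γ' : Path x y), γ.Homotopic γ' → d x y γ = d x y γ' := by
    intro x y γ γ' hγ
    refine hinj y _ _ ?_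
    rw [hd, hd]
    change cov.monodromy _ _ = cov.monodromy _ _
    rw [Path.Homotopic.Quotient.eq.2 (hγ.map h)]
  let c : PathCocycle X :=
    { toFun := fun x y γ => if d x y γ = 1 then 0 else 1
      map_trans := by
        intro x y z γ γ'
        rw [hdt]
        rcases Int.units_eq_one_or (d x y γ) with h1 | h1 <;>
        rcases Int.units_eq_one_or (d y z γ') with h2 | h2 <;> rw [h1, h2] <;> decide
      map_homotopic := fun x y γ γ' hγ => by rw [hdh γ γ' hγ] }
  obtain ⟨f, hf⟩ := hX c
  -- A coboundary depends only on the ends of a path. So lifted paths end at a point independent of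
  -- the path, as the lifting criterion demands.
  have hdeq : ∀ {x y : X} (γ γ' : Path x y), d x y γ = d x y γ' := by
    intro x y γ γ'
    have h1 : (if d x y γ = 1 then (0 : ZMod 2) else 1) = if d x y γ' = 1 then 0 else 1 :=
      (hf γ).trans (hf γ').symm
    rcases Int.units_eq_one_or (d x y γ) with h2 | h2 <;>
    rcases Int.units_eq_one_or (d x y γ') with h3 | h3 <;> rw [h2, h3] at h1 ⊢ <;>
    revert h1 <;> decide
  obtain ⟨x₀⟩ := PathConnectedSpace.nonempty (X := X)
  have hend : ∀ {y : X} (γ : Path x₀ y) (Γ : C(I, E)), Γ 0 = w₀ x₀ →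
      p ∘ Γ = h.comp γ.toContinuousMap → Γ 1 = (M γ (ε x₀)).1 := by
    intro y γ Γ h0 h1
    have h2 := (cov.eq_liftPath_iff' (γ := (γ.map h.continuous).toContinuousMap) (e := w₀ x₀)
      (by rw [hw₀]; simp)).2 ⟨h1, h0⟩
    rw [h2]
    rfl
  obtain ⟨w, hw, -⟩ := cov.isLocalHomeomorph.existsUnique_continuousMap_lifts
    h x₀ (w₀ x₀) (hw₀ x₀) (fun γ h0 => by
      obtain ⟨Γ, h1, h2⟩ := cov.exists_path_lifts (h.comp γ) (w₀ x₀) (by simp [h0, hw₀])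
      exact ⟨Γ, h2, h1⟩) (by
      intro γ γ' Γ Γ' h1 h2 h3 h4 h5 h6 h7
      let P : Path x₀ (γ' 1) := ⟨γ, h1, h7⟩
      let P' : Path x₀ (γ' 1) := ⟨γ', h2, rfl⟩
      rw [hend P Γ h3 h5, hend P' Γ' h4 h6, ← hd, ← hd, hdeq P P'])
  exact ⟨w, fun x => congrFun hw.2 x⟩

end Lift

/-! ### Continuous choice of a vector given up to sign -/

section DoubleCover

variable (W : Type) [NormedAddCommGroup W] [NormedSpace ℝ W]

/-- The non-zero vectors, with the action of the signs. -/
def nonzeroVectors : SubMulAction ℤˣ W where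
  carrier := {u | u ≠ 0}
  smul_mem' k u hu := by
    rcases Int.units_eq_one_or k with rfl | rfl
    · simpa using hu
    · simpa [Units.smul_def] using hu

lemma isQuotientCoveringMap_nonzeroVectors : IsQuotientCoveringMap
    (Quotient.mk (MulAction.orbitRel ℤˣ (nonzeroVectors W))) ℤˣ where
  toIsQuotientMap := isQuotientMap_quotient_mk'
  continuous_const_smul k := by
    refine Continuous.subtype_mk ?_ _
    exact (continuous_const_smul (k : ℤ)).comp continuous_subtype_val
  apply_eq_iff_mem_orbit := Quotient.eq''
  disjoint u := by
    refine ⟨{v | ‖v.1 - u.1‖ < ‖u.1‖}, ?_, ?_⟩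
    · refine (isOpen_lt (by fun_prop) continuous_const).mem_nhds ?_
      have hu : u.1 ≠ 0 := u.2
      simpa using hu
    · rintro k ⟨_, ⟨v, hv, rfl⟩, hv'⟩
      rcases Int.units_eq_one_or k with rfl | rfl
      · rfl
      · exfalso
        have h1 : ‖v.1 - u.1‖ < ‖u.1‖ := hv
        have h2 : ‖-v.1 - u.1‖ < ‖u.1‖ := by
          have : ‖((-1 : ℤˣ) • v.1 : W) - u.1‖ < ‖u.1‖ := hv'
          simpa [Units.smul_def] using this
        have h3 : (2 : ℝ) • u.1 = -(v.1 - u.1) - (-v.1 - u.1) := by rw [two_smul]; abel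
        have h4 := norm_sub_le (-(v.1 - u.1)) (-v.1 - u.1)
        rw [← h3, norm_smul, norm_neg] at h4
        norm_num at h4
        linarith

/-- A continuous family of lines with unit vectors given up to sign has a continuous section of
unit vectors if there are no non-trivial path cocycles. -/
theorem exists_continuous_section {X : Type} [TopologicalSpace X] [PathConnectedSpace X]
    [LocallyPathConnectedSpace X] (hX : ∀ c : PathCocycle X, c.IsCoboundary)
    (R : X → W → Prop) (hne : ∀ x u, R x u → u ≠ 0) (hneg : ∀ x u, R x u → R x (-u))
    (huniq : ∀ x u v, R x u → R x v → v = u ∨ v = -u)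
    (hloc : ∀ x, ∃ N ∈ 𝓝 x, ∃ u : X → W, ContinuousOn u N ∧ ∀ y ∈ N, R y (u y)) :
    ∃ u : C(X, W), ∀ x, R x (u x) := by
  choose N hN u hu huR using hloc
  let v : ∀ x, nonzeroVectors W := fun x =>
    ⟨u x x, hne x _ (huR x x (mem_of_mem_nhds (hN x)))⟩
  have hv : ∀ x, R x (v x).1 := fun x => huR x x (mem_of_mem_nhds (hN x))
  have hmk : ∀ a b : nonzeroVectors W, (b.1 = a.1 ∨ b.1 = -a.1) ↔
      Quotient.mk (MulAction.orbitRel ℤˣ (nonzeroVectors W)) b = Quotient.mk _ a := by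
    intro a b
    rw [Quotient.eq, MulAction.orbitRel_apply]
    constructor
    · rintro (hab | hab)
      · exact ⟨1, Subtype.ext (by simpa using hab.symm)⟩
      · refine ⟨-1, Subtype.ext ?_⟩
        rw [hab]
        change ((-1 : ℤˣ) • a.1 : W) = _
        simp [Units.smul_def]
    · rintro ⟨k, hk⟩
      have hk' : (k • a.1 : W) = b.1 := congrArg Subtype.val hk
      rcases Int.units_eq_one_or k with rfl | rfl
      · left; simpa using hk'.symm
      · right; rw [← hk']; simp [Units.smul_def]
  let h : X → Quotient (MulAction.orbitRel ℤˣ (nonzeroVectors W)) := fun x => Quotient.mk _ (v x)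
  have hh : Continuous h := by
    rw [continuous_iff_continuousAt]
    intro x
    have h1 : ContinuousOn h (N x) := by
      have h2 : Continuous (fun y : N x =>
          (⟨u x y, hne y _ (huR x y y.2)⟩ : nonzeroVectors W)) :=
        (continuousOn_iff_continuous_domRestrict.1 (hu x)).subtype_mk _
      rw [continuousOn_iff_continuous_domRestrict]
      refine (continuous_quotient_mk'.comp h2).congr fun y => ?_
      exact ((hmk _ _).1 (huniq y _ _ (huR x y y.2) (hv y))).symm
    exact h1.continuousAt (hN x)
  obtain ⟨w, hw⟩ := exists_lift_of_isCoboundary (isQuotientCoveringMap_nonzeroVectors W) hX ⟨h, hh⟩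
  refine ⟨⟨fun x => (w x).1, continuous_subtype_val.comp w.continuous⟩, fun x => ?_⟩
  rcases (hmk _ _).2 (hw x) with h1 | h1
  · change R x (w x).1
    rw [h1]; exact hv x
  · change R x (w x).1
    rw [h1]; exact hneg x _ (hv x)

end DoubleCover
end FourGenus

namespace FourGenus

open scoped ContDiff Manifold
open Topology

/-! ### Plücker coordinates of the tangent planes -/

section Plucker

/-- The Plücker coordinates of a pair of vectors. -/
def plucker (a b : E4) : Fin 4 → Fin 4 → ℝ := fun i j => a i * b j - a j * b i

lemma plucker_pair (a b : E4) (x y x' y' : ℝ) :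
    plucker (x • a + y • b) (x' • a + y' • b) = (x * y' - y * x') • plucker a b := by
  funext i j
  simp [plucker]
  ring

lemma linearIndependent_of_plucker_ne_zero {a b : E4} (h : plucker a b ≠ 0) :
    LinearIndependent ℝ ![a, b] := by
  rw [LinearIndependent.pair_iff]
  intro x y hxy
  have hc : ∀ i, x * a i + y * b i = 0 := fun i => by
    simpa using congrArg (fun v : E4 => v i) hxy
  have hx : x • plucker a b = 0 := by
    funext i j
    change x * (a i * b j - a j * b i) = 0
    linear_combination b j * hc i - b i * hc j
  have hy : y • plucker a b = 0 := by
    funext i j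
    change y * (a i * b j - a j * b i) = 0
    linear_combination a i * hc j - a j * hc i
  exact ⟨(smul_eq_zero.1 hx).resolve_right h, (smul_eq_zero.1 hy).resolve_right h⟩

lemma plucker_ne_zero {a b : E4} (h : LinearIndependent ℝ ![a, b]) : plucker a b ≠ 0 := by
  intro h0
  rw [LinearIndependent.pair_iff] at h
  have hc : ∀ i j, a i * b j - a j * b i = 0 := fun i j => congrFun (congrFun h0 i) j
  have ha : ∀ j, a j = 0 := by
    intro j
    refine neg_eq_zero.1 (h (b j) (-a j) ?_).2
    ext i
    simp only [PiLp.add_apply, PiLp.smul_apply, smul_eq_mul, PiLp.zero_apply]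
    linear_combination hc i j
  have := (h 1 0 (by
    ext i
    simp [ha i])).1
  norm_num at this

/-- An elementary two-form. -/
noncomputable def elementaryForm (i j : Fin 4) : E4 [⋀^Fin 2]→L[ℝ] ℝ where
  toFun m := m 0 i * m 1 j - m 0 j * m 1 i
  map_update_add' m k x y := by
    fin_cases k <;> simp [Function.update] <;> ring
  map_update_smul' m k c x := by
    fin_cases k <;> simp [Function.update] <;> ring
  cont := by fun_prop
  map_eq_zero_of_eq' m k l hkl hne := by
    have : m 0 = m 1 := by
      fin_cases k <;> fin_cases l
      · exact absurd rfl hne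
      · exact hkl
      · exact hkl.symm
      · exact absurd rfl hne
    change m 0 i * m 1 j - m 0 j * m 1 i = 0
    rw [this]; ring

/-- The two-form with given coefficients. -/
noncomputable def formOf (u : Fin 4 → Fin 4 → ℝ) : E4 [⋀^Fin 2]→L[ℝ] ℝ :=
  ∑ i, ∑ j, u i j • elementaryForm i j

lemma formOf_apply (u : Fin 4 → Fin 4 → ℝ) (a b : E4) :
    formOf u ![a, b] = ∑ i, ∑ j, u i j * plucker a b i j := by
  simp only [formOf, ContinuousAlternatingMap.sum_apply, ContinuousAlternatingMap.smul_apply]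
  rfl

lemma continuous_formOf : Continuous formOf := by
  unfold formOf
  refine continuous_finsetSum _ fun i _ => continuous_finsetSum _ fun j _ => ?_
  have h : Continuous (fun u : Fin 4 → Fin 4 → ℝ => u i j) := by fun_prop
  exact h.smul continuous_const

/-- Evaluated on its own pair, the form is `c` times the sum of the squares of the Plücker
coordinates. -/
lemma formOf_plucker_ne_zero {a b : E4} {c : ℝ} (h : c • plucker a b ≠ 0) :
    formOf (c • plucker a b) ![a, b] ≠ 0 := by
  have hc : c ≠ 0 := fun h0 => h (by rw [h0, zero_smul])
  have hp : plucker a b ≠ 0 := fun h0 => h (by rw [h0, smul_zero])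
  have h1 : formOf (c • plucker a b) ![a, b] = c * ∑ i, ∑ j, plucker a b i j ^ 2 := by
    rw [formOf_apply, Finset.mul_sum]
    refine Finset.sum_congr rfl fun i _ => ?_
    rw [Finset.mul_sum]
    refine Finset.sum_congr rfl fun j _ => ?_
    simp only [Pi.smul_apply, smul_eq_mul]
    ring
  rw [h1]
  refine mul_ne_zero hc fun h0 => hp ?_
  have h2 := (Finset.sum_eq_zero_iff_of_nonneg fun i _ =>
    Finset.sum_nonneg fun j _ => sq_nonneg (plucker a b i j)).1 h0
  funext i j
  have h3 := (Finset.sum_eq_zero_iff_of_nonneg fun j _ => sq_nonneg (plucker a b i j)).1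
    (h2 i (Finset.mem_univ i)) j (Finset.mem_univ j)
  exact pow_eq_zero_iff (two_ne_zero) |>.1 h3

/-- Normalized Plücker coordinates of the tangent plane. -/
def IsUnitPlucker (F : Set E4) (q : E4) (u : Fin 4 → Fin 4 → ℝ) : Prop :=
  ‖u‖ = 1 ∧ ∃ a ∈ tangentPlane F q, ∃ b ∈ tangentPlane F q, ∃ c : ℝ, u = c • plucker a b

lemma IsUnitPlucker.ne_zero {F : Set E4} {q : E4} {u : Fin 4 → Fin 4 → ℝ}
    (h : IsUnitPlucker F q u) : u ≠ 0 := by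
  rintro rfl
  simpa using h.1

lemma IsUnitPlucker.neg {F : Set E4} {q : E4} {u : Fin 4 → Fin 4 → ℝ}
    (h : IsUnitPlucker F q u) : IsUnitPlucker F q (-u) := by
  obtain ⟨h1, a, ha, b, hb, c, rfl⟩ := h
  exact ⟨by rwa [norm_neg], a, ha, b, hb, -c, (neg_smul _ _).symm⟩

/-- The tangent plane has dimension at most two, so all Plücker vectors of pairs in it are
proportional, and the unit norm fixes the factor up to sign. -/
lemma IsUnitPlucker.eq_or_eq_neg {F : Set E4} (hF : IsProperSurface F) {q : E4} (hq : q ∈ F)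
    {u v : Fin 4 → Fin 4 → ℝ} (hu : IsUnitPlucker F q u) (hv : IsUnitPlucker F q v) :
    v = u ∨ v = -u := by
  have hu0 := hu.ne_zero
  obtain ⟨h1, a, ha, b, hb, c, rfl⟩ := hu
  obtain ⟨h2, a', ha', b', hb', c', rfl⟩ := hv
  have hc : c ≠ 0 := fun h0 => hu0 (by rw [h0, zero_smul])
  have hp : plucker a b ≠ 0 := fun h0 => hu0 (by rw [h0, smul_zero])
  obtain ⟨W, hfin, hWT, -⟩ := exists_tangent_bound hF hq
  have hli := linearIndependent_of_plucker_ne_zero hp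
  obtain ⟨x, y, rfl⟩ := exists_pair_of_finrank_le hfin (hWT a ha) (hWT b hb) hli (hWT a' ha')
  obtain ⟨x', y', rfl⟩ := exists_pair_of_finrank_le hfin (hWT a ha) (hWT b hb) hli (hWT b' hb')
  rw [plucker_pair] at h2 ⊢
  obtain ⟨k, hk⟩ : ∃ k : ℝ, c' • (x * y' - y * x') • plucker a b = k • c • plucker a b :=
    ⟨c' * (x * y' - y * x') / c, by rw [smul_smul, smul_smul, div_mul_cancel₀ _ hc]⟩
  rw [hk] at h2 ⊢
  rw [norm_smul, h1, mul_one, Real.norm_eq_abs] at h2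
  rcases eq_or_eq_neg_of_abs_eq h2 with rfl | rfl
  · left; rw [one_smul]
  · right; rw [neg_smul, one_smul]

end Plucker

/-! ### Orientability of surfaces without first homology -/

section Local

variable {F : Set E4}

/-- The model of a surface near a boundary point. -/
def halfPlane : Set E4 := {x | 0 ≤ x 0 ∧ x 2 = 0 ∧ x 3 = 0}

lemma convex_halfPlane : Convex ℝ halfPlane := by
  rintro x ⟨hx0, hx2, hx3⟩ y ⟨hy0, hy2, hy3⟩ a b ha hb -
  refine ⟨?_, ?_, ?_⟩
  · simpa using add_nonneg (mul_nonneg ha hx0) (mul_nonneg hb hy0)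
  · simp [hx2, hy2]
  · simp [hx3, hy3]

/-- The half-plane is convex, so a vector pointing from `φ q` to another of its points lies in its
tangent cone; this also covers boundary points. -/
lemma fderiv_symm_mem_tangentPlane {φ : OpenPartialHomeomorph E4 E4}
    (h2 : ContDiffOn ℝ ∞ φ.symm φ.target)
    (h4 : ∀ x ∈ φ.source, x ∈ F ↔ 0 ≤ φ x 0 ∧ φ x 2 = 0 ∧ φ x 3 = 0) {q : E4}
    (hq : q ∈ φ.source) (hqF : q ∈ F) {v : E4} (hv : φ q + v ∈ halfPlane) :
    fderiv ℝ φ.symm (φ q) v ∈ tangentPlane F q := by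
  refine Submodule.subset_span ?_
  have hd := chart_hasFDerivAt (φ := φ.symm) h2 (φ.map_source hq)
  have h5 : v ∈ tangentConeAt ℝ (halfPlane ∩ φ.target) (φ q) := by
    rw [tangentConeAt_inter_nhds (φ.open_target.mem_nhds (φ.map_source hq))]
    have := mem_tangentConeAt_of_segment_subset (convex_halfPlane.segment_subset
      (show φ q ∈ halfPlane from (h4 q hq).1 hqF) hv)
    simpa using this
  have h6 := (hd.hasFDerivWithinAt (s := halfPlane ∩ φ.target)).mapsTo_tangent_cone h5
  rw [φ.left_inv hq] at h6
  refine tangentConeAt_mono ?_ h6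
  rintro _ ⟨x, ⟨hx1, hx2⟩, rfl⟩
  rw [h4 _ (φ.map_target hx2), φ.right_inv hx2]
  exact hx1

lemma exists_local_unitPlucker (hF : IsProperSurface F) (p : F) :
    ∃ N ∈ 𝓝 p, ∃ u : F → Fin 4 → Fin 4 → ℝ, ContinuousOn u N ∧
      ∀ q ∈ N, IsUnitPlucker F q.1 (u q) := by
  obtain ⟨φ, hp, h1, h2, -, h4⟩ := hF.chart p.1 p.2
  let N : Set F := Subtype.val ⁻¹' φ.source
  have hN : N ∈ 𝓝 p := (φ.open_source.preimage continuous_subtype_val).mem_nhds hp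
  let A : Fin 4 → F → E4 := fun i q => fderiv ℝ φ.symm (φ q.1) (EuclideanSpace.single i 1)
  have hA : ∀ i, ContinuousOn (A i) N := by
    intro i
    have h5 : ContinuousOn (fun q : F => fderiv ℝ φ.symm (φ q.1)) N :=
      (h2.continuousOn_fderiv_of_isOpen φ.open_target (by simp)).comp
        (φ.continuousOn.comp continuous_subtype_val.continuousOn fun q hq => hq)
        fun q hq => φ.map_source hq
    exact h5.clm_apply continuousOn_const
  have hmem : ∀ q ∈ N, A 0 q ∈ tangentPlane F q.1 ∧ A 1 q ∈ tangentPlane F q.1 := by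
    intro q hq
    obtain ⟨h5, h6, h7⟩ := (h4 q.1 hq).1 q.2
    refine ⟨fderiv_symm_mem_tangentPlane h2 h4 hq q.2 ⟨?_, ?_, ?_⟩,
      fderiv_symm_mem_tangentPlane h2 h4 hq q.2 ⟨?_, ?_, ?_⟩⟩
    · simp; linarith
    · simp [h6]
    · simp [h7]
    · simpa using h5
    · simp [h6]
    · simp [h7]
  have hli : ∀ q ∈ N, plucker (A 0 q) (A 1 q) ≠ 0 := by
    intro q hq
    refine plucker_ne_zero (LinearIndependent.pair_iff.2 fun x y hxy => ?_)
    have h5 : x • EuclideanSpace.single (0 : Fin 4) (1 : ℝ) +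
        y • EuclideanSpace.single (1 : Fin 4) (1 : ℝ) = (0 : E4) := by
      rw [← chart_fderiv_apply_symm h1 h2 hq (x • EuclideanSpace.single (0 : Fin 4) (1 : ℝ) +
        y • EuclideanSpace.single (1 : Fin 4) (1 : ℝ)), map_add, map_smul, map_smul]
      change fderiv ℝ φ q.1 (x • A 0 q + y • A 1 q) = 0
      rw [hxy, map_zero]
    exact ⟨by simpa using congrArg (fun v : E4 => v 0) h5,
      by simpa using congrArg (fun v : E4 => v 1) h5⟩
  refine ⟨N, hN, fun q => ‖plucker (A 0 q) (A 1 q)‖⁻¹ • plucker (A 0 q) (A 1 q), ?_, ?_⟩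
  · have hco : ∀ i k, ContinuousOn (fun q => A i q k) N := fun i k =>
      (EuclideanSpace.proj (𝕜 := ℝ) k).continuous.comp_continuousOn (hA i)
    have hP : ContinuousOn (fun q => plucker (A 0 q) (A 1 q)) N :=
      continuousOn_pi.2 fun i => continuousOn_pi.2 fun j =>
        ((hco 0 i).mul (hco 1 j)).sub ((hco 0 j).mul (hco 1 i))
    exact (hP.norm.inv₀ fun q hq => norm_ne_zero_iff.2 (hli q hq)).smul hP
  · intro q hq
    exact ⟨by
      rw [norm_smul, norm_inv, norm_norm, inv_mul_cancel₀ (norm_ne_zero_iff.2 (hli q hq))],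
      A 0 q, (hmem q hq).1, A 1 q, (hmem q hq).2, _, rfl⟩

/-- In a chart, the half-plane meets a small ball in a convex set. -/
lemma IsProperSurface.exists_isPathConnected_subset (hF : IsProperSurface F) (p : F) {t : Set F}
    (ht : t ∈ 𝓝 p) : ∃ r ∈ 𝓝 p, IsPathConnected r ∧ r ⊆ t := by
  obtain ⟨φ, hp, h1, h2, -, h4⟩ := hF.chart p.1 p.2
  obtain ⟨V, hV, hVt⟩ := mem_nhds_subtype F p t |>.1 ht
  have h5 : φ.target ∩ φ.symm ⁻¹' V ∈ 𝓝 (φ p.1) := by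
    refine Filter.inter_mem (φ.open_target.mem_nhds (φ.map_source hp)) ?_
    have hV' : V ∈ 𝓝 (φ.symm (φ p.1)) := by rwa [φ.left_inv hp]
    exact (φ.continuousAt_symm (φ.map_source hp)).preimage_mem_nhds hV'
  obtain ⟨ε, hε, hball⟩ := Metric.mem_nhds_iff.1 h5
  have hH : φ p.1 ∈ halfPlane := (h4 _ hp).1 p.2
  let B : Set E4 := halfPlane ∩ Metric.ball (φ p.1) ε
  have hB : IsPathConnected B := (convex_halfPlane.inter (convex_ball _ _)).isPathConnected
    ⟨φ p.1, hH, Metric.mem_ball_self hε⟩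
  have hBF : ∀ x ∈ B, φ.symm x ∈ F := fun x hx => by
    have hx' := (hball hx.2).1
    rw [h4 _ (φ.map_target hx'), φ.right_inv hx']
    exact hx.1
  let S : Set E4 := φ.source ∩ φ ⁻¹' Metric.ball (φ p.1) ε
  have hS : IsOpen S := φ.isOpen_inter_preimage Metric.isOpen_ball
  have hself : φ p.1 ∈ Metric.ball (φ p.1) ε := Metric.mem_ball_self hε
  have hpS : p.1 ∈ S := ⟨hp, hself⟩
  let r : Set F := Subtype.val ⁻¹' S
  have hrp : r ∈ 𝓝 p := (hS.preimage continuous_subtype_val).mem_nhds hpS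
  have hrt : r ⊆ t := by
    intro q hq
    have hq' : q.1 ∈ φ.source ∧ φ q.1 ∈ Metric.ball (φ p.1) ε := hq
    have := (hball hq'.2).2
    rw [Set.mem_preimage, φ.left_inv hq'.1] at this
    exact hVt this
  have hcB : Continuous (fun x : B => φ.symm x.1) :=
    φ.symm.continuousOn.comp_continuous continuous_subtype_val fun x => (hball x.2.2).1
  have hc : Continuous (fun x : B => (⟨φ.symm x.1, hBF x.1 x.2⟩ : F)) := hcB.subtype_mk _
  have : PathConnectedSpace B := isPathConnected_iff_pathConnectedSpace.1 hB
  have hr : r = Set.range (fun x : B => (⟨φ.symm x.1, hBF x.1 x.2⟩ : F)) := by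
    refine Set.Subset.antisymm (fun q hq => ?_) ?_
    · have hq' : q.1 ∈ φ.source ∧ φ q.1 ∈ Metric.ball (φ p.1) ε := hq
      exact ⟨⟨φ q.1, (h4 _ hq'.1).1 q.2, hq'.2⟩, Subtype.ext (φ.left_inv hq'.1)⟩
    · rintro _ ⟨x, rfl⟩
      have hx' := (hball x.2.2).1
      have hxS : φ (φ.symm x.1) ∈ Metric.ball (φ p.1) ε := by
        rw [φ.right_inv hx']; exact x.2.2
      exact ⟨φ.map_target hx', hxS⟩
  have hrc : IsPathConnected r := by
    rw [hr]
    exact isPathConnected_range hc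
  exact ⟨r, hrp, hrc, hrt⟩

lemma IsProperSurface.locallyPathConnectedSpace (hF : IsProperSurface F) :
    LocallyPathConnectedSpace F :=
  ⟨fun p => Filter.hasBasis_self.2 fun _ ht => hF.exists_isPathConnected_subset p ht⟩

/-- A surface with vanishing first Betti number is orientable. -/
theorem IsProperSurface.isOrientable_of_firstBetti_eq_zero (hF : IsProperSurface F)
    (h : firstBetti F = 0) : IsOrientable F := by
  have := hF.locallyPathConnectedSpace
  have : ConnectedSpace F := isConnected_iff_connectedSpace.1 hF.isConnected
  have : PathConnectedSpace F := pathConnectedSpace_iff_connectedSpace.2 inferInstance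
  -- The unit Plücker vectors form the orientation double cover. A continuous section supplies the
  -- coefficients of a nowhere vanishing two-form.
  obtain ⟨u, hu⟩ := exists_continuous_section (Fin 4 → Fin 4 → ℝ) (X := F)
    (isCoboundary_of_firstBetti_eq_zero h) (fun q u => IsUnitPlucker F q.1 u)
    (fun _ _ h => h.ne_zero) (fun _ _ h => h.neg) (fun q _ _ h h' => h.eq_or_eq_neg hF q.2 h')
    (exists_local_unitPlucker hF)
  classical
  refine ⟨fun q => if hq : q ∈ F then formOf (u ⟨q, hq⟩) else 0, ?_, fun q hq => ?_⟩
  · rw [continuousOn_iff_continuous_domRestrict]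
    refine (continuous_formOf.comp u.continuous).congr fun q => ?_
    simp [Set.domRestrict]
  · have h0 := (hu ⟨q, hq⟩).ne_zero
    obtain ⟨-, a, ha, b, hb, c, hc⟩ := hu ⟨q, hq⟩
    refine ⟨a, ha, b, hb, ?_⟩
    rw [hc] at h0
    simp only [dif_pos hq, hc]
    exact formOf_plucker_ne_zero h0

end Local
end FourGenus

namespace FourGenus

open scoped ContDiff Manifold
open Topology

/-! ### The two directions of the band move and the conclusion -/

section Main

variable {K K' : Knot} {F : Set E4}

lemma mem_coneOver_of_norm_pos {A : Set S3} {p : E4} (hp : 0 < ‖p‖) :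
    p ∈ coneOver A ↔ dir p ∈ A :=
  and_iff_right (norm_pos_iff.1 hp)

/-- The decreasing sweep starts from the knot `K'` inside the ball and reaches its surgery on the
sphere; a diffeomorphism of the ball then carries the surgery to `K`. -/
lemma exists_surface_of_bandMove (h : NonOrientedBandMove K' K) (hF : IsProperSurface F)
    (hK' : HasBoundary F K') : ∃ F' : Set E4, IsProperSurface F' ∧ ¬ IsOrientable F' ∧
      HasBoundary F' K ∧ firstBetti F' ≤ firstBetti F + 1 := by
  obtain ⟨ψ, g, a, b, hb, hno, hg, hiso⟩ := h
  obtain ⟨F₁, hF₁, hb₁, ε, hε, hcol⟩ := exists_conical hF hK'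
  obtain ⟨Φ, hΦ⟩ := exists_ballDiffeo_of_ambientIsotopic hiso
  obtain ⟨e, he, he1, he2⟩ : ∃ e : ℝ, 0 < e ∧ e < 1 / 4 ∧ 2 * e ≤ ε :=
    ⟨min (1 / 8) (ε / 2), by positivity, (min_le_left _ _).trans_lt (by norm_num),
      by linarith [min_le_right (1 / 8) (ε / 2)]⟩
  obtain ⟨s, τ, z, hs, hs0, hse⟩ := exists_decreasing_sweep he
  have S : SwapSetting K' ψ g a b s τ e z F₁ := ⟨hb, hg, hs, .inl hse, he1, hF₁, fun p h1 h2 => by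
    rw [hse, bandLevel_zero hb hg]
    exact hcol p (by linarith) h2⟩
  refine ⟨Φ.toHomeomorph '' swapSurface K' ψ g s e F₁, Φ.isProperSurface S.isProperSurface,
    fun ho => S.not_isOrientable hno (Φ.isOrientable ho), ?_, ?_⟩
  · have hsph := S.inter_sphere
    rw [hse, sub_zero, bandLevel_one] at hsph
    rw [HasBoundary]
    ext p
    have hmem : ∀ q : E4, ‖q‖ = 1 →
        (q ∈ swapSurface K' ψ g s e F₁ ↔ dir q ∈ bandSurgery K' ψ g) := by
      intro q hq
      have h1 : q ∈ swapSurface K' ψ g s e F₁ ↔ q ∈ Subtype.val '' bandSurgery K' ψ g := by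
        rw [← hsph]
        exact ⟨fun h => ⟨h, mem_sphere_zero_iff_norm.2 hq⟩, fun h => h.1⟩
      rw [h1]
      constructor
      · rintro ⟨θ, hθ, rfl⟩
        rwa [dir_coe]
      · intro h
        exact ⟨dir q, h, by rw [coe_dir (norm_pos_iff.1 (by rw [hq]; norm_num)), hq]; simp⟩
    have hK : p ∈ Subtype.val '' K.carrier ↔ ‖p‖ = 1 ∧ dir p ∈ K.carrier := by
      constructor
      · rintro ⟨θ, hθ, rfl⟩
        exact ⟨norm_coe_S3 θ, by rwa [dir_coe]⟩
      · rintro ⟨h1, h2⟩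
        exact ⟨dir p, h2, by rw [coe_dir (norm_pos_iff.1 (by rw [h1]; norm_num)), h1]; simp⟩
    rw [hK, Set.mem_inter_iff, mem_sphere_zero_iff_norm, and_comm]
    refine and_congr_right fun hp => ?_
    obtain ⟨q, rfl⟩ := Φ.toHomeomorph.surjective p
    rw [Φ.norm_map] at hp
    have hp' : ‖Φ.toHomeomorph q‖ = 1 := by rw [Φ.norm_map, hp]
    rw [Φ.toHomeomorph.injective.mem_set_image, hmem q hp,
      ← mem_coneOver_of_norm_pos (A := bandSurgery K' ψ g) (by rw [hp]; norm_num),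
      ← mem_coneOver_of_norm_pos (A := K.carrier) (by rw [hp']; norm_num)]
    exact (hΦ q (by rw [hp]; norm_num)).symm
  · rw [Φ.firstBetti_image, ← hb₁]
    exact S.firstBetti_le

/-- Here the band is attached to `K`. The surface is first carried back to bound the surgery on `K`,
and the increasing sweep undoes the surgery towards the sphere, so the isotopy acts before the swap.
-/
lemma exists_surface_of_reverse_bandMove (h : NonOrientedBandMove K K') (hF : IsProperSurface F)
    (hK' : HasBoundary F K') : ∃ F' : Set E4, IsProperSurface F' ∧ ¬ IsOrientable F' ∧
      HasBoundary F' K ∧ firstBetti F' ≤ firstBetti F + 1 := by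
  obtain ⟨ψ, g, a, b, hb, hno, hg, hiso⟩ := h
  obtain ⟨F₁, hF₁, hb₁, ε, hε, hcol⟩ := exists_conical hF hK'
  obtain ⟨Φ, hΦ⟩ := exists_ballDiffeo_of_ambientIsotopic hiso
  -- The bound `1/8` places the collar `‖p‖ > 1 - 2e` in the region `‖p‖ ≥ 3/4` where the
  -- diffeomorphism is conical.
  obtain ⟨e, he, he1, he2⟩ : ∃ e : ℝ, 0 < e ∧ e ≤ 1 / 8 ∧ 2 * e ≤ ε :=
    ⟨min (1 / 8) (ε / 2), by positivity, min_le_left _ _,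
      by linarith [min_le_right (1 / 8) (ε / 2)]⟩
  obtain ⟨s, τ, z, hs, hs0, hse⟩ := exists_increasing_sweep he
  have hF₂ : IsProperSurface (Φ.symm.toHomeomorph '' F₁) := Φ.symm.isProperSurface hF₁
  have S : SwapSetting K ψ g a b s τ e z (Φ.symm.toHomeomorph '' F₁) :=
    ⟨hb, hg, hs, .inr hse, by linarith, hF₂, fun p h1 h2 => by
      have hn := Φ.norm_map p
      have hpos : 0 < ‖p‖ := by linarith
      have himg : p ∈ Φ.symm.toHomeomorph '' F₁ ↔ Φ.toHomeomorph p ∈ F₁ := by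
        constructor
        · rintro ⟨q, hq, rfl⟩
          change Φ.toHomeomorph (Φ.toHomeomorph.symm q) ∈ F₁
          rwa [Homeomorph.apply_symm_apply]
        · exact fun hq => ⟨_, hq, Φ.toHomeomorph.symm_apply_apply p⟩
      rw [hse, bandLevel_one, himg, hcol _ (by rw [hn]; linarith) (by rw [hn]; exact h2),
        ← mem_coneOver_of_norm_pos (A := bandSurgery K ψ g) hpos,
        ← mem_coneOver_of_norm_pos (A := K'.carrier) (by rw [hn]; exact hpos)]
      exact hΦ p (by linarith)⟩
  refine ⟨swapSurface K ψ g s e (Φ.symm.toHomeomorph '' F₁), S.isProperSurface,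
    S.not_isOrientable hno, ?_, ?_⟩
  · rw [HasBoundary, S.inter_sphere, hse, sub_self, bandLevel_zero hb hg]
  · have := S.firstBetti_le
    rwa [Φ.symm.firstBetti_image, hb₁] at this

lemma exists_surface_of_related (h : RelatedByNonOrientedBandMove K K') (hF : IsProperSurface F)
    (hK' : HasBoundary F K') : ∃ F' : Set E4, IsProperSurface F' ∧ ¬ IsOrientable F' ∧
      HasBoundary F' K ∧ firstBetti F' ≤ firstBetti F + 1 :=
  h.elim (fun h => exists_surface_of_reverse_bandMove h hF hK')
    fun h => exists_surface_of_bandMove h hF hK'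

lemma gamma4_le_firstBetti_add_one (h : RelatedByNonOrientedBandMove K K')
    (hF : IsProperSurface F) (hK' : HasBoundary F K') : gamma4 K ≤ firstBetti F + 1 := by
  obtain ⟨F', h1, h2, h3, h4⟩ := exists_surface_of_related h hF hK'
  have h5 : gamma4 K ≤ firstBetti F' := sInf_le ⟨F', h1, h2, h3, rfl⟩
  exact h5.trans h4

lemma one_le_gamma4 (K : Knot) : 1 ≤ gamma4 K := by
  refine le_sInf ?_
  rintro _ ⟨F, h1, h2, -, rfl⟩
  rw [Order.one_le_iff_ne_zero]
  exact fun h0 => h2 (h1.isOrientable_of_firstBetti_eq_zero h0)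

lemma gamma4_le_add_one (h : RelatedByNonOrientedBandMove K K') : gamma4 K ≤ gamma4 K' + 1 := by
  by_cases hne : {n | ∃ F : Set E4, IsProperSurface F ∧ ¬ IsOrientable F ∧ HasBoundary F K' ∧
    firstBetti F = n}.Nonempty
  · obtain ⟨F, h1, -, h3, h4⟩ := csInf_mem hne
    rw [gamma4.eq_1 K', ← h4]
    exact gamma4_le_firstBetti_add_one h h1 h3
  -- The infimum of the empty set in `ℕ∞` is `⊤`, so the inequality is trivial in this case.
  · rw [gamma4.eq_1 K', Set.not_nonempty_iff_eq_empty.1 hne]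
    simp

lemma gamma4_eq_one_of_isSlice (h : RelatedByNonOrientedBandMove K K') (hs : IsSlice K') :
    gamma4 K = 1 := by
  obtain ⟨F, h1, h2, ⟨f⟩⟩ := hs
  refine le_antisymm ?_ (one_le_gamma4 K)
  have : ContractibleSpace (Metric.closedBall (0 : EuclideanSpace ℝ (Fin 2)) 1) :=
    (convex_closedBall _ _).contractibleSpace ⟨0, by simp⟩
  have h0 : firstBetti F = 0 := by
    rw [firstBetti_congr f, firstBetti_eq_zero_of_contractibleSpace]
  simpa [h0] using gamma4_le_firstBetti_add_one h h1 h2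

end Main
end FourGenus

theorem proposition2p6 (K K' : FourGenus.Knot)
    (h : FourGenus.RelatedByNonOrientedBandMove K K') :
    FourGenus.gamma4 K ≤ FourGenus.gamma4 K' + 1 ∧
      (FourGenus.IsSlice K' → FourGenus.gamma4 K = 1) := by
  exact ⟨FourGenus.gamma4_le_add_one h, FourGenus.gamma4_eq_one_of_isSlice h⟩
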